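/- **Setting.** Let $\rho,z$ be smooth on $[0,\pi]$ with $z(\phi)\sin\phi=\rho(\phi)\cos\phi$ (so $\phi$ is the polar angle of $(\rho(\phi),z(\phi))$), $\rho(0)=\rho(\pi)=0$, $\rho>0$ in $(0,\pi)$, $z'(0)=z'(\pi)=0$ and $\gamma:=\sqrt{(\rho')^2+(z')^2}\ge c>0$, and let $$\mathcal M=\{(\rho(\phi)\cos\theta,\rho(\phi)\sin\theta,z(\phi)):\ \phi\in[0,\pi],\ \theta\in[0,2\pi]\}\subset\mathbb R^3,$$ with area form $\rho\gamma\,d\theta\,d\phi$. Let $\mathbf A=a(\phi)\,d\theta$ be an axially symmetric potential, with $a\in C^1([0,\pi])$ such that $a(0)=a(\pi)=0$, $a>0$ in $(0,\pi)$, and, for some $0<\phi_1<\phi_2<\phi_3<\pi$, $a'>0$ in $(0,\phi_1)\cup(\phi_2,\phi_3)$ and $a'<0$ in $(\phi_1,\phi_2)\cup(\phi_3,\pi)$. Put $a_i=a(\phi_i)$ and assume $a_1<a_3$. Assume that the induced field $H=a'/(\rho\gamma)$ extends to a $C^1$ function on $\mathcal M$. Let $*F$ be the function of $\phi$ (unique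 up to a constant) with $(*F)'=a\gamma/\rho$, and put $\beta_c=\max(*F)-\min(*F)$. For $0<\beta<\beta_c$ let $V_\beta$ be the solution of the two-sided obstacle problem $$\min\Big\{\int_{\mathcal M}\big(|\nabla V|^2+2HV\big)\ :\ V\in H^1(\mathcal M),\ |V|\le\beta/2\Big\},$$ and let $SC_\beta=\{|V_\beta|<\beta/2\}\subset\mathcal M$. (This solution exists, is unique, and has a continuous representative, which is used in the definition of $SC_\beta$.) For $\alpha\in(a_2,a_1)$ the level set $\{a=\alpha\}$ consists of exactly four points $\phi_-<\psi_+<\psi_-<\phi_+$ (depending on $\alpha$). Put $$I_-(\alpha)=\int_{\phi_-}^{\psi_+}(a-\alpha)\frac{\gamma}{\rho}\,d\phi,\qquad I_+(\alpha)=\int_{\psi_-}^{\phi_+}(a-\alpha)\frac{\gamma}{\rho}\,d\phi,\qquad J(\alpha)=-\int_{\psi_+}^{\psi_-}(a-\alpha)\frac{\gamma}{\rho}\,d\phi.$$ **Proposition.** There is a (necessarily unique) $\alpha^*\in(a_2,a_1)$ such that $J<\min(I_-,I_+)$ on $(a_2,\alpha^*)$ and $\min(I_-,I_+)<J$ on $(\alpha^*,a_1)$.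 Put $$\beta_1^*=\max\big(I_-(\alpha^*),I_+(\alpha^*)\big),\qquad \beta_2^*=\min\big(I_-(\alpha^*),I_+(\alpha^*)\big).$$ Then $\beta_c>\beta_1^*\ge\beta_2^*>0$. Moreover, identifying an interval $(s,t)$, $0<s<t<\pi$, with the set of the points of $\mathcal M$ for which $\phi\in(s,t)$: - for $\beta_1^*<\beta<\beta_c$, $SC_\beta$ is an open interval; - for $\beta_2^*<\beta<\beta_1^*$, $SC_\beta$ is the union of two open intervals with disjoint closures, one of which does not depend on $\beta$; - for $0<\beta<\beta_2^*$, $SC_\beta$ is the union of three open intervals with pairwise disjoint closures. -/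

import Mathlib

open MeasureTheory Set Filter Topology
open scoped Real ContDiff

namespace Shell

/-- Ambient Euclidean space. -/
abbrev E3 : Type := EuclideanSpace ℝ (Fin 3)

/-- Profile curve `φ ↦ (ρ φ, z φ)`, `φ ∈ [0, π]`, of a closed surface of revolution around the
vertical axis. A smooth function on `[0, π]` is represented by a smooth function on `ℝ`, of which
only the restriction to `[0, π]` is ever used. The parameter `φ` is the polar angle of the point
`(ρ φ, z φ)`: the relation `z tan φ = ρ` is written without denominators, since it means `z = 0`
at `φ = π / 2`. -/
structure Profile where
  ρ : ℝ → ℝ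
  z : ℝ → ℝ
  smooth_ρ : ContDiff ℝ ∞ ρ
  smooth_z : ContDiff ℝ ∞ z
  polar_angle : ∀ φ ∈ Icc 0 π, z φ * Real.sin φ = ρ φ * Real.cos φ
  ρ_zero : ρ 0 = 0
  ρ_pi : ρ π = 0
  ρ_pos : ∀ φ ∈ Ioo 0 π, 0 < ρ φ
  deriv_z_zero : deriv z 0 = 0
  deriv_z_pi : deriv z π = 0
  speed_pos : ∃ c > 0, ∀ φ ∈ Icc 0 π, c ≤ √(deriv ρ φ ^ 2 + deriv z φ ^ 2)

noncomputable section

namespace Profile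

variable (S : Profile)

/-- The speed `γ` of the profile curve. -/
def γ (φ : ℝ) : ℝ := √(deriv S.ρ φ ^ 2 + deriv S.z φ ^ 2)

/-- The point of the surface with coordinates `q = (φ, θ)`. -/
def point (q : ℝ × ℝ) : E3 :=
  !₂[S.ρ q.1 * Real.cos q.2, S.ρ q.1 * Real.sin q.2, S.z q.1]

/-- The surface of revolution. -/
def surface : Set E3 := S.point '' (Icc 0 π ×ˢ Icc 0 (2 * π))

/-- The part of the surface where `φ` lies in the open interval `(s, t)`. -/
def band (s t : ℝ) : Set E3 := S.point '' (Ioo s t ×ˢ Icc 0 (2 * π))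

/-- The area measure `ρ γ dφ dθ`, in the coordinates `(φ, θ)`. -/
def area : Measure (ℝ × ℝ) :=
  (volume.restrict (Icc 0 π ×ˢ Icc 0 (2 * π))).withDensity
    (fun q => ENNReal.ofReal (S.ρ q.1 * S.γ q.1))

/-- `f` represents a `C¹` function on the surface: it is `C¹` in the ambient space near each point
of the surface. -/
def IsC1 (f : E3 → ℝ) : Prop := ∀ p ∈ S.surface, ContDiffAt ℝ 1 f p

/-- The gradient on the surface of a `C¹` function `f`, in coordinates: its components
`γ⁻¹ ∂f/∂φ` and `ρ⁻¹ ∂f/∂θ` in the orthonormal frame `(e_φ, e_θ)` tangent to the surface. -/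
def grad (f : E3 → ℝ) (q : ℝ × ℝ) : EuclideanSpace ℝ (Fin 2) :=
  !₂[deriv (fun φ => f (S.point (φ, q.2))) q.1 / S.γ q.1,
     deriv (fun θ => f (S.point (q.1, θ))) q.2 / S.ρ q.1]

/-- `V` (which matters only on the surface) belongs to the Sobolev space `H¹` of the surface, the
completion of the `C¹` functions for the norm `(∫ V² + ∫ |∇V|²)^(1/2)`, and its gradient, expressed
in the orthonormal frame `(e_φ, e_θ)`, is `G`. -/
def HasSobolevGrad (V : E3 → ℝ) (G : ℝ × ℝ → EuclideanSpace ℝ (Fin 2)) : Prop :=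
  MemLp (fun q => V (S.point q)) 2 S.area ∧ MemLp G 2 S.area ∧
  ∃ f : ℕ → E3 → ℝ, (∀ n, S.IsC1 (f n)) ∧
    Tendsto (fun n => eLpNorm (fun q => f n (S.point q) - V (S.point q)) 2 S.area) atTop (𝓝 0) ∧
    Tendsto (fun n => eLpNorm (fun q => S.grad (f n) q - G q) 2 S.area) atTop (𝓝 0)

/-- `∫ (|∇V|² + 2 H V)` over the surface, for `V` with gradient `G`. -/
def energy (H V : E3 → ℝ) (G : ℝ × ℝ → EuclideanSpace ℝ (Fin 2)) : ℝ :=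
  ∫ q, (‖G q‖ ^ 2 + 2 * H (S.point q) * V (S.point q)) ∂S.area

/-- `V` solves the two-sided obstacle problem: it minimizes `∫ (|∇V|² + 2 H V)` among all `H¹`
functions with `|V| ≤ β / 2` almost everywhere on the surface. -/
def IsSolution (H : E3 → ℝ) (β : ℝ) (V : E3 → ℝ) : Prop :=
  ∃ G, S.HasSobolevGrad V G ∧ (∀ᵐ q ∂S.area, |V (S.point q)| ≤ β / 2) ∧
    ∀ W G', S.HasSobolevGrad W G' → (∀ᵐ q ∂S.area, |W (S.point q)| ≤ β / 2) →
      S.energy H V G ≤ S.energy H W G'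

/-- `V` is the solution `V_β` of the obstacle problem: it is a continuous solution, and every
solution agrees with it almost everywhere. -/
def IsTheSolution (H : E3 → ℝ) (β : ℝ) (V : E3 → ℝ) : Prop :=
  ContinuousOn V S.surface ∧ S.IsSolution H β V ∧
    ∀ W, S.IsSolution H β W → ∀ᵐ q ∂S.area, W (S.point q) = V (S.point q)

/-- The superconductivity region `{|V| < β / 2}`, for the solution `V = V_β`. -/
def SC (β : ℝ) (V : E3 → ℝ) : Set E3 := {p ∈ S.surface | |V p| < β / 2}

/-- `H` is the field induced by the potential `A = a(φ) dθ`: a `C¹` function on the surface with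
`dA = H · (area form)`, that is, `H = a' / (ρ γ)`. -/
def IsInducedField (a : ℝ → ℝ) (H : E3 → ℝ) : Prop :=
  S.IsC1 H ∧ ∀ φ ∈ Icc 0 π, ∀ θ, deriv a φ = H (S.point (φ, θ)) * (S.ρ φ * S.γ φ)

/-- The function `*F` of `φ`, normalized by `*F(0) = 0`: `(*F)' = a γ / ρ`. -/
def starF (a : ℝ → ℝ) (φ : ℝ) : ℝ := ∫ t in (0 : ℝ)..φ, a t * (S.γ t / S.ρ t)

/-- `β_c = max (*F) - min (*F)`. -/
def betaC (a : ℝ → ℝ) : ℝ := sSup (S.starF a '' Icc 0 π) - sInf (S.starF a '' Icc 0 π)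

/-- The integral `∫ (a - α) γ / ρ dφ` over the interval from `s` to `t`. -/
def levelInt (a : ℝ → ℝ) (α s t : ℝ) : ℝ := ∫ φ in s..t, (a φ - α) * (S.γ φ / S.ρ φ)

end Profile

end

/-- The assumptions on the shape of `a`: it vanishes at the poles, is positive in between, increases
strictly on `(0, φ₁)` and `(φ₂, φ₃)`, decreases strictly on `(φ₁, φ₂)` and `(φ₃, π)`, with its lower
maximum at `φ₁`. -/
structure IsDoubleBump (a : ℝ → ℝ) (φ₁ φ₂ φ₃ : ℝ) : Prop where
  contDiff : ContDiff ℝ 1 a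
  zero : a 0 = 0
  pi : a π = 0
  pos : ∀ φ ∈ Ioo 0 π, 0 < a φ
  order : 0 < φ₁ ∧ φ₁ < φ₂ ∧ φ₂ < φ₃ ∧ φ₃ < π
  incr₁ : ∀ φ ∈ Ioo 0 φ₁, 0 < deriv a φ
  decr₁ : ∀ φ ∈ Ioo φ₁ φ₂, deriv a φ < 0
  incr₂ : ∀ φ ∈ Ioo φ₂ φ₃, 0 < deriv a φ
  decr₂ : ∀ φ ∈ Ioo φ₃ π, deriv a φ < 0
  lower : a φ₁ < a φ₃

end Shell

/-! The solution is written down as a function v of φ and then verified. On a component (s, t) of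
the free region the Euler equation is (v'ρ/γ)' = a', so v' = (a - α)γ/ρ for some level α, and C¹
contact with the obstacles forces a(s) = a(t) = α. Off the free region, v may lie on the lower
obstacle only where a' ≥ 0 and on the upper one only where a' ≤ 0.

These conditions suffice (`IsFree.isTheSolution`). If W is a competitor with gradient G, the weak
equation gives E(W) = E(V) + ∫|G - ∇V|² + 2∫ H(W - V), the last integral being over the contact set
(`IsFree.energy_eq`), and its integrand is nonnegative (`contact_nonneg`). If E(W) = E(V), then W
and V have the same gradient and agree at the contact points where H ≠ 0, in particular near the
pole φ = 0. A Poincaré inequality on slices then gives W = V (`ae_eq_zero_of_tendsto`).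

It remains to find the free intervals. Let M(α) and P(α) be the areas, with weight γ/ρ, of the left
and right peaks of a above α, and D(α) the area of the valley below α; on (a₂, a₁) these are I₋, I₊
and J. Written as integrals of truncations over fixed intervals (`excess`, `deficit`), they are
continuous in α; M and P are nonincreasing and D is strictly increasing on [a₂, a₁]. Hence D crosses
min(M, P) exactly once there, at α* (`exists_critical_level`).

One interval: for α < α* the valley is smaller than both peaks, so the primitive of (a - α)γ/ρ on
(φ₋, φ₊) stays strictly between its end values 0 and M + P - D; the latter goes from β_c at α = 0 to
max(M, P) at α*. Two intervals: at α* the smaller peak and the valley cancel, which gives an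
excursion from one obstacle back to itself, independent of β; the larger peak is crossed at the
level where its area is β. Three intervals: for β below D(α*), the left peak, the valley and the
right peak are crossed separately, at levels where M, D and P equal β. -/

namespace Shell

namespace Profile

variable (S : Profile)

/-! ### The geometry of the profile curve -/

lemma differentiable_ρ : Differentiable ℝ S.ρ := S.smooth_ρ.differentiable (by simp)

lemma differentiable_z : Differentiable ℝ S.z := S.smooth_z.differentiable (by simp)

lemma continuous_ρ : Continuous S.ρ := S.smooth_ρ.continuous

lemma continuous_γ : Continuous S.γ := by
  have h1 := S.smooth_ρ.continuous_deriv (by simp)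
  have h2 := S.smooth_z.continuous_deriv (by simp)
  unfold γ
  fun_prop

lemma γ_pos {φ : ℝ} (hφ : φ ∈ Icc 0 π) : 0 < S.γ φ := by
  obtain ⟨c, hc, h⟩ := S.speed_pos
  exact hc.trans_le (h φ hφ)

lemma γ_nonneg (φ : ℝ) : 0 ≤ S.γ φ := Real.sqrt_nonneg _

lemma ρ_nonneg {φ : ℝ} (hφ : φ ∈ Icc 0 π) : 0 ≤ S.ρ φ := by
  rcases eq_or_lt_of_le hφ.1 with h | h
  · rw [← h, S.ρ_zero]
  rcases eq_or_lt_of_le hφ.2 with h' | h'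
  · rw [h', S.ρ_pi]
  exact (S.ρ_pos φ ⟨h, h'⟩).le

/-- At the pole z' = 0, so the positive speed is carried by ρ'; since ρ > 0 on the right of 0, the
slope cannot be negative. -/
lemma deriv_ρ_zero_pos : 0 < deriv S.ρ 0 := by
  have hne : deriv S.ρ 0 ≠ 0 := by
    intro h
    have := S.γ_pos (φ := 0) ⟨le_rfl, Real.pi_pos.le⟩
    simp [γ, h, S.deriv_z_zero] at this
  refine lt_of_le_of_ne ?_ hne.symm
  by_contra! hlt
  have h := (hasDerivAt_iff_tendsto_slope.1 (S.differentiable_ρ 0).hasDerivAt).eventually_lt_const hlt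
  have h2 : ∀ᶠ x in 𝓝[>] (0 : ℝ), slope S.ρ 0 x < 0 :=
    h.filter_mono (nhdsWithin_mono _ fun x (hx : 0 < x) => hx.ne')
  obtain ⟨x, hx, hx'⟩ := (h2.and (Ioo_mem_nhdsGT Real.pi_pos)).exists
  have := S.ρ_pos x hx'
  rw [slope_def_field, S.ρ_zero, sub_zero, sub_zero] at hx
  exact absurd (div_pos this hx'.1) hx.not_gt

lemma deriv_ρ_pi_neg : deriv S.ρ π < 0 := by
  have hne : deriv S.ρ π ≠ 0 := by
    intro h
    have := S.γ_pos (φ := π) ⟨Real.pi_pos.le, le_rfl⟩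
    simp [γ, h, S.deriv_z_pi] at this
  refine lt_of_le_of_ne ?_ hne
  by_contra! hlt
  have h := (hasDerivAt_iff_tendsto_slope.1
    (S.differentiable_ρ π).hasDerivAt).eventually_const_lt hlt
  have h2 : ∀ᶠ x in 𝓝[<] π, 0 < slope S.ρ π x :=
    h.filter_mono (nhdsWithin_mono _ fun x (hx : x < π) => hx.ne)
  obtain ⟨x, hx, hx'⟩ := (h2.and (Ioo_mem_nhdsLT Real.pi_pos)).exists
  have := S.ρ_pos x hx'
  rw [slope_def_field, S.ρ_pi, sub_zero] at hx
  exact absurd (div_neg_of_pos_of_neg this (by linarith [hx'.2])) hx.not_gt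

lemma hasDerivAt_polar_relation (φ : ℝ) :
    HasDerivAt (fun x => S.z x * Real.sin x - S.ρ x * Real.cos x)
      (deriv S.z φ * Real.sin φ + S.z φ * Real.cos φ -
        (deriv S.ρ φ * Real.cos φ + S.ρ φ * (-Real.sin φ))) φ :=
  ((S.differentiable_z φ).hasDerivAt.mul (Real.hasDerivAt_sin φ)).sub
    ((S.differentiable_ρ φ).hasDerivAt.mul (Real.hasDerivAt_cos φ))

/-- The polar relation is known on [0, π] only, hence the derivative within that interval. At the
poles, where the relation itself is void, its derivative identifies z with ρ'. -/
lemma deriv_polar_relation {φ : ℝ} (hφ : φ ∈ Icc 0 π) :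
    deriv S.z φ * Real.sin φ + S.z φ * Real.cos φ -
        (deriv S.ρ φ * Real.cos φ + S.ρ φ * (-Real.sin φ)) = 0 := by
  refine UniqueDiffWithinAt.eq_deriv (Icc 0 π) (uniqueDiffOn_Icc Real.pi_pos φ hφ)
    (S.hasDerivAt_polar_relation φ).hasDerivWithinAt ?_
  refine (hasDerivWithinAt_const φ (Icc 0 π) (0 : ℝ)).congr ?_ ?_
  · intro x hx
    linarith [S.polar_angle x hx]
  · linarith [S.polar_angle φ hφ]

lemma z_zero : S.z 0 = deriv S.ρ 0 := by
  have := S.deriv_polar_relation (φ := 0) ⟨le_rfl, Real.pi_pos.le⟩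
  simp at this
  linarith

lemma z_pi : S.z π = deriv S.ρ π := by
  have := S.deriv_polar_relation (φ := π) ⟨Real.pi_pos.le, le_rfl⟩
  simp at this
  linarith

lemma norm_point_sq (q : ℝ × ℝ) : ‖S.point q‖ ^ 2 = S.ρ q.1 ^ 2 + S.z q.1 ^ 2 := by
  rw [EuclideanSpace.norm_sq_eq]
  simp only [point, Fin.sum_univ_three, Real.norm_eq_abs, sq_abs, Matrix.cons_val_zero,
    Matrix.cons_val_one, Matrix.cons_val]
  linear_combination S.ρ q.1 ^ 2 * Real.sin_sq_add_cos_sq q.2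

@[simp] lemma point_apply_two (q : ℝ × ℝ) : S.point q 2 = S.z q.1 := by simp [point]

/-- Needed for the polar angle to be continuous along the surface. Only the poles are at issue, and
there z = ρ' ≠ 0. -/
lemma point_ne_zero {q : ℝ × ℝ} (hq : q.1 ∈ Icc 0 π) : S.point q ≠ 0 := by
  intro h
  have h1 := S.norm_point_sq q
  rw [h, norm_zero] at h1
  have hz : S.z q.1 = 0 := by nlinarith [sq_nonneg (S.ρ q.1), sq_nonneg (S.z q.1)]
  have hρ : S.ρ q.1 = 0 := by nlinarith [sq_nonneg (S.ρ q.1), sq_nonneg (S.z q.1)]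
  rcases eq_or_lt_of_le hq.1 with h0 | h0
  · rw [← h0, S.z_zero] at hz
    exact S.deriv_ρ_zero_pos.ne' hz
  rcases eq_or_lt_of_le hq.2 with h' | h'
  · rw [h', S.z_pi] at hz
    exact S.deriv_ρ_pi_neg.ne hz
  exact (S.ρ_pos _ ⟨h0, h'⟩).ne' hρ

/-- Inside (0, π) the norm is ρ / sin φ by the polar relation. At the poles only the sign of z
matters, and it is that of ρ'. -/
lemma z_eq_norm_mul_cos {q : ℝ × ℝ} (hq : q.1 ∈ Icc 0 π) :
    S.z q.1 = ‖S.point q‖ * Real.cos q.1 := by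
  have h1 := S.norm_point_sq q
  rcases eq_or_lt_of_le hq.1 with h0 | h0
  · have hz : 0 < S.z q.1 := by rw [← h0, S.z_zero]; exact S.deriv_ρ_zero_pos
    have hρ : S.ρ q.1 = 0 := by rw [← h0, S.ρ_zero]
    rw [hρ, zero_pow two_ne_zero, zero_add] at h1
    rw [← h0, Real.cos_zero, mul_one, h0]
    exact ((sq_eq_sq₀ (norm_nonneg _) hz.le).1 h1).symm
  rcases eq_or_lt_of_le hq.2 with h' | h'
  · have hz : S.z q.1 < 0 := by rw [h', S.z_pi]; exact S.deriv_ρ_pi_neg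
    have hρ : S.ρ q.1 = 0 := by rw [h', S.ρ_pi]
    rw [hρ, zero_pow two_ne_zero, zero_add] at h1
    have : ‖S.point q‖ = -S.z q.1 :=
      (sq_eq_sq₀ (norm_nonneg _) (by linarith)).1 (by linarith [neg_sq (S.z q.1)])
    rw [this, h', Real.cos_pi]
    ring
  · have hs : 0 < Real.sin q.1 := Real.sin_pos_of_pos_of_lt_pi h0 h'
    have hρ := S.ρ_pos q.1 ⟨h0, h'⟩
    have hp := S.polar_angle q.1 hq
    have hn : ‖S.point q‖ = S.ρ q.1 / Real.sin q.1 := by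
      refine (sq_eq_sq₀ (norm_nonneg _) (by positivity)).1 ?_
      rw [h1, div_pow, eq_div_iff (by positivity)]
      have : S.z q.1 ^ 2 * Real.sin q.1 ^ 2 = S.ρ q.1 ^ 2 * Real.cos q.1 ^ 2 := by
        rw [← mul_pow, hp, mul_pow]
      linear_combination this + S.ρ q.1 ^ 2 * Real.sin_sq_add_cos_sq q.1
    rw [hn, div_mul_eq_mul_div, eq_div_iff hs.ne', hp]

lemma contDiff_point : ContDiff ℝ ∞ S.point := by
  rw [contDiff_euclidean]
  intro i
  have hρ : ContDiff ℝ ∞ fun q : ℝ × ℝ => S.ρ q.1 := S.smooth_ρ.comp contDiff_fst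
  have hz : ContDiff ℝ ∞ fun q : ℝ × ℝ => S.z q.1 := S.smooth_z.comp contDiff_fst
  fin_cases i
  · simpa [point] using hρ.mul (Real.contDiff_cos.comp contDiff_snd)
  · simpa [point] using hρ.mul (Real.contDiff_sin.comp contDiff_snd)
  · simpa [point] using hz

lemma point_mem_surface {q : ℝ × ℝ} (hq : q ∈ Icc 0 π ×ˢ Icc 0 (2 * π)) :
    S.point q ∈ S.surface := mem_image_of_mem _ hq

end Profile

/-- The polar angle of a point of space. -/
noncomputable def polar (p : E3) : ℝ := Real.arccos (p 2 / ‖p‖)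

lemma polar_point (S : Profile) {q : ℝ × ℝ} (hq : q.1 ∈ Icc 0 π) : polar (S.point q) = q.1 := by
  have := norm_pos_iff.2 (S.point_ne_zero hq)
  rw [polar, S.point_apply_two, S.z_eq_norm_mul_cos hq, mul_div_cancel_left₀ _ this.ne',
    Real.arccos_cos hq.1 hq.2]

lemma continuousAt_polar {p : E3} (hp : p ≠ 0) : ContinuousAt polar p := by
  have h1 : ContinuousAt (fun p : E3 => p 2) p := by fun_prop
  exact Real.continuous_arccos.continuousAt.comp
    (h1.div continuous_norm.continuousAt (norm_ne_zero_iff.2 hp))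

/-! ### C¹ functions on the surface and their slices -/

namespace Profile

variable (S : Profile)

/-- A `C¹` function of the polar angle, locally constant near the poles, is `C¹` on the surface. -/
lemma isC1_comp_polar {v : ℝ → ℝ} (hv : ContDiff ℝ 1 v) (h0 : ∀ᶠ x in 𝓝 0, v x = v 0)
    (hπ : ∀ᶠ x in 𝓝 π, v x = v π) : S.IsC1 (fun p => v (polar p)) := by
  rintro p ⟨q, hq, rfl⟩
  have hne := S.point_ne_zero hq.1
  have hc := continuousAt_polar hne
  have hpol := polar_point S hq.1
  rcases eq_or_lt_of_le hq.1.1 with h | h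
  -- At a pole the cosine is ±1, where `Real.arccos` is not differentiable. Continuity of the polar
  -- angle is enough, because v is constant near the end values.
  · refine (contDiffAt_const (c := v 0)).congr_of_eventuallyEq ?_
    rw [ContinuousAt, hpol, ← h] at hc
    exact hc.eventually h0
  rcases eq_or_lt_of_le hq.1.2 with h' | h'
  · refine (contDiffAt_const (c := v π)).congr_of_eventuallyEq ?_
    rw [ContinuousAt, hpol, h'] at hc
    exact hc.eventually hπ
  refine hv.contDiffAt.comp _ ?_
  have hcos : S.point q 2 / ‖S.point q‖ = Real.cos q.1 := by
    have := norm_pos_iff.2 hne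
    rw [S.point_apply_two, S.z_eq_norm_mul_cos hq.1, mul_div_cancel_left₀ _ this.ne']
  have h1 : ContDiffAt ℝ 1 (fun p : E3 => p 2 / ‖p‖) (S.point q) := by
    refine ContDiffAt.div ?_ (contDiffAt_norm ℝ hne) (norm_ne_zero_iff.2 hne)
    exact (contDiff_euclidean.1 (contDiff_id (𝕜 := ℝ) (E := E3)) 2).contDiffAt
  refine ContDiffAt.comp (S.point q) (g := Real.arccos) ?_ h1
  have hs : 0 < Real.sin q.1 := Real.sin_pos_of_pos_of_lt_pi h h'
  have hsc := Real.sin_sq_add_cos_sq q.1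
  refine Real.contDiffAt_arccos ?_ ?_
  · rw [hcos]; intro hh; rw [hh] at hsc; nlinarith
  · rw [hcos]; intro hh; rw [hh] at hsc; nlinarith

lemma IsC1.contDiffAt_comp_point {f : E3 → ℝ} (hf : S.IsC1 f) {q : ℝ × ℝ}
    (hq : q ∈ Icc 0 π ×ˢ Icc 0 (2 * π)) : ContDiffAt ℝ 1 (fun q => f (S.point q)) q :=
  (hf _ (S.point_mem_surface hq)).comp q (S.contDiff_point.of_le (by simp)).contDiffAt

lemma IsC1.continuousOn_comp_point {f : E3 → ℝ} (hf : S.IsC1 f) :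
    ContinuousOn (fun q => f (S.point q)) (Icc 0 π ×ˢ Icc 0 (2 * π)) := fun _ hq =>
  (IsC1.contDiffAt_comp_point S hf hq).continuousAt.continuousWithinAt

lemma IsC1.contDiffAt_slice {f : E3 → ℝ} (hf : S.IsC1 f) {q : ℝ × ℝ}
    (hq : q ∈ Icc 0 π ×ˢ Icc 0 (2 * π)) :
    ContDiffAt ℝ 1 (fun x => f (S.point (x, q.2))) q.1 := by
  have h : ContDiffAt ℝ 1 (fun x : ℝ => (x, q.2)) q.1 := contDiffAt_id.prodMk contDiffAt_const
  exact ContDiffAt.comp (g := fun q => f (S.point q)) q.1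
    (IsC1.contDiffAt_comp_point S hf hq) h

lemma IsC1.deriv_slice {f : E3 → ℝ} (hf : S.IsC1 f) {q : ℝ × ℝ}
    (hq : q ∈ Icc 0 π ×ˢ Icc 0 (2 * π)) :
    deriv (fun x => f (S.point (x, q.2))) q.1 = fderiv ℝ (fun q => f (S.point q)) q (1, 0) := by
  have h : HasDerivAt (fun x : ℝ => (x, q.2)) (1, 0) q.1 :=
    (hasDerivAt_id q.1).prodMk (hasDerivAt_const _ _)
  have h2 := ((IsC1.contDiffAt_comp_point S hf hq).differentiableAt (by simp)).hasFDerivAt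
  exact (HasFDerivAt.comp_hasDerivAt (l := fun q => f (S.point q)) q.1 h2 h).deriv

lemma IsC1.continuousOn_deriv_slice {f : E3 → ℝ} (hf : S.IsC1 f) :
    ContinuousOn (fun q : ℝ × ℝ => deriv (fun x => f (S.point (x, q.2))) q.1)
      (Icc 0 π ×ˢ Icc 0 (2 * π)) := by
  refine ContinuousOn.congr (f := fun q => fderiv ℝ (fun q => f (S.point q)) q (1, 0)) ?_
    fun _ hq => IsC1.deriv_slice S hf hq
  intro q hq
  have := (IsC1.contDiffAt_comp_point S hf hq).continuousAt_fderiv (by simp)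
  exact (this.clm_apply continuousAt_const).continuousWithinAt

/-! ### The weight `γ / ρ` -/

lemma continuousOn_weight : ContinuousOn (fun x => S.γ x / S.ρ x) (Ioo 0 π) :=
  S.continuous_γ.continuousOn.div S.continuous_ρ.continuousOn fun x hx => (S.ρ_pos x hx).ne'

lemma weight_pos {φ : ℝ} (hφ : φ ∈ Ioo 0 π) : 0 < S.γ φ / S.ρ φ :=
  div_pos (S.γ_pos (Ioo_subset_Icc_self hφ)) (S.ρ_pos φ hφ)

lemma weight_nonneg {φ : ℝ} (hφ : φ ∈ Icc 0 π) : 0 ≤ S.γ φ / S.ρ φ :=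
  div_nonneg (S.γ_nonneg φ) (S.ρ_nonneg hφ)

/-- At a zero `c` of `ρ` where `ρ' ≠ 0`, a function vanishing to first order, times the weight
`γ / ρ`, is continuous. -/
lemma continuousAt_mul_weight {a : ℝ → ℝ} {c : ℝ} (ha : HasDerivAt a 0 c) (hac : a c = 0)
    (hρ : S.ρ c = 0) (hρ' : deriv S.ρ c ≠ 0) :
    ContinuousAt (fun x => a x * (S.γ x / S.ρ x)) c := by
  rw [continuousAt_iff_punctured_nhds]
  have h1 := hasDerivAt_iff_tendsto_slope.1 ha
  have h2 := hasDerivAt_iff_tendsto_slope.1 (S.differentiable_ρ c).hasDerivAt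
  have h3 : Tendsto S.γ (𝓝[≠] c) (𝓝 (S.γ c)) := S.continuous_γ.continuousAt.mono_left inf_le_left
  have h4 := (h1.div h2 hρ').mul h3
  -- The value at c is 0 because a c = 0, whatever the junk value of γ / ρ; the limit is (0 / ρ'(c))
  -- γ(c) = 0, from the quotient of the slopes of a and ρ.
  simp only [hac, zero_mul, zero_div] at h4 ⊢
  refine h4.congr' ?_
  filter_upwards [self_mem_nhdsWithin] with x hx
  have hx' : x - c ≠ 0 := sub_ne_zero.2 hx
  simp only [Pi.div_apply, slope_def_field, hac, hρ, sub_zero]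
  rw [div_div_div_cancel_right₀ hx']
  ring

end Profile

namespace Profile

variable (S : Profile)

/-! ### The area measure -/

/-- The rectangle of the coordinates `(φ, θ)`. -/
abbrev rect : Set (ℝ × ℝ) := Icc 0 π ×ˢ Icc 0 (2 * π)

lemma measurableSet_rect : MeasurableSet rect := measurableSet_Icc.prod measurableSet_Icc

lemma isCompact_rect : IsCompact rect := isCompact_Icc.prod isCompact_Icc

lemma restrict_rect_eq_prod : (volume : Measure (ℝ × ℝ)).restrict rect =
    (volume.restrict (Icc 0 π)).prod (volume.restrict (Icc 0 (2 * π))) := by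
  rw [Measure.prod_restrict, Measure.volume_eq_prod]

lemma continuous_density : Continuous fun q : ℝ × ℝ => S.ρ q.1 * S.γ q.1 :=
  (S.continuous_ρ.comp continuous_fst).mul (S.continuous_γ.comp continuous_fst)

lemma density_nonneg {q : ℝ × ℝ} (hq : q ∈ rect) : 0 ≤ S.ρ q.1 * S.γ q.1 :=
  mul_nonneg (S.ρ_nonneg hq.1) (S.γ_nonneg _)

lemma measurable_density :
    Measurable fun q : ℝ × ℝ => ENNReal.ofReal (S.ρ q.1 * S.γ q.1) :=
  S.continuous_density.measurable.ennreal_ofReal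

lemma area_absolutelyContinuous : S.area ≪ volume.restrict rect :=
  withDensity_absolutelyContinuous _ _

instance : IsFiniteMeasure S.area := by
  refine isFiniteMeasure_withDensity_ofReal ?_
  exact (S.continuous_density.continuousOn.integrableOn_compact isCompact_rect).2

lemma ae_area_mem_rect : ∀ᵐ q ∂S.area, q ∈ rect :=
  S.area_absolutelyContinuous.ae_le (ae_restrict_mem measurableSet_rect)

lemma ae_area_fst_mem : ∀ᵐ q ∂S.area, q.1 ∈ Ioo 0 π := by
  rw [area, ae_withDensity_iff S.measurable_density]
  filter_upwards [ae_restrict_mem measurableSet_rect] with q hq hne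
  have h0 : S.ρ q.1 ≠ 0 := by
    rintro h
    simp [h] at hne
  refine ⟨lt_of_le_of_ne hq.1.1 ?_, lt_of_le_of_ne hq.1.2 ?_⟩
  · intro h; rw [← h, S.ρ_zero] at h0; exact h0 rfl
  · intro h; rw [h, S.ρ_pi] at h0; exact h0 rfl

lemma integral_area (F : ℝ × ℝ → ℝ) :
    ∫ q, F q ∂S.area = ∫ q in rect, S.ρ q.1 * S.γ q.1 * F q := by
  rw [area, integral_withDensity_eq_integral_toReal_smul S.measurable_density (by simp)]
  refine setIntegral_congr_fun measurableSet_rect fun q hq => ?_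
  simp only [smul_eq_mul]
  rw [ENNReal.toReal_ofReal (S.density_nonneg hq)]

lemma aestronglyMeasurable_area {E : Type*} [NormedAddCommGroup E] {F : ℝ × ℝ → E} (hF : ContinuousOn F rect) :
    AEStronglyMeasurable F S.area :=
  (hF.aestronglyMeasurable measurableSet_rect).mono_ac S.area_absolutelyContinuous

lemma memLp_area {E : Type*} [NormedAddCommGroup E] {F : ℝ × ℝ → E} (hF : ContinuousOn F rect) (p : ENNReal) :
    MemLp F p S.area := by
  obtain ⟨C, hC⟩ := isCompact_rect.exists_bound_of_continuousOn hF
  refine MemLp.of_bound (S.aestronglyMeasurable_area hF) C ?_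
  filter_upwards [S.ae_area_mem_rect] with q hq using hC q hq

/-- If `F n → F` in `L²`, then `∫ h F n → ∫ h F` for `h` in `L²`. -/
lemma tendsto_integral_mul {α : Type*} [MeasurableSpace α] {μ : Measure α} {h F : α → ℝ}
    {Fn : ℕ → α → ℝ} (hh : MemLp h 2 μ) (hF : MemLp F 2 μ) (hFn : ∀ n, MemLp (Fn n) 2 μ)
    (hlim : Tendsto (fun n => eLpNorm (fun q => Fn n q - F q) 2 μ) atTop (𝓝 0)) :
    Tendsto (fun n => ∫ q, h q * Fn n q ∂μ) atTop (𝓝 (∫ q, h q * F q ∂μ)) := by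
  refine tendsto_integral_of_L1' _ (hh.integrable_mul hF).aestronglyMeasurable
    (.of_forall fun n => hh.integrable_mul (hFn n)) ?_
  have hle : ∀ n, eLpNorm ((fun q => h q * Fn n q) - fun q => h q * F q) 1 μ ≤
      eLpNorm h 2 μ * eLpNorm (fun q => Fn n q - F q) 2 μ := by
    intro n
    have : ((fun q => h q * Fn n q) - fun q => h q * F q) = h • fun q => Fn n q - F q := by
      ext q
      simp [mul_sub]
    rw [this]
    exact eLpNorm_smul_le_mul_eLpNorm ((hFn n).sub hF).aestronglyMeasurable
      hh.aestronglyMeasurable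
  refine tendsto_of_tendsto_of_tendsto_of_le_of_le tendsto_const_nhds ?_ (fun _ => zero_le) hle
  simpa using ENNReal.Tendsto.const_mul hlim (Or.inr hh.2.ne)

/-! ### Functions of the polar angle satisfying the equation on a free region -/

/-- `v` is a `C¹` function of the polar angle, locally constant near the poles, which satisfies
weakly `(v' ρ / γ)' = a' · 1_T`. -/
structure IsFree (a v : ℝ → ℝ) (T : Set ℝ) : Prop where
  contDiff : ContDiff ℝ 1 v
  near_zero : ∀ᶠ x in 𝓝 0, v x = v 0
  near_pi : ∀ᶠ x in 𝓝 π, v x = v π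
  measurableSet : MeasurableSet T
  weak : ∀ f : ℝ → ℝ, (∀ x ∈ Icc 0 π, ContDiffAt ℝ 1 f x) →
    ∫ x in Icc 0 π, deriv v x * (S.ρ x / S.γ x) * deriv f x =
      -∫ x in Icc 0 π, T.indicator (fun x => deriv a x * f x) x

lemma continuous_deriv_of_contDiff {v : ℝ → ℝ} (hv : ContDiff ℝ 1 v) : Continuous (deriv v) :=
  hv.continuous_deriv le_rfl

lemma continuousOn_deriv_of_contDiffAt {f : ℝ → ℝ} {s : Set ℝ}
    (hf : ∀ x ∈ s, ContDiffAt ℝ 1 f x) : ContinuousOn (deriv f) s := fun x hx =>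
  ((hf x hx).continuousAt_fderiv (by simp)).clm_apply (continuousAt_const (y := (1 : ℝ)))
    |>.continuousWithinAt

lemma continuousOn_ρ_div_γ : ContinuousOn (fun x => S.ρ x / S.γ x) (Icc 0 π) :=
  S.continuous_ρ.continuousOn.div S.continuous_γ.continuousOn fun _ hx => (S.γ_pos hx).ne'

variable {S}

lemma IsFree.const (a : ℝ → ℝ) (c : ℝ) : S.IsFree a (fun _ => c) ∅ where
  contDiff := contDiff_const
  near_zero := by simp
  near_pi := by simp
  measurableSet := MeasurableSet.empty
  weak f _ := by simp

/-- The weak equation is linear in v, and disjointness makes the two indicators add up. This is what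
allows a solution to be glued from one piece per free interval. -/
lemma IsFree.add {a v v' : ℝ → ℝ} {T T' : Set ℝ} (ha : ContDiff ℝ 1 a) (h : S.IsFree a v T)
    (h' : S.IsFree a v' T') (hd : Disjoint T T') :
    S.IsFree a (fun x => v x + v' x) (T ∪ T') where
  contDiff := h.contDiff.add h'.contDiff
  near_zero := by
    filter_upwards [h.near_zero, h'.near_zero] with x h1 h2
    rw [h1, h2]
  near_pi := by
    filter_upwards [h.near_pi, h'.near_pi] with x h1 h2
    rw [h1, h2]
  measurableSet := h.measurableSet.union h'.measurableSet
  weak f hf := by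
    have hfc : ContinuousOn f (Icc 0 π) := fun x hx => (hf x hx).continuousAt.continuousWithinAt
    have hi : ∀ {u : ℝ → ℝ}, ContDiff ℝ 1 u →
        IntegrableOn (fun x => deriv u x * (S.ρ x / S.γ x) * deriv f x) (Icc 0 π) := fun hu =>
      (((continuous_deriv_of_contDiff hu).continuousOn.mul S.continuousOn_ρ_div_γ).mul
        (continuousOn_deriv_of_contDiffAt hf)).integrableOn_compact isCompact_Icc
    have hj : ∀ {A : Set ℝ}, MeasurableSet A →
        IntegrableOn (A.indicator fun x => deriv a x * f x) (Icc 0 π) := fun hA =>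
      Integrable.indicator (((continuous_deriv_of_contDiff ha).continuousOn.mul
        hfc).integrableOn_compact isCompact_Icc) hA
    rw [indicator_union_of_disjoint hd]
    rw [integral_add (hj h.measurableSet) (hj h'.measurableSet), neg_add, ← h.weak f hf,
      ← h'.weak f hf, ← integral_add (hi h.contDiff) (hi h'.contDiff)]
    refine integral_congr_ae (.of_forall fun x => ?_)
    have : deriv (fun x => v x + v' x) x = deriv v x + deriv v' x :=
      deriv_fun_add (h.contDiff.differentiable (by simp) x)
        (h'.contDiff.differentiable (by simp) x)
    simp only [this]
    ring

/-- Fubini: for each θ the slice of f is a test function for the one-dimensional equation. The area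
density ργ turns the two factors 1/γ into ρ/γ, and turns H into a'. -/
lemma IsFree.integral_mul_grad {a v : ℝ → ℝ} {T : Set ℝ} {H f : E3 → ℝ} (hv : S.IsFree a v T)
    (ha : ContDiff ℝ 1 a) (hH : S.IsInducedField a H) (hf : S.IsC1 f) :
    ∫ q, deriv v q.1 / S.γ q.1 * S.grad f q 0 ∂S.area =
      -∫ q, (Prod.fst ⁻¹' T).indicator (fun q => H (S.point q)) q * f (S.point q) ∂S.area := by
  rw [S.integral_area, S.integral_area]
  have e1 : ∫ q in rect, S.ρ q.1 * S.γ q.1 * (deriv v q.1 / S.γ q.1 * S.grad f q 0) =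
      ∫ q in rect, deriv v q.1 * (S.ρ q.1 / S.γ q.1) *
        deriv (fun x => f (S.point (x, q.2))) q.1 := by
    refine setIntegral_congr_fun measurableSet_rect fun q hq => ?_
    have := (S.γ_pos hq.1).ne'
    simp only [grad, Matrix.cons_val_zero]
    field_simp
  have e2 : ∫ q in rect, S.ρ q.1 * S.γ q.1 *
        ((Prod.fst ⁻¹' T).indicator (fun q => H (S.point q)) q * f (S.point q)) =
      ∫ q in rect, (Prod.fst ⁻¹' T).indicator (fun q => deriv a q.1 * f (S.point q)) q := by
    refine setIntegral_congr_fun measurableSet_rect fun q hq => ?_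
    by_cases hT : q.1 ∈ T
    · have := hH.2 q.1 hq.1 q.2
      simp only [indicator, mem_preimage, hT, if_true, this]
      ring
    · simp [indicator, mem_preimage, hT]
  rw [e1, e2]
  have c1 : ContinuousOn (fun q : ℝ × ℝ => deriv v q.1 * (S.ρ q.1 / S.γ q.1) *
      deriv (fun x => f (S.point (x, q.2))) q.1) rect := by
    refine ContinuousOn.mul (ContinuousOn.mul ?_ ?_) (IsC1.continuousOn_deriv_slice S hf)
    · exact ((continuous_deriv_of_contDiff hv.contDiff).comp continuous_fst).continuousOn
    · exact S.continuousOn_ρ_div_γ.comp continuous_fst.continuousOn fun q hq => hq.1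
  have c2 : ContinuousOn (fun q : ℝ × ℝ => deriv a q.1 * f (S.point q)) rect :=
    ((continuous_deriv_of_contDiff ha).comp continuous_fst).continuousOn.mul
      (IsC1.continuousOn_comp_point S hf)
  have i1 : IntegrableOn _ rect := c1.integrableOn_compact isCompact_rect
  have i2 : IntegrableOn _ rect :=
    Integrable.indicator (c2.integrableOn_compact isCompact_rect)
      (measurable_fst hv.measurableSet)
  rw [IntegrableOn, restrict_rect_eq_prod] at i1 i2
  rw [restrict_rect_eq_prod, integral_prod_symm _ i1, integral_prod_symm _ i2, ← integral_neg]
  refine setIntegral_congr_fun measurableSet_Icc fun θ hθ => ?_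
  have := hv.weak (fun x => f (S.point (x, θ))) fun x hx =>
    IsC1.contDiffAt_slice S hf (q := (x, θ)) ⟨hx, hθ⟩
  exact this

end Profile

namespace Profile

variable {S : Profile}

/-! ### The weak equation tested with Sobolev functions -/

lemma norm_coord_le (x : EuclideanSpace ℝ (Fin 2)) : ‖x 0‖ ≤ ‖x‖ := PiLp.norm_apply_le x 0

lemma memLp_coord {G : ℝ × ℝ → EuclideanSpace ℝ (Fin 2)} (hG : MemLp G 2 S.area) :
    MemLp (fun q => G q 0) 2 S.area := by
  refine hG.of_le ?_ (.of_forall fun q => norm_coord_le (G q))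
  have hc : Continuous fun x : EuclideanSpace ℝ (Fin 2) => x 0 := by fun_prop
  exact hc.comp_aestronglyMeasurable hG.aestronglyMeasurable

lemma IsC1.continuousOn_grad_coord {f : E3 → ℝ} (hf : S.IsC1 f) :
    ContinuousOn (fun q => S.grad f q 0) rect := by
  simp only [grad, Matrix.cons_val_zero]
  exact (IsC1.continuousOn_deriv_slice S hf).div
    (S.continuous_γ.comp continuous_fst).continuousOn fun _ hq => (S.γ_pos hq.1).ne'

lemma IsFree.memLp_slope {a v : ℝ → ℝ} {T : Set ℝ} (hv : S.IsFree a v T) :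
    MemLp (fun q : ℝ × ℝ => deriv v q.1 / S.γ q.1) 2 S.area :=
  S.memLp_area (((continuous_deriv_of_contDiff hv.contDiff).comp
    continuous_fst).continuousOn.div (S.continuous_γ.comp continuous_fst).continuousOn
      fun _ hq => (S.γ_pos hq.1).ne') 2

lemma memLp_field {H : E3 → ℝ} (hH : S.IsC1 H) : MemLp (fun q => H (S.point q)) 2 S.area :=
  S.memLp_area (IsC1.continuousOn_comp_point S hH) 2

lemma memLp_indicator_field {H : E3 → ℝ} (hH : S.IsC1 H) {T : Set ℝ} (hT : MeasurableSet T) :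
    MemLp ((Prod.fst ⁻¹' T).indicator fun q => H (S.point q)) 2 S.area :=
  (memLp_field hH).indicator (measurable_fst hT)

/-- Both sides are L² pairings with a fixed function, so the identity passes from the approximating
C¹ functions to the limit. -/
lemma IsFree.integral_mul_sobolevGrad {a v : ℝ → ℝ} {T : Set ℝ} {H W : E3 → ℝ}
    {G : ℝ × ℝ → EuclideanSpace ℝ (Fin 2)} (hv : S.IsFree a v T)
    (ha : ContDiff ℝ 1 a) (hH : S.IsInducedField a H) (hW : S.HasSobolevGrad W G) :
    ∫ q, deriv v q.1 / S.γ q.1 * G q 0 ∂S.area =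
      -∫ q, (Prod.fst ⁻¹' T).indicator (fun q => H (S.point q)) q * W (S.point q) ∂S.area := by
  obtain ⟨hW2, hG2, f, hf, hlim, hlim'⟩ := hW
  have l1 := tendsto_integral_mul hv.memLp_slope (memLp_coord hG2)
    (fun n => S.memLp_area (IsC1.continuousOn_grad_coord (hf n)) 2)
    (tendsto_of_tendsto_of_tendsto_of_le_of_le tendsto_const_nhds hlim' (fun _ => zero_le)
      fun n => eLpNorm_mono fun q => norm_coord_le (S.grad (f n) q - G q))
  have l2 := tendsto_integral_mul (memLp_indicator_field hH.1 hv.measurableSet) hW2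
    (fun n => S.memLp_area (IsC1.continuousOn_comp_point S (hf n)) 2) hlim
  refine tendsto_nhds_unique l1 (l2.neg.congr fun n => ?_)
  exact (hv.integral_mul_grad ha hH (hf n)).symm

lemma grad_comp_polar (v : ℝ → ℝ) {q : ℝ × ℝ} (hq : q.1 ∈ Ioo 0 π) :
    S.grad (fun p => v (polar p)) q = !₂[deriv v q.1 / S.γ q.1, 0] := by
  have h1 : (fun x => v (polar (S.point (x, q.2)))) =ᶠ[𝓝 q.1] v := by
    filter_upwards [Ioo_mem_nhds hq.1 hq.2] with x hx
    rw [polar_point S (q := (x, q.2)) (Ioo_subset_Icc_self hx)]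
  have h2 : (fun θ => v (polar (S.point (q.1, θ)))) = fun _ => v q.1 := by
    ext θ
    rw [polar_point S (q := (q.1, θ)) (Ioo_subset_Icc_self hq)]
  simp only [grad]
  rw [h1.deriv_eq, h2, deriv_const, zero_div]

lemma IsFree.isC1 {a v : ℝ → ℝ} {T : Set ℝ} (hv : S.IsFree a v T) :
    S.IsC1 fun p => v (polar p) :=
  S.isC1_comp_polar hv.contDiff hv.near_zero hv.near_pi

lemma IsFree.hasSobolevGrad {a v : ℝ → ℝ} {T : Set ℝ} (hv : S.IsFree a v T) :
    S.HasSobolevGrad (fun p => v (polar p)) (S.grad fun p => v (polar p)) := by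
  refine ⟨S.memLp_area (IsC1.continuousOn_comp_point S hv.isC1) 2, ?_, fun _ => _,
    fun _ => hv.isC1, by simp, by simp⟩
  have h : S.grad (fun p => v (polar p)) =ᵐ[S.area]
      fun q => EuclideanSpace.single 0 (deriv v q.1 / S.γ q.1) := by
    filter_upwards [S.ae_area_fst_mem] with q hq
    rw [grad_comp_polar v hq]
    ext i
    fin_cases i <;> simp
  refine (memLp_congr_ae h).2 (hv.memLp_slope.of_le ?_ (.of_forall fun q => by simp))
  refine S.aestronglyMeasurable_area ?_
  have hc : ContinuousOn (fun q : ℝ × ℝ => deriv v q.1 / S.γ q.1) rect :=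
    ((continuous_deriv_of_contDiff hv.contDiff).comp
      continuous_fst).continuousOn.div (S.continuous_γ.comp continuous_fst).continuousOn
      fun _ hq => (S.γ_pos hq.1).ne'
  have hs : Continuous fun x : ℝ => (EuclideanSpace.single 0 x : EuclideanSpace ℝ (Fin 2)) :=
    (LinearIsometry.continuous
      ⟨(LinearMap.toSpanSingleton ℝ _ (EuclideanSpace.single 0 1) :
        ℝ →ₗ[ℝ] EuclideanSpace ℝ (Fin 2)), fun x => by simp [norm_smul]⟩).congr fun x => by
      ext i
      fin_cases i <;> simp [LinearMap.toSpanSingleton_apply]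
  exact hs.comp_continuousOn hc

/-- The energy of a Sobolev function, compared with that of a function which satisfies the
equation on a free region. -/
lemma IsFree.energy_eq {a v : ℝ → ℝ} {T : Set ℝ} {H W : E3 → ℝ}
    {G : ℝ × ℝ → EuclideanSpace ℝ (Fin 2)} (hv : S.IsFree a v T)
    (ha : ContDiff ℝ 1 a) (hH : S.IsInducedField a H) (hW : S.HasSobolevGrad W G) :
    S.energy H W G = S.energy H (fun p => v (polar p)) (S.grad fun p => v (polar p)) +
      ∫ q, ‖G q - S.grad (fun p => v (polar p)) q‖ ^ 2 ∂S.area +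
      2 * ∫ q, (Prod.fst ⁻¹' Tᶜ).indicator (fun q => H (S.point q)) q *
        (W (S.point q) - v (polar (S.point q))) ∂S.area := by
  have hV := hv.hasSobolevGrad
  have wW := hv.integral_mul_sobolevGrad ha hH hW
  have wV := hv.integral_mul_sobolevGrad ha hH hV
  set V : E3 → ℝ := fun p => v (polar p) with hVdef
  set GV := S.grad V
  set g : ℝ × ℝ → ℝ := fun q => deriv v q.1 / S.γ q.1
  set h1 := (Prod.fst ⁻¹' T).indicator fun q => H (S.point q)
  set h2 := (Prod.fst ⁻¹' Tᶜ).indicator fun q => H (S.point q)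
  have hsum : ∀ q, H (S.point q) = h1 q + h2 q := fun q => by
    by_cases hq : q.1 ∈ T <;> simp [h1, h2, hq]
  have mg : MemLp g 2 S.area := hv.memLp_slope
  have m1 : MemLp h1 2 S.area := memLp_indicator_field hH.1 hv.measurableSet
  have m2 : MemLp h2 2 S.area := memLp_indicator_field hH.1 hv.measurableSet.compl
  have ig : Integrable (fun q => g q * G q 0) S.area := mg.integrable_mul (memLp_coord hW.2.1)
  have igV : Integrable (fun q => g q * GV q 0) S.area :=
    mg.integrable_mul (memLp_coord hV.2.1)
  have iW1 : Integrable (fun q => h1 q * W (S.point q)) S.area := m1.integrable_mul hW.1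
  have iW2 : Integrable (fun q => h2 q * W (S.point q)) S.area := m2.integrable_mul hW.1
  have iV1 : Integrable (fun q => h1 q * V (S.point q)) S.area := m1.integrable_mul hV.1
  have iV2 : Integrable (fun q => h2 q * V (S.point q)) S.area := m2.integrable_mul hV.1
  have iD : Integrable (fun q => ‖G q - GV q‖ ^ 2) S.area :=
    (hW.2.1.sub hV.2.1).integrable_norm_pow (p := 2) two_ne_zero
  -- Since ∇V = (g, 0) in the frame, |G|² = |G - ∇V|² + 2 g G₀ - g (∇V)₀ pointwise. The weak
  -- equations `wW` and `wV` later trade the integrals of g G₀ and g (∇V)₀ for integrals of H over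
  -- the free region.
  have eW : S.energy H W G = ∫ q, ‖G q - GV q‖ ^ 2 ∂S.area + 2 * ∫ q, g q * G q 0 ∂S.area -
      ∫ q, g q * GV q 0 ∂S.area + 2 * (∫ q, h1 q * W (S.point q) ∂S.area +
        ∫ q, h2 q * W (S.point q) ∂S.area) := by
    have i1 : Integrable (fun q => ‖G q - GV q‖ ^ 2 + 2 * (g q * G q 0)) S.area :=
      iD.add (ig.const_mul 2)
    have i2 : Integrable (fun q => ‖G q - GV q‖ ^ 2 + 2 * (g q * G q 0) - g q * GV q 0) S.area :=
      i1.sub igV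
    have i3 : Integrable (fun q => 2 * (h1 q * W (S.point q) + h2 q * W (S.point q))) S.area :=
      (iW1.add iW2).const_mul 2
    rw [← integral_add iW1 iW2, ← integral_const_mul, ← integral_const_mul,
      ← integral_add iD (ig.const_mul 2), ← integral_sub i1 igV, ← integral_add i2 i3]
    refine integral_congr_ae ?_
    filter_upwards [S.ae_area_fst_mem] with q hq
    have hGV : GV q = !₂[g q, 0] := grad_comp_polar v hq
    have hGV0 : GV q 0 = g q := by rw [hGV]; simp
    have hGV1 : GV q 1 = 0 := by rw [hGV]; simp
    simp only [EuclideanSpace.norm_sq_eq, Fin.sum_univ_two, PiLp.sub_apply,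
      Real.norm_eq_abs, sq_abs, hGV0, hGV1, hsum]
    ring
  have eV : S.energy H V GV = ∫ q, g q * GV q 0 ∂S.area + 2 * (∫ q, h1 q * V (S.point q) ∂S.area +
        ∫ q, h2 q * V (S.point q) ∂S.area) := by
    have i3 : Integrable (fun q => 2 * (h1 q * V (S.point q) + h2 q * V (S.point q))) S.area :=
      (iV1.add iV2).const_mul 2
    rw [← integral_add iV1 iV2, ← integral_const_mul, ← integral_add igV i3]
    refine integral_congr_ae ?_
    filter_upwards [S.ae_area_fst_mem] with q hq
    have hGV : GV q = !₂[g q, 0] := grad_comp_polar v hq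
    have hGV0 : GV q 0 = g q := by rw [hGV]; simp
    have hGV1 : GV q 1 = 0 := by rw [hGV]; simp
    simp only [EuclideanSpace.norm_sq_eq, Fin.sum_univ_two,
      Real.norm_eq_abs, sq_abs, hGV0, hGV1, hsum]
    ring
  have e2 : ∫ q, h2 q * (W (S.point q) - V (S.point q)) ∂S.area =
      ∫ q, h2 q * W (S.point q) ∂S.area - ∫ q, h2 q * V (S.point q) ∂S.area := by
    rw [← integral_sub iW2 iV2]
    simp only [mul_sub]
  rw [e2, eW, eV, wW, wV]
  ring

/-! ### Sobolev functions with vanishing gradient -/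

/-- Integrated form of the fundamental theorem of calculus on horizontal slices. -/
lemma lintegral_slices_le {k d : ℝ × ℝ → ℝ} {I I' J : Set ℝ} [OrdConnected I]
    (hI : MeasurableSet I) (hI' : MeasurableSet I') (hJ : MeasurableSet J) (hII' : I' ⊆ I)
    (hIfin : volume I ≠ ⊤) (hk : ContinuousOn k (I ×ˢ J)) (hd : ContinuousOn d (I ×ˢ J))
    (hkd : ∀ x ∈ I, ∀ θ ∈ J, HasDerivAt (fun x => k (x, θ)) (d (x, θ)) x) :
    volume I' * ∫⁻ q in I ×ˢ J, ‖k q‖ₑ ≤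
      ((∫⁻ q in I' ×ˢ J, ‖k q‖ₑ) + volume I' * ∫⁻ q in I ×ˢ J, ‖d q‖ₑ) * volume I := by
  have hI'fin : volume I' ≠ ⊤ := ((measure_mono hII').trans_lt hIfin.lt_top).ne
  have meas : ∀ {f : ℝ × ℝ → ℝ} {A : Set ℝ}, MeasurableSet A → A ⊆ I →
      ContinuousOn f (I ×ˢ J) → AEMeasurable (fun q => ‖f q‖ₑ)
        ((volume.restrict A).prod (volume.restrict J)) := by
    intro f A hA hAI hf
    rw [Measure.prod_restrict]
    exact ((hf.mono (prod_mono hAI le_rfl)).aestronglyMeasurable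
      (hA.prod hJ)).enorm
  have slice : ∀ {f : ℝ × ℝ → ℝ} {A : Set ℝ}, MeasurableSet A → A ⊆ I →
      ContinuousOn f (I ×ˢ J) → ∫⁻ q in A ×ˢ J, ‖f q‖ₑ =
        ∫⁻ θ in J, ∫⁻ x in A, ‖f (x, θ)‖ₑ := by
    intro f A hA hAI hf
    rw [Measure.volume_eq_prod, ← Measure.prod_restrict]
    exact lintegral_prod_symm _ (meas hA hAI hf)
  rw [slice hI le_rfl hk, slice hI' hII' hk, slice hI le_rfl hd,
    ← lintegral_const_mul' _ _ hI'fin, ← lintegral_const_mul' _ _ hI'fin,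
    ← lintegral_add_left' (meas hI' hII' hk).lintegral_prod_left',
    ← lintegral_mul_const' _ _ hIfin]
  refine setLIntegral_mono' hJ fun θ hθ => ?_
  have hcs : ContinuousOn (fun x => d (x, θ)) I :=
    hd.comp (by fun_prop) fun x hx => ⟨hx, hθ⟩
  -- On a fixed slice, |k(x)| ≤ |k(y)| + ∫_I |d| for x in I and y in I'. Both volume factors arise
  -- by integrating this inequality over y in I' and then over x in I.
  rw [← lintegral_const_mul' _ _ hI'fin, ← setLIntegral_const]
  refine setLIntegral_mono' hI fun x hx => ?_
  rw [mul_comm, ← setLIntegral_const]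
  rw [mul_comm (volume I'), ← setLIntegral_const I', ← lintegral_add_right _ measurable_const]
  refine setLIntegral_mono' hI' fun y hy => ?_
  have hsub : uIcc y x ⊆ I := OrdConnected.uIcc_subset ‹_› (hII' hy) hx
  have ftc : ∫ t in y..x, d (t, θ) = k (x, θ) - k (y, θ) :=
    intervalIntegral.integral_eq_sub_of_hasDerivAt (fun t ht => hkd t (hsub ht) θ hθ)
      (hcs.mono hsub).intervalIntegrable
  have h1 : ‖k (x, θ)‖ₑ ≤ ‖k (y, θ)‖ₑ + ‖∫ t in y..x, d (t, θ)‖ₑ := by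
    calc ‖k (x, θ)‖ₑ = ‖k (y, θ) + ∫ t in y..x, d (t, θ)‖ₑ := by rw [ftc]; congr 1; ring
      _ ≤ _ := enorm_add_le _ _
  refine h1.trans (add_le_add_right ?_ _)
  have h2 : ‖∫ t in y..x, d (t, θ)‖ₑ = ‖∫ t in uIoc y x, d (t, θ)‖ₑ := by
    rw [← enorm_norm, intervalIntegral.norm_intervalIntegral_eq, enorm_norm]
  rw [h2]
  exact (enorm_integral_le_lintegral_enorm _).trans
    (lintegral_mono_set (uIoc_subset_uIcc.trans hsub))

/-- Away from the poles the area measure dominates Lebesgue measure. -/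
lemma exists_restrict_le_area (S : Profile) {ε : ℝ} (hε : 0 < ε) :
    ∃ c : ENNReal, c ≠ ⊤ ∧
      volume.restrict (Icc ε (π - ε) ×ˢ Icc 0 (2 * π)) ≤ c • S.area := by
  have hsub : Icc ε (π - ε) ⊆ Ioo 0 π := fun x hx => ⟨by linarith [hx.1], by linarith [hx.2]⟩
  obtain ⟨m, hm, hle⟩ : ∃ m > 0, ∀ x ∈ Icc ε (π - ε), m ≤ S.ρ x * S.γ x := by
    rcases (Icc ε (π - ε)).eq_empty_or_nonempty with h | h
    · exact ⟨1, one_pos, by simp [h]⟩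
    obtain ⟨x, hx, hmin⟩ := isCompact_Icc.exists_isMinOn h
      (S.continuous_ρ.mul S.continuous_γ).continuousOn
    exact ⟨_, mul_pos (S.ρ_pos x (hsub hx)) (S.γ_pos (Ioo_subset_Icc_self (hsub hx))), hmin⟩
  have hm0 : ENNReal.ofReal m ≠ 0 := by simpa using hm
  refine ⟨(ENNReal.ofReal m)⁻¹, by simpa using hm, Measure.le_iff.2 fun A hA => ?_⟩
  have hR : MeasurableSet (Icc ε (π - ε) ×ˢ Icc (0 : ℝ) (2 * π)) :=
    measurableSet_Icc.prod measurableSet_Icc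
  rw [Measure.smul_apply, smul_eq_mul, Measure.restrict_apply hA, ← ENNReal.div_eq_inv_mul,
    ENNReal.le_div_iff_mul_le (Or.inl hm0) (Or.inl ENNReal.ofReal_ne_top), mul_comm,
    area, withDensity_apply _ hA, Measure.restrict_restrict hA, ← setLIntegral_const]
  calc _ ≤ ∫⁻ q in A ∩ Icc ε (π - ε) ×ˢ Icc (0 : ℝ) (2 * π),
        ENNReal.ofReal (S.ρ q.1 * S.γ q.1) :=
      setLIntegral_mono' (hA.inter hR) fun q hq => ENNReal.ofReal_le_ofReal (hle _ hq.2.1)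
    _ ≤ _ := lintegral_mono_set (inter_subset_inter_right _
        (prod_mono (hsub.trans Ioo_subset_Icc_self) le_rfl))

/-- Convergence to zero in `L²` of the surface implies convergence to zero in `L¹` away from the
poles. -/
lemma tendsto_lintegral_of_eLpNorm {ε : ℝ} (hε : 0 < ε) {F : ℕ → ℝ × ℝ → ℝ}
    (hF : ∀ n, AEStronglyMeasurable (F n) S.area)
    (hlim : Tendsto (fun n => eLpNorm (F n) 2 S.area) atTop (𝓝 0)) :
    Tendsto (fun n => ∫⁻ q in Icc ε (π - ε) ×ˢ Icc 0 (2 * π), ‖F n q‖ₑ) atTop (𝓝 0) := by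
  obtain ⟨c, hc, hle⟩ := S.exists_restrict_le_area hε
  set μ := volume.restrict (Icc ε (π - ε) ×ˢ Icc (0 : ℝ) (2 * π))
  have : IsFiniteMeasure (c • S.area) := Measure.smul_finite S.area hc
  have : IsFiniteMeasure μ := isFiniteMeasure_of_le (c • S.area) hle
  have hac : μ ≪ S.area := (Measure.absolutelyContinuous_of_le hle).trans
    Measure.smul_absolutelyContinuous
  -- The Hölder constant of the inclusion of L² in L¹: the exponent is 1 - 1/2.
  set K := μ univ ^ (1 / (1 : ENNReal).toReal - 1 / (2 : ENNReal).toReal)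
  have hK : K ≠ ⊤ := by
    refine ENNReal.rpow_ne_top_of_nonneg ?_ (measure_ne_top _ _)
    norm_num
  have hcc : c ^ (1 / (2 : ENNReal).toReal) ≠ ⊤ :=
    ENNReal.rpow_ne_top_of_nonneg (by positivity) hc
  have hb : ∀ n, ∫⁻ q, ‖F n q‖ₑ ∂μ ≤
      c ^ (1 / (2 : ENNReal).toReal) * eLpNorm (F n) 2 S.area * K := by
    intro n
    rw [← eLpNorm_one_eq_lintegral_enorm]
    refine (eLpNorm_le_eLpNorm_mul_rpow_measure_univ (by norm_num : (1 : ENNReal) ≤ 2)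
      ((hF n).mono_ac hac)).trans ?_
    gcongr
    refine (eLpNorm_mono_measure _ hle).trans (le_of_eq ?_)
    rw [eLpNorm_smul_measure_of_ne_top (by norm_num), smul_eq_mul, ENNReal.toReal_div,
      ENNReal.toReal_one]
  refine tendsto_of_tendsto_of_tendsto_of_le_of_le tendsto_const_nhds ?_ (fun _ => zero_le) hb
  have := ENNReal.Tendsto.mul_const (b := K)
    (ENNReal.Tendsto.const_mul (a := c ^ (1 / (2 : ENNReal).toReal)) hlim (Or.inr hcc)) (Or.inr hK)
  simpa using this

/-- A limit of `C¹` functions whose gradients tend to zero vanishes if it vanishes near a pole. -/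
lemma ae_eq_zero_of_tendsto {U : ℝ × ℝ → ℝ} {k : ℕ → E3 → ℝ} (hk : ∀ n, S.IsC1 (k n))
    (hU : MemLp U 2 S.area)
    (hlim : Tendsto (fun n => eLpNorm (fun q => k n (S.point q) - U q) 2 S.area) atTop (𝓝 0))
    (hlim' : Tendsto (fun n => eLpNorm (fun q => S.grad (k n) q 0) 2 S.area) atTop (𝓝 0))
    {s : ℝ} (hs : s ∈ Ioo 0 π) (hz : ∀ᵐ q ∂S.area, q.1 ≤ s → U q = 0) :
    ∀ᵐ q ∂S.area, U q = 0 := by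
  -- The area density degenerates at the poles, so the comparison with Lebesgue measure is made on
  -- strips that avoid them.
  have key : ∀ ε : ℝ, 0 < ε → ε < s → s ≤ π - ε →
      ∀ᵐ q ∂S.area, q ∈ Icc ε (π - ε) ×ˢ Icc 0 (2 * π) → U q = 0 := by
    intro ε hε hεs hsε
    obtain ⟨c, hc, hle⟩ := S.exists_restrict_le_area hε
    have hac : volume.restrict (Icc ε (π - ε) ×ˢ Icc (0 : ℝ) (2 * π)) ≪ S.area :=
      (Measure.absolutelyContinuous_of_le hle).trans Measure.smul_absolutelyContinuous
    have hsubI : Icc ε (π - ε) ⊆ Icc 0 π := Icc_subset_Icc hε.le (by linarith)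
    have hsub : Icc ε (π - ε) ×ˢ Icc (0 : ℝ) (2 * π) ⊆ rect := prod_mono hsubI le_rfl
    have hII' : Icc ε s ⊆ Icc ε (π - ε) := Icc_subset_Icc le_rfl hsε
    have hR : MeasurableSet (Icc ε (π - ε) ×ˢ Icc (0 : ℝ) (2 * π)) :=
      measurableSet_Icc.prod measurableSet_Icc
    have hR' : MeasurableSet (Icc ε s ×ˢ Icc (0 : ℝ) (2 * π)) :=
      measurableSet_Icc.prod measurableSet_Icc
    have hkm : ∀ n, AEStronglyMeasurable (fun q => k n (S.point q)) S.area := fun n =>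
      S.aestronglyMeasurable_area (IsC1.continuousOn_comp_point S (hk n))
    have t1 := tendsto_lintegral_of_eLpNorm hε (fun n => (hkm n).sub hU.aestronglyMeasurable) hlim
    have t2 := tendsto_lintegral_of_eLpNorm hε
      (fun n => S.aestronglyMeasurable_area (IsC1.continuousOn_grad_coord (hk n))) hlim'
    obtain ⟨Γ, hΓ⟩ := isCompact_Icc.exists_bound_of_continuousOn
      (S.continuous_γ.continuousOn (s := Icc 0 π))
    -- the derivatives along the slices
    have t3 : Tendsto (fun n => ∫⁻ q in Icc ε (π - ε) ×ˢ Icc (0 : ℝ) (2 * π),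
        ‖deriv (fun x => k n (S.point (x, q.2))) q.1‖ₑ) atTop (𝓝 0) := by
      have hb : ∀ n, ∫⁻ q in Icc ε (π - ε) ×ˢ Icc (0 : ℝ) (2 * π),
          ‖deriv (fun x => k n (S.point (x, q.2))) q.1‖ₑ ≤ ENNReal.ofReal Γ *
          ∫⁻ q in Icc ε (π - ε) ×ˢ Icc (0 : ℝ) (2 * π), ‖S.grad (k n) q 0‖ₑ := by
        intro n
        rw [← lintegral_const_mul' _ _ ENNReal.ofReal_ne_top]
        refine setLIntegral_mono' hR fun q hq => ?_
        have hγ := S.γ_pos (hsubI hq.1)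
        have : deriv (fun x => k n (S.point (x, q.2))) q.1 = S.γ q.1 * S.grad (k n) q 0 := by
          simp only [grad, Matrix.cons_val_zero]
          field_simp
        rw [this, enorm_mul]
        gcongr
        rw [← ofReal_norm]
        exact ENNReal.ofReal_le_ofReal (hΓ _ (hsubI hq.1))
      refine tendsto_of_tendsto_of_tendsto_of_le_of_le tendsto_const_nhds ?_ (fun _ => zero_le) hb
      simpa using ENNReal.Tendsto.const_mul (a := ENNReal.ofReal Γ) t2
        (Or.inr ENNReal.ofReal_ne_top)
    -- the part where `U` vanishes
    have t4 : Tendsto (fun n => ∫⁻ q in Icc ε s ×ˢ Icc (0 : ℝ) (2 * π), ‖k n (S.point q)‖ₑ)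
        atTop (𝓝 0) := by
      have hb : ∀ n, ∫⁻ q in Icc ε s ×ˢ Icc (0 : ℝ) (2 * π), ‖k n (S.point q)‖ₑ ≤
          ∫⁻ q in Icc ε (π - ε) ×ˢ Icc (0 : ℝ) (2 * π), ‖k n (S.point q) - U q‖ₑ := by
        intro n
        calc _ = ∫⁻ q in Icc ε s ×ˢ Icc (0 : ℝ) (2 * π), ‖k n (S.point q) - U q‖ₑ := by
              refine lintegral_congr_ae ?_
              have hres : volume.restrict (Icc ε s ×ˢ Icc (0 : ℝ) (2 * π)) ≪ S.area :=
                (Measure.absolutelyContinuous_of_le (Measure.restrict_mono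
                  (prod_mono hII' le_rfl) le_rfl)).trans hac
              filter_upwards [hres.ae_le hz, ae_restrict_mem hR'] with q hq hq'
              rw [hq hq'.1.2, sub_zero]
          _ ≤ _ := lintegral_mono_set (prod_mono hII' le_rfl)
      exact tendsto_of_tendsto_of_tendsto_of_le_of_le tendsto_const_nhds t1 (fun _ => zero_le) hb
    have hI'0 : volume (Icc ε s) ≠ 0 := by simpa using hεs
    have hI't : volume (Icc ε s) ≠ ⊤ := by simp
    -- The slice inequality, divided by the length of [ε, s], bounds k n on the whole strip by its
    -- integral where U vanishes and by its derivative, both of which tend to 0. Since k n also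
    -- tends to U there, U = 0 on the strip.
    have t5 : Tendsto (fun n => ∫⁻ q in Icc ε (π - ε) ×ˢ Icc (0 : ℝ) (2 * π),
        ‖k n (S.point q)‖ₑ) atTop (𝓝 0) := by
      have hb : ∀ n, ∫⁻ q in Icc ε (π - ε) ×ˢ Icc (0 : ℝ) (2 * π), ‖k n (S.point q)‖ₑ ≤
          (volume (Icc ε s))⁻¹ * (((∫⁻ q in Icc ε s ×ˢ Icc (0 : ℝ) (2 * π), ‖k n (S.point q)‖ₑ) +
            volume (Icc ε s) * ∫⁻ q in Icc ε (π - ε) ×ˢ Icc (0 : ℝ) (2 * π),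
              ‖deriv (fun x => k n (S.point (x, q.2))) q.1‖ₑ) * volume (Icc ε (π - ε))) := by
        intro n
        rw [← ENNReal.div_eq_inv_mul, ENNReal.le_div_iff_mul_le (Or.inl hI'0) (Or.inl hI't),
          mul_comm]
        refine lintegral_slices_le measurableSet_Icc measurableSet_Icc measurableSet_Icc hII'
          (by simp) ((IsC1.continuousOn_comp_point S (hk n)).mono hsub)
          ((IsC1.continuousOn_deriv_slice S (hk n)).mono hsub) fun x hx θ hθ => ?_
        exact ((IsC1.contDiffAt_slice S (hk n) (q := (x, θ)) ⟨hsubI hx, hθ⟩).differentiableAt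
          (by simp)).hasDerivAt
      refine tendsto_of_tendsto_of_tendsto_of_le_of_le tendsto_const_nhds ?_ (fun _ => zero_le) hb
      have h1 := t4.add (ENNReal.Tendsto.const_mul (a := volume (Icc ε s)) t3 (Or.inr hI't))
      have h2 := ENNReal.Tendsto.mul_const (b := volume (Icc ε (π - ε))) h1 (Or.inr (by simp))
      have h3 := ENNReal.Tendsto.const_mul (a := (volume (Icc ε s))⁻¹) h2
        (Or.inr (ENNReal.inv_ne_top.2 hI'0))
      simpa using h3
    have hUm : AEStronglyMeasurable U
        (volume.restrict (Icc ε (π - ε) ×ˢ Icc (0 : ℝ) (2 * π))) :=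
      hU.aestronglyMeasurable.mono_ac hac
    have h0 : ∫⁻ q in Icc ε (π - ε) ×ˢ Icc (0 : ℝ) (2 * π), ‖U q‖ₑ = 0 := by
      have t6 := t1.add t5
      rw [add_zero] at t6
      refine le_antisymm (ge_of_tendsto' t6 fun n => ?_) zero_le
      rw [← lintegral_add_left' (((hkm n).mono_ac hac).sub hUm).enorm]
      refine lintegral_mono fun q => ?_
      calc ‖U q‖ₑ = ‖-(k n (S.point q) - U q) + k n (S.point q)‖ₑ := by congr 1; ring
        _ ≤ ‖-(k n (S.point q) - U q)‖ₑ + ‖k n (S.point q)‖ₑ := enorm_add_le _ _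
        _ = _ := by rw [enorm_neg]; rfl
    rw [lintegral_eq_zero_iff' hUm.enorm, EventuallyEq, ae_restrict_iff' hR] at h0
    have hav : S.area ≪ volume :=
      S.area_absolutelyContinuous.trans Measure.restrict_le_self.absolutelyContinuous
    filter_upwards [hav.ae_le h0] with q hq hq'
    simpa using hq hq'
  -- With δ ≤ s and δ ≤ π - s, each ε = δ / (n + 2) is admissible in `key`; the corresponding strips
  -- exhaust (0, π).
  set δ : ℝ := min s (π - s) with hδ
  have hδ0 : 0 < δ := lt_min hs.1 (by linarith [hs.2])
  have hall : ∀ᵐ q ∂S.area, ∀ n : ℕ,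
      q ∈ Icc (δ / (n + 2)) (π - δ / (n + 2)) ×ˢ Icc 0 (2 * π) → U q = 0 := by
    refine ae_all_iff.2 fun n => ?_
    have h1 : δ / (n + 2) < δ := div_lt_self hδ0 (by linarith [n.cast_nonneg (α := ℝ)])
    exact key _ (by positivity) (h1.trans_le (min_le_left _ _))
      (by linarith [min_le_right s (π - s)])
  filter_upwards [hall, S.ae_area_fst_mem, S.ae_area_mem_rect] with q hq h1 h2
  obtain ⟨n, hn⟩ := exists_nat_gt (δ / min q.1 (π - q.1))
  have hm : 0 < min q.1 (π - q.1) := lt_min h1.1 (by linarith [h1.2])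
  have h3 : δ / (n + 2) ≤ min q.1 (π - q.1) := by
    rw [div_lt_iff₀ hm] at hn
    rw [div_le_iff₀ (by positivity)]
    nlinarith
  exact hq n ⟨⟨h3.trans (min_le_left _ _), by linarith [h3.trans (min_le_right _ _)]⟩, h2.2⟩

end Profile

namespace Profile

variable {S : Profile}

/-! ### A sufficient condition for being the solution of the obstacle problem -/

lemma IsC1.sub {f g : E3 → ℝ} (hf : S.IsC1 f) (hg : S.IsC1 g) : S.IsC1 fun p => f p - g p :=
  fun p hp => (hf p hp).sub (hg p hp)

lemma grad_sub_coord {f g : E3 → ℝ} (hf : S.IsC1 f) (hg : S.IsC1 g) {q : ℝ × ℝ}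
    (hq : q ∈ rect) : S.grad (fun p => f p - g p) q 0 = S.grad f q 0 - S.grad g q 0 := by
  simp only [grad, Matrix.cons_val_zero]
  rw [← sub_div]
  congr 1
  exact deriv_fun_sub ((IsC1.contDiffAt_slice S hf hq).differentiableAt (by simp))
    ((IsC1.contDiffAt_slice S hg hq).differentiableAt (by simp))

/-- Two Sobolev functions, one of them `C¹`, with the same gradient agree if they agree near a
pole. -/
lemma ae_eq_of_grad_eq {V W : E3 → ℝ} {G : ℝ × ℝ → EuclideanSpace ℝ (Fin 2)} (hV : S.IsC1 V)
    (hW : S.HasSobolevGrad W G) (hG : ∀ᵐ q ∂S.area, G q = S.grad V q) {s : ℝ} (hs : s ∈ Ioo 0 π)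
    (hz : ∀ᵐ q ∂S.area, q.1 ≤ s → W (S.point q) = V (S.point q)) :
    ∀ᵐ q ∂S.area, W (S.point q) = V (S.point q) := by
  obtain ⟨hW2, -, f, hf, hlim, hlim'⟩ := hW
  have h := ae_eq_zero_of_tendsto (U := fun q => W (S.point q) - V (S.point q))
    (k := fun n p => f n p - V p) (fun n => IsC1.sub (hf n) hV)
    (hW2.sub (S.memLp_area (IsC1.continuousOn_comp_point S hV) 2))
    (by simpa only [sub_sub_sub_cancel_right] using hlim)
    (tendsto_of_tendsto_of_tendsto_of_le_of_le tendsto_const_nhds hlim' (fun _ => zero_le)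
      fun n => eLpNorm_mono_ae (by
        filter_upwards [hG, S.ae_area_mem_rect] with q hq hq'
        rw [grad_sub_coord (hf n) hV hq', hq]
        exact norm_coord_le (S.grad (f n) q - S.grad V q)))
    hs (by
      filter_upwards [hz] with q hq hq'
      rw [hq hq', sub_self])
  filter_upwards [h] with q hq using sub_eq_zero.1 hq

/-- On the lower obstacle W - V ≥ 0 and H ≥ 0; on the upper one both signs are reversed. H has the
sign of a' because the area density is positive away from the poles. -/
lemma contact_nonneg {a v : ℝ → ℝ} {T : Set ℝ} {H : E3 → ℝ} {β : ℝ} (hH : S.IsInducedField a H)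
    (hc : ∀ x ∈ Icc 0 π, x ∉ T →
      (v x = -(β / 2) ∧ 0 ≤ deriv a x) ∨ (v x = β / 2 ∧ deriv a x ≤ 0))
    {W : E3 → ℝ} (hW : ∀ᵐ q ∂S.area, |W (S.point q)| ≤ β / 2) :
    ∀ᵐ q ∂S.area, 0 ≤ (Prod.fst ⁻¹' Tᶜ).indicator (fun q => H (S.point q)) q *
      (W (S.point q) - v (polar (S.point q))) := by
  filter_upwards [hW, S.ae_area_mem_rect, S.ae_area_fst_mem] with q hq hr hq'
  by_cases hT : q.1 ∈ T
  · simp [hT]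
  have hpos : 0 < S.ρ q.1 * S.γ q.1 := mul_pos (S.ρ_pos _ hq') (S.γ_pos hr.1)
  have hHa := hH.2 q.1 hr.1 q.2
  rw [indicator_of_mem (by simpa using hT), polar_point S hr.1]
  have := abs_le.1 hq
  rcases hc _ hr.1 hT with ⟨h1, h2⟩ | ⟨h1, h2⟩
  · rw [hHa] at h2
    exact mul_nonneg (nonneg_of_mul_nonneg_left h2 hpos) (by rw [h1]; linarith)
  · rw [hHa] at h2
    exact mul_nonneg_of_nonpos_of_nonpos (nonpos_of_mul_nonpos_left h2 hpos)
      (by rw [h1]; linarith)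

lemma integral_sq_dist_nonneg (G G' : ℝ × ℝ → EuclideanSpace ℝ (Fin 2)) :
    0 ≤ ∫ q, ‖G q - G' q‖ ^ 2 ∂S.area :=
  integral_nonneg fun _ => sq_nonneg _

lemma ae_eq_of_integral_sq_dist {G G' : ℝ × ℝ → EuclideanSpace ℝ (Fin 2)}
    (hG : MemLp G 2 S.area) (hG' : MemLp G' 2 S.area)
    (h : ∫ q, ‖G q - G' q‖ ^ 2 ∂S.area = 0) : ∀ᵐ q ∂S.area, G q = G' q := by
  have h1 := (integral_eq_zero_iff_of_nonneg (fun _ => sq_nonneg _)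
    ((hG.sub hG').integrable_norm_pow (p := 2) two_ne_zero)).1 h
  filter_upwards [h1] with q hq
  simpa [sub_eq_zero] using hq

/-- A function satisfying the equation on a free region `T`, bounded by the obstacles, and equal,
off `T`, to the lower obstacle where `a` increases and to the upper obstacle where `a` decreases,
is the solution of the obstacle problem. -/
theorem IsFree.isTheSolution {a v : ℝ → ℝ} {T : Set ℝ} {H : E3 → ℝ} {β : ℝ}
    (hv : S.IsFree a v T) (ha : ContDiff ℝ 1 a) (hH : S.IsInducedField a H)
    (hb : ∀ x ∈ Icc 0 π, |v x| ≤ β / 2)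
    (hc : ∀ x ∈ Icc 0 π, x ∉ T →
      (v x = -(β / 2) ∧ 0 ≤ deriv a x) ∨ (v x = β / 2 ∧ deriv a x ≤ 0))
    {s : ℝ} (hs : s ∈ Ioo 0 π) (hsT : ∀ x ∈ Ioc 0 s, x ∉ T ∧ 0 < deriv a x) :
    S.IsTheSolution H β fun p => v (polar p) := by
  have hbV : ∀ᵐ q ∂S.area, |v (polar (S.point q))| ≤ β / 2 := by
    filter_upwards [S.ae_area_mem_rect] with q hq
    rw [polar_point S hq.1]
    exact hb _ hq.1
  have hV := hv.hasSobolevGrad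
  refine ⟨fun p hp => (hv.isC1 p hp).continuousAt.continuousWithinAt,
    ⟨_, hV, hbV, fun W G' hW hWb => ?_⟩, ?_⟩
  · have h1 := integral_sq_dist_nonneg (S := S) G' (S.grad fun p => v (polar p))
    have h2 := integral_nonneg_of_ae (contact_nonneg hH hc hWb)
    rw [hv.energy_eq ha hH hW, add_assoc]
    exact le_add_of_nonneg_right (add_nonneg h1 (mul_nonneg two_pos.le h2))
  -- Uniqueness: both nonnegative corrections in the energy identity vanish. So the gradients agree
  -- and H (W - V) = 0 off T; on (0, s] the field is nonzero, which gives W = V near the pole.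
  rintro W ⟨G', hW, hWb, hWmin⟩
  have hle := hWmin _ _ hV hbV
  have h1 := integral_sq_dist_nonneg (S := S) G' (S.grad fun p => v (polar p))
  have hnn := contact_nonneg hH hc hWb
  have h2 := mul_nonneg (two_pos (α := ℝ)).le (integral_nonneg_of_ae hnn)
  rw [hv.energy_eq ha hH hW, add_assoc, add_le_iff_nonpos_right] at hle
  obtain ⟨hA, hB⟩ := (add_eq_zero_iff_of_nonneg h1 h2).1 (le_antisymm hle (add_nonneg h1 h2))
  have iB : Integrable (fun q => (Prod.fst ⁻¹' Tᶜ).indicator (fun q => H (S.point q)) q *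
        (W (S.point q) - v (polar (S.point q)))) S.area :=
    (memLp_indicator_field hH.1 hv.measurableSet.compl).integrable_mul (hW.1.sub hV.1)
  have hB' := (integral_eq_zero_iff_of_nonneg_ae hnn iB).1
    ((mul_eq_zero.1 hB).resolve_left two_ne_zero)
  have hG : ∀ᵐ q ∂S.area, G' q = S.grad (fun p => v (polar p)) q :=
    ae_eq_of_integral_sq_dist hW.2.1 hV.2.1 hA
  refine ae_eq_of_grad_eq (V := fun p => v (polar p)) hv.isC1 hW hG hs ?_
  filter_upwards [hB', S.ae_area_mem_rect, S.ae_area_fst_mem] with q hq hr hq' hqs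
  obtain ⟨hT, hpos⟩ := hsT q.1 ⟨hq'.1, hqs⟩
  have hHa := hH.2 q.1 hr.1 q.2
  have hne : H (S.point q) ≠ 0 := by
    intro h
    rw [hHa] at hpos
    simp [h] at hpos
  rw [indicator_of_mem (by simpa using hT)] at hq
  exact sub_eq_zero.1 ((mul_eq_zero.1 hq).resolve_left hne)

lemma SC_comp_polar {v : ℝ → ℝ} {β : ℝ} {A : Set ℝ} (hA : A ⊆ Icc 0 π)
    (h : ∀ x ∈ Icc 0 π, |v x| < β / 2 ↔ x ∈ A) :
    S.SC β (fun p => v (polar p)) = S.point '' (A ×ˢ Icc 0 (2 * π)) := by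
  ext p
  constructor
  · rintro ⟨⟨q, hq, rfl⟩, hlt⟩
    change |v (polar (S.point q))| < β / 2 at hlt
    rw [polar_point S hq.1, h _ hq.1] at hlt
    exact ⟨q, ⟨hlt, hq.2⟩, rfl⟩
  · rintro ⟨q, hq, rfl⟩
    refine ⟨⟨q, ⟨hA hq.1, hq.2⟩, rfl⟩, ?_⟩
    change |v (polar (S.point q))| < β / 2
    rw [polar_point S (hA hq.1), h _ (hA hq.1)]
    exact hq.1

/-- The solution of the obstacle problem and its free region, read off from a function of the polar
angle which satisfies the equation on a free region `T`. -/
theorem IsFree.solves {a v : ℝ → ℝ} {T : Set ℝ} {H : E3 → ℝ} {β : ℝ} (hβ : 0 < β)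
    (hv : S.IsFree a v T) (ha : ContDiff ℝ 1 a) (hH : S.IsInducedField a H) (hT : T ⊆ Icc 0 π)
    (hx : ∀ x ∈ Icc 0 π, (x ∈ T ∧ |v x| < β / 2) ∨
      (x ∉ T ∧ ((v x = -(β / 2) ∧ 0 ≤ deriv a x) ∨ (v x = β / 2 ∧ deriv a x ≤ 0))))
    {s : ℝ} (hs : s ∈ Ioo 0 π) (hsT : ∀ x ∈ Ioc 0 s, x ∉ T ∧ 0 < deriv a x) :
    S.IsTheSolution H β (fun p => v (polar p)) ∧
      S.SC β (fun p => v (polar p)) = S.point '' (T ×ˢ Icc 0 (2 * π)) := by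
  have h2 : |β / 2| = β / 2 := abs_of_pos (by positivity)
  refine ⟨hv.isTheSolution ha hH ?_ ?_ hs hsT, SC_comp_polar hT ?_⟩
  · intro x hxI
    rcases hx x hxI with ⟨-, h⟩ | ⟨-, ⟨h, -⟩ | ⟨h, -⟩⟩
    · exact h.le
    · rw [h, abs_neg, h2]
    · rw [h, h2]
  · intro x hxI hxT
    rcases hx x hxI with ⟨h, -⟩ | ⟨-, h⟩
    · exact absurd h hxT
    · exact h
  · intro x hxI
    rcases hx x hxI with ⟨h, h'⟩ | ⟨h', ⟨h, -⟩ | ⟨h, -⟩⟩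
    · exact iff_of_true h' h
    · exact iff_of_false (by rw [h, abs_neg, h2]; exact lt_irrefl _) h'
    · exact iff_of_false (by rw [h, h2]; exact lt_irrefl _) h'

end Profile

namespace Profile

variable {S : Profile}

/-! ### Level integrals -/

lemma uIcc_subset_Ioo {x y : ℝ} (hx : x ∈ Ioo 0 π) (hy : y ∈ Ioo 0 π) : uIcc x y ⊆ Ioo 0 π :=
  OrdConnected.uIcc_subset ordConnected_Ioo hx hy

lemma continuousOn_levelIntegrand {a : ℝ → ℝ} (ha : Continuous a) (α : ℝ) :
    ContinuousOn (fun x => (a x - α) * (S.γ x / S.ρ x)) (Ioo 0 π) :=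
  (ha.sub continuous_const).continuousOn.mul S.continuousOn_weight

lemma intervalIntegrable_level {a : ℝ → ℝ} (ha : Continuous a) (α : ℝ) {x y : ℝ}
    (hx : x ∈ Ioo 0 π) (hy : y ∈ Ioo 0 π) :
    IntervalIntegrable (fun x => (a x - α) * (S.γ x / S.ρ x)) volume x y :=
  ((continuousOn_levelIntegrand ha α).mono (uIcc_subset_Ioo hx hy)).intervalIntegrable

lemma levelInt_add {a : ℝ → ℝ} (ha : Continuous a) (α : ℝ) {x y z : ℝ} (hx : x ∈ Ioo 0 π)
    (hy : y ∈ Ioo 0 π) (hz : z ∈ Ioo 0 π) :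
    S.levelInt a α x y + S.levelInt a α y z = S.levelInt a α x z :=
  intervalIntegral.integral_add_adjacent_intervals (intervalIntegrable_level ha α hx hy)
    (intervalIntegrable_level ha α hy hz)

lemma levelInt_pos {a : ℝ → ℝ} (ha : Continuous a) {α x y : ℝ} (hx : x ∈ Ioo 0 π)
    (hy : y ∈ Ioo 0 π) (hxy : x < y) (h : ∀ t ∈ Ioo x y, α < a t) : 0 < S.levelInt a α x y :=
  intervalIntegral.intervalIntegral_pos_of_pos_on (intervalIntegrable_level ha α hx hy)
    (fun t ht => mul_pos (sub_pos.2 (h t ht))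
      (S.weight_pos ⟨hx.1.trans ht.1, ht.2.trans hy.2⟩)) hxy

/-- The reflection (a, α) ↦ (-a, -α) exchanges peaks and valleys, so each statement about a valley
follows from one about a peak. -/
lemma levelInt_neg_eq (S : Profile) (a : ℝ → ℝ) (α x y : ℝ) :
    S.levelInt (fun t => -a t) (-α) x y = -S.levelInt a α x y := by
  rw [levelInt, levelInt, ← intervalIntegral.integral_neg]
  refine intervalIntegral.integral_congr fun t _ => ?_
  ring

lemma levelInt_neg {a : ℝ → ℝ} (ha : Continuous a) {α x y : ℝ} (hx : x ∈ Ioo 0 π)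
    (hy : y ∈ Ioo 0 π) (hxy : x < y) (h : ∀ t ∈ Ioo x y, a t < α) : S.levelInt a α x y < 0 := by
  have := levelInt_pos (S := S) (a := fun t => -a t) (α := -α) ha.neg hx hy hxy
    fun t ht => neg_lt_neg (h t ht)
  rw [levelInt_neg_eq] at this
  linarith

/-! ### Bumps -/

/-- The primitive of `(a - α) γ / ρ` on `[s, t]`, extended by constants. -/
noncomputable def bump (S : Profile) (a : ℝ → ℝ) (α s t x : ℝ) : ℝ :=
  ∫ y in s..x, (Icc s t).indicator (fun y => (a y - α) * (S.γ y / S.ρ y)) y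

section

variable {a : ℝ → ℝ} {α s t : ℝ}

lemma bump_of_le (hsα : a s = α) {x : ℝ} (hx : x ≤ s) : S.bump a α s t x = 0 := by
  rw [bump, ← intervalIntegral.integral_zero (a := s) (b := x) (μ := volume)]
  refine intervalIntegral.integral_congr fun y hy => ?_
  rw [uIcc_of_ge hx] at hy
  rcases hy.2.lt_or_eq with h | h
  · exact indicator_of_notMem (fun h' => absurd h'.1 h.not_ge) _
  · by_cases h' : s ∈ Icc s t <;> simp [h, hsα, indicator]

lemma bump_of_mem {x : ℝ} (hx : x ∈ Icc s t) : S.bump a α s t x = S.levelInt a α s x := by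
  refine intervalIntegral.integral_congr fun y hy => ?_
  rw [uIcc_of_le hx.1] at hy
  have hy' : y ∈ Icc s t := ⟨hy.1, hy.2.trans hx.2⟩
  exact indicator_of_mem hy' _

/-- Because a = α at both ends, cutting off to [s, t] creates no jump. This is what makes the glued
function C¹ across the free boundary. -/
lemma continuous_bumpIntegrand (ha : Continuous a) (hs : s ∈ Ioo 0 π) (ht : t ∈ Ioo 0 π)
    (hst : s < t) (hsα : a s = α) (htα : a t = α) :
    Continuous ((Icc s t).indicator fun y => (a y - α) * (S.γ y / S.ρ y)) := by
  refine continuous_indicator ?_ ?_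
  · rw [frontier_Icc hst.le]
    rintro x (rfl | rfl) <;> simp [*]
  · rw [closure_Icc, ← uIcc_of_le hst.le]
    exact (continuousOn_levelIntegrand ha α).mono (uIcc_subset_Ioo hs ht)

lemma bump_of_ge (ha : Continuous a) (hs : s ∈ Ioo 0 π) (ht : t ∈ Ioo 0 π)
    (hst : s < t) (hsα : a s = α) (htα : a t = α) {x : ℝ} (hx : t ≤ x) :
    S.bump a α s t x = S.levelInt a α s t := by
  have hc := continuous_bumpIntegrand (S := S) ha hs ht hst hsα htα
  rw [← bump_of_mem (right_mem_Icc.2 hst.le), bump, bump,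
    ← intervalIntegral.integral_add_adjacent_intervals (hc.intervalIntegrable s t)
      (hc.intervalIntegrable t x), add_eq_left,
    ← intervalIntegral.integral_zero (a := t) (b := x) (μ := volume)]
  refine intervalIntegral.integral_congr fun y hy => ?_
  rw [uIcc_of_le hx] at hy
  rcases hy.1.lt_or_eq with h | h
  · exact indicator_of_notMem (fun h' => absurd h'.2 h.not_ge) _
  · by_cases h' : t ∈ Icc s t <;> simp [← h, htα, indicator]

lemma hasDerivAt_bump (ha : Continuous a) (hs : s ∈ Ioo 0 π) (ht : t ∈ Ioo 0 π)
    (hst : s < t) (hsα : a s = α) (htα : a t = α) (x : ℝ) :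
    HasDerivAt (S.bump a α s t)
      ((Icc s t).indicator (fun y => (a y - α) * (S.γ y / S.ρ y)) x) x := by
  have hc := continuous_bumpIntegrand (S := S) ha hs ht hst hsα htα
  exact intervalIntegral.integral_hasDerivAt_right (hc.intervalIntegrable _ _)
    hc.stronglyMeasurable.stronglyMeasurableAtFilter hc.continuousAt

/-- On [s, t] the flux v'ρ/γ is a - α, and it vanishes outside. Integration by parts against f
leaves -∫ a' f over (s, t), the boundary terms being killed by a(s) = a(t) = α. -/
lemma isFree_bump (ha : ContDiff ℝ 1 a) (hs : s ∈ Ioo 0 π) (ht : t ∈ Ioo 0 π)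
    (hst : s < t) (hsα : a s = α) (htα : a t = α) :
    S.IsFree a (S.bump a α s t) (Ioo s t) where
  contDiff := by
    have hd := hasDerivAt_bump (S := S) ha.continuous hs ht hst hsα htα
    rw [contDiff_one_iff_deriv]
    refine ⟨fun x => (hd x).differentiableAt, ?_⟩
    rw [show deriv (S.bump a α s t) = _ from funext fun x => (hd x).deriv]
    exact continuous_bumpIntegrand ha.continuous hs ht hst hsα htα
  near_zero := by
    filter_upwards [Iio_mem_nhds hs.1] with x hx
    rw [bump_of_le hsα hx.le, bump_of_le hsα hs.1.le]
  near_pi := by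
    filter_upwards [Ioi_mem_nhds ht.2] with x hx
    rw [bump_of_ge ha.continuous hs ht hst hsα htα (le_of_lt hx),
      bump_of_ge ha.continuous hs ht hst hsα htα ht.2.le]
  measurableSet := measurableSet_Ioo
  weak f hf := by
    have hsub : Icc s t ⊆ Icc 0 π := Icc_subset_Icc hs.1.le ht.2.le
    have e1 : ∫ x in Icc 0 π, deriv (S.bump a α s t) x * (S.ρ x / S.γ x) * deriv f x =
        ∫ x in s..t, (a x - α) * deriv f x := by
      rw [intervalIntegral.integral_of_le hst.le, ← integral_Icc_eq_integral_Ioc]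
      have h1 := setIntegral_indicator (s := Icc 0 π) (t := Icc s t) (μ := volume)
        (f := fun x => (a x - α) * deriv f x) measurableSet_Icc
      rw [inter_eq_right.2 hsub] at h1
      rw [← h1]
      refine setIntegral_congr_fun measurableSet_Icc fun x hx => ?_
      simp only [(hasDerivAt_bump (S := S) ha.continuous hs ht hst hsα htα x).deriv]
      by_cases hxs : x ∈ Icc s t
      · have hρ := (S.ρ_pos x ⟨hs.1.trans_le hxs.1, hxs.2.trans_lt ht.2⟩).ne'
        have hγ := (S.γ_pos hx).ne'
        rw [indicator_of_mem hxs, indicator_of_mem hxs]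
        field_simp
      · rw [indicator_of_notMem hxs, indicator_of_notMem hxs, zero_mul, zero_mul]
    have e2 : ∫ x in Icc 0 π, (Ioo s t).indicator (fun x => deriv a x * f x) x =
        ∫ x in s..t, deriv a x * f x := by
      rw [setIntegral_indicator measurableSet_Ioo,
        inter_eq_right.2 (Ioo_subset_Icc_self.trans hsub), intervalIntegral.integral_of_le hst.le,
        integral_Ioc_eq_integral_Ioo]
    have hsub' : uIcc s t ⊆ Icc 0 π := by rwa [uIcc_of_le hst.le]
    have h3 := intervalIntegral.integral_mul_deriv_eq_deriv_mul (a := s) (b := t)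
      (u := fun x => a x - α) (u' := deriv a) (v := f) (v' := deriv f)
      (fun x _ => ((ha.differentiable (by simp) x).hasDerivAt.sub_const α))
      (fun x hx => ((hf x (hsub' hx)).differentiableAt (by simp)).hasDerivAt)
      ((continuous_deriv_of_contDiff ha).intervalIntegrable _ _)
      (((continuousOn_deriv_of_contDiffAt hf).mono hsub').intervalIntegrable)
    rw [e1, e2, h3, hsα, htα]
    ring

end

/-- `b` vanishes before `s`, equals `e` after `t`, and has values in `(l, h)` in between. -/
structure IsRamp (b : ℝ → ℝ) (s t l h e : ℝ) : Prop where
  before : ∀ x ≤ s, b x = 0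
  between : ∀ x ∈ Ioo s t, b x ∈ Ioo l h
  after : ∀ x, t ≤ x → b x = e

lemma isRamp_bump {a : ℝ → ℝ} {α s t l h : ℝ} (ha : Continuous a) (hs : s ∈ Ioo 0 π)
    (ht : t ∈ Ioo 0 π) (hst : s < t) (hsα : a s = α) (htα : a t = α)
    (hlh : ∀ x ∈ Ioo s t, S.levelInt a α s x ∈ Ioo l h) :
    IsRamp (S.bump a α s t) s t l h (S.levelInt a α s t) where
  before _ hx := bump_of_le hsα hx
  between x hx := by
    rw [bump_of_mem (Ioo_subset_Icc_self hx)]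
    exact hlh x hx
  after _ hx := bump_of_ge ha hs ht hst hsα htα hx

/-! ### Gluing ramps into solutions of the obstacle problem -/

section Assemble

variable {a : ℝ → ℝ} {H : E3 → ℝ} {β : ℝ}

/-- The solution is -β/2 + b: it rests on the lower obstacle before s and on the upper one after t,
in agreement with the sign of a'. The number δ marks a stretch next to the pole where a' > 0, which
uniqueness requires. -/
lemma solves_one {b : ℝ → ℝ} {s t δ : ℝ} (hβ : 0 < β) (ha : ContDiff ℝ 1 a)
    (hH : S.IsInducedField a H) (hδ : 0 < δ) (hδs : δ < s) (hst : s < t) (ht : t < π)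
    (hb : S.IsFree a b (Ioo s t)) (hr : IsRamp b s t 0 β β)
    (h0 : ∀ x ∈ Ioc 0 δ, 0 < deriv a x) (h1 : ∀ x ∈ Icc 0 s, 0 ≤ deriv a x)
    (h2 : ∀ x ∈ Icc t π, deriv a x ≤ 0) :
    ∃ V, S.IsTheSolution H β V ∧ S.SC β V = S.band s t := by
  have hF := (IsFree.const (S := S) a (-(β / 2))).add ha hb (empty_disjoint _)
  rw [empty_union] at hF
  refine ⟨_, hF.solves hβ ha hH (fun x hx => ⟨by linarith [hx.1], by linarith [hx.2]⟩) ?_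
    (s := δ) ⟨hδ, by linarith⟩ fun x hx => ⟨fun h => by linarith [h.1, hx.2], h0 x hx⟩⟩
  intro x hx
  rcases le_or_gt x s with hxs | hxs
  · exact Or.inr ⟨fun h => absurd h.1 hxs.not_gt, Or.inl ⟨by rw [hr.before x hxs, add_zero],
      h1 x ⟨hx.1, hxs⟩⟩⟩
  rcases lt_or_ge x t with hxt | hxt
  · have := hr.between x ⟨hxs, hxt⟩
    exact Or.inl ⟨⟨hxs, hxt⟩, abs_lt.2 ⟨by linarith [this.1], by linarith [this.2]⟩⟩
  · exact Or.inr ⟨fun h => absurd h.2 hxt.not_gt, Or.inr ⟨by rw [hr.after x hxt]; ring,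
      h2 x ⟨hxt, hx.2⟩⟩⟩

/-- Two free intervals: an excursion from the lower obstacle, then the ascent. -/
lemma solves_two {b b' : ℝ → ℝ} {s t s' t' δ : ℝ} (hβ : 0 < β) (ha : ContDiff ℝ 1 a)
    (hH : S.IsInducedField a H) (hδ : 0 < δ) (hδs : δ < s) (hst : s < t) (hts : t ≤ s')
    (hst' : s' < t') (ht : t' < π)
    (hb : S.IsFree a b (Ioo s t)) (hb' : S.IsFree a b' (Ioo s' t'))
    (hr : IsRamp b s t 0 β 0) (hr' : IsRamp b' s' t' 0 β β)
    (h0 : ∀ x ∈ Ioc 0 δ, 0 < deriv a x) (h1 : ∀ x ∈ Icc 0 s, 0 ≤ deriv a x)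
    (h2 : ∀ x ∈ Icc t s', 0 ≤ deriv a x) (h3 : ∀ x ∈ Icc t' π, deriv a x ≤ 0) :
    ∃ V, S.IsTheSolution H β V ∧ S.SC β V = S.band s t ∪ S.band s' t' := by
  have hd : Disjoint (Ioo s t) (Ioo s' t') := disjoint_left.2 fun x h h' => by
    linarith [h.2, h'.1]
  have hF := ((IsFree.const (S := S) a (-(β / 2))).add ha hb (empty_disjoint _))
  rw [empty_union] at hF
  have hF' := hF.add ha hb' hd
  have hsol := hF'.solves (H := H) hβ ha hH ?_ ?_
    (s := δ) ⟨hδ, by linarith⟩ fun x hx => ⟨?_, h0 x hx⟩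
  · exact ⟨_, hsol.1, by rw [hsol.2, union_prod, image_union]; rfl⟩
  · rintro x (hx | hx) <;> exact ⟨by linarith [hx.1], by linarith [hx.2]⟩
  · intro x hx
    rcases le_or_gt x s with hxs | hxs
    · refine Or.inr ⟨?_, Or.inl ⟨?_, h1 x ⟨hx.1, hxs⟩⟩⟩
      · rintro (h | h) <;> linarith [h.1]
      · rw [hr.before x hxs, hr'.before x (by linarith)]; ring
    rcases lt_or_ge x t with hxt | hxt
    · have := hr.between x ⟨hxs, hxt⟩
      refine Or.inl ⟨Or.inl ⟨hxs, hxt⟩, ?_⟩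
      rw [hr'.before x (by linarith)]
      exact abs_lt.2 ⟨by linarith [this.1], by linarith [this.2]⟩
    rcases le_or_gt x s' with hxs' | hxs'
    · refine Or.inr ⟨?_, Or.inl ⟨?_, h2 x ⟨hxt, hxs'⟩⟩⟩
      · rintro (h | h) <;> linarith [h.1, h.2]
      · rw [hr.after x hxt, hr'.before x hxs']; ring
    rcases lt_or_ge x t' with hxt' | hxt'
    · have := hr'.between x ⟨hxs', hxt'⟩
      refine Or.inl ⟨Or.inr ⟨hxs', hxt'⟩, ?_⟩
      rw [hr.after x hxt]
      exact abs_lt.2 ⟨by linarith [this.1], by linarith [this.2]⟩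
    · refine Or.inr ⟨?_, Or.inr ⟨?_, h3 x ⟨hxt', hx.2⟩⟩⟩
      · rintro (h | h) <;> linarith [h.2]
      · rw [hr.after x hxt, hr'.after x hxt']; ring
  · rintro (h | h) <;> linarith [h.1, hx.2]

/-- Two free intervals: the ascent, then an excursion from the upper obstacle. -/
lemma solves_two' {b b' : ℝ → ℝ} {s t s' t' δ : ℝ} (hβ : 0 < β) (ha : ContDiff ℝ 1 a)
    (hH : S.IsInducedField a H) (hδ : 0 < δ) (hδs : δ < s) (hst : s < t) (hts : t ≤ s')
    (hst' : s' < t') (ht : t' < π)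
    (hb : S.IsFree a b (Ioo s t)) (hb' : S.IsFree a b' (Ioo s' t'))
    (hr : IsRamp b s t 0 β β) (hr' : IsRamp b' s' t' (-β) 0 0)
    (h0 : ∀ x ∈ Ioc 0 δ, 0 < deriv a x) (h1 : ∀ x ∈ Icc 0 s, 0 ≤ deriv a x)
    (h2 : ∀ x ∈ Icc t s', deriv a x ≤ 0) (h3 : ∀ x ∈ Icc t' π, deriv a x ≤ 0) :
    ∃ V, S.IsTheSolution H β V ∧ S.SC β V = S.band s t ∪ S.band s' t' := by
  have hd : Disjoint (Ioo s t) (Ioo s' t') := disjoint_left.2 fun x h h' => by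
    linarith [h.2, h'.1]
  have hF := ((IsFree.const (S := S) a (-(β / 2))).add ha hb (empty_disjoint _))
  rw [empty_union] at hF
  have hF' := hF.add ha hb' hd
  have hsol := hF'.solves (H := H) hβ ha hH ?_ ?_
    (s := δ) ⟨hδ, by linarith⟩ fun x hx => ⟨?_, h0 x hx⟩
  · exact ⟨_, hsol.1, by rw [hsol.2, union_prod, image_union]; rfl⟩
  · rintro x (hx | hx) <;> exact ⟨by linarith [hx.1], by linarith [hx.2]⟩
  · intro x hx
    rcases le_or_gt x s with hxs | hxs
    · refine Or.inr ⟨?_, Or.inl ⟨?_, h1 x ⟨hx.1, hxs⟩⟩⟩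
      · rintro (h | h) <;> linarith [h.1]
      · rw [hr.before x hxs, hr'.before x (by linarith)]; ring
    rcases lt_or_ge x t with hxt | hxt
    · have := hr.between x ⟨hxs, hxt⟩
      refine Or.inl ⟨Or.inl ⟨hxs, hxt⟩, ?_⟩
      rw [hr'.before x (by linarith)]
      exact abs_lt.2 ⟨by linarith [this.1], by linarith [this.2]⟩
    rcases le_or_gt x s' with hxs' | hxs'
    · refine Or.inr ⟨?_, Or.inr ⟨?_, h2 x ⟨hxt, hxs'⟩⟩⟩
      · rintro (h | h) <;> linarith [h.1, h.2]
      · rw [hr.after x hxt, hr'.before x hxs']; ring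
    rcases lt_or_ge x t' with hxt' | hxt'
    · have := hr'.between x ⟨hxs', hxt'⟩
      refine Or.inl ⟨Or.inr ⟨hxs', hxt'⟩, ?_⟩
      rw [hr.after x hxt]
      exact abs_lt.2 ⟨by linarith [this.1], by linarith [this.2]⟩
    · refine Or.inr ⟨?_, Or.inr ⟨?_, h3 x ⟨hxt', hx.2⟩⟩⟩
      · rintro (h | h) <;> linarith [h.2]
      · rw [hr.after x hxt, hr'.after x hxt']; ring
  · rintro (h | h) <;> linarith [h.1, hx.2]

/-- The sum -β/2 + b₁ + b₂ + b₃ goes up, down and up again between the obstacles, because at each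
point at most one ramp is in progress and the others are at an end value. Neighbouring intervals are
allowed to touch, so that threshold values of β are covered as well. -/
lemma solves_three {b₁ b₂ b₃ : ℝ → ℝ} {s₁ t₁ s₂ t₂ s₃ t₃ δ : ℝ} (hβ : 0 < β)
    (ha : ContDiff ℝ 1 a) (hH : S.IsInducedField a H) (hδ : 0 < δ) (hδs : δ < s₁)
    (hst₁ : s₁ < t₁) (h12 : t₁ ≤ s₂) (hst₂ : s₂ < t₂) (h23 : t₂ ≤ s₃) (hst₃ : s₃ < t₃)
    (ht : t₃ < π) (hb₁ : S.IsFree a b₁ (Ioo s₁ t₁)) (hb₂ : S.IsFree a b₂ (Ioo s₂ t₂))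
    (hb₃ : S.IsFree a b₃ (Ioo s₃ t₃)) (hr₁ : IsRamp b₁ s₁ t₁ 0 β β)
    (hr₂ : IsRamp b₂ s₂ t₂ (-β) 0 (-β)) (hr₃ : IsRamp b₃ s₃ t₃ 0 β β)
    (h0 : ∀ x ∈ Ioc 0 δ, 0 < deriv a x) (h1 : ∀ x ∈ Icc 0 s₁, 0 ≤ deriv a x)
    (h2 : ∀ x ∈ Icc t₁ s₂, deriv a x ≤ 0) (h3 : ∀ x ∈ Icc t₂ s₃, 0 ≤ deriv a x)
    (h4 : ∀ x ∈ Icc t₃ π, deriv a x ≤ 0) :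
    ∃ V, S.IsTheSolution H β V ∧
      S.SC β V = S.band s₁ t₁ ∪ S.band s₂ t₂ ∪ S.band s₃ t₃ := by
  have hF := ((IsFree.const (S := S) a (-(β / 2))).add ha hb₁ (empty_disjoint _))
  rw [empty_union] at hF
  have hF' := (hF.add ha hb₂ (disjoint_left.2 fun x h h' => by linarith [h.2, h'.1])).add ha hb₃
    (disjoint_left.2 fun x h h' => by rcases h with h | h <;> linarith [h.2, h'.1])
  have hsol := hF'.solves (H := H) hβ ha hH ?_ ?_
    (s := δ) ⟨hδ, by linarith⟩ fun x hx => ⟨?_, h0 x hx⟩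
  · exact ⟨_, hsol.1, by rw [hsol.2, union_prod, image_union, union_prod, image_union]; rfl⟩
  · rintro x ((hx | hx) | hx) <;> exact ⟨by linarith [hx.1], by linarith [hx.2]⟩
  · intro x hx
    rcases le_or_gt x s₁ with hs₁ | hs₁
    · refine Or.inr ⟨?_, Or.inl ⟨?_, h1 x ⟨hx.1, hs₁⟩⟩⟩
      · rintro ((h | h) | h) <;> linarith [h.1]
      · rw [hr₁.before x hs₁, hr₂.before x (by linarith), hr₃.before x (by linarith)]; ring
    rcases lt_or_ge x t₁ with ht₁ | ht₁
    · have := hr₁.between x ⟨hs₁, ht₁⟩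
      refine Or.inl ⟨Or.inl (Or.inl ⟨hs₁, ht₁⟩), ?_⟩
      rw [hr₂.before x (by linarith), hr₃.before x (by linarith)]
      exact abs_lt.2 ⟨by linarith [this.1], by linarith [this.2]⟩
    rcases le_or_gt x s₂ with hs₂ | hs₂
    · refine Or.inr ⟨?_, Or.inr ⟨?_, h2 x ⟨ht₁, hs₂⟩⟩⟩
      · rintro ((h | h) | h) <;> linarith [h.1, h.2]
      · rw [hr₁.after x ht₁, hr₂.before x hs₂, hr₃.before x (by linarith)]; ring
    rcases lt_or_ge x t₂ with ht₂ | ht₂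
    · have := hr₂.between x ⟨hs₂, ht₂⟩
      refine Or.inl ⟨Or.inl (Or.inr ⟨hs₂, ht₂⟩), ?_⟩
      rw [hr₁.after x ht₁, hr₃.before x (by linarith)]
      exact abs_lt.2 ⟨by linarith [this.1], by linarith [this.2]⟩
    rcases le_or_gt x s₃ with hs₃ | hs₃
    · refine Or.inr ⟨?_, Or.inl ⟨?_, h3 x ⟨ht₂, hs₃⟩⟩⟩
      · rintro ((h | h) | h) <;> linarith [h.1, h.2]
      · rw [hr₁.after x ht₁, hr₂.after x ht₂, hr₃.before x hs₃]; ring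
    rcases lt_or_ge x t₃ with ht₃ | ht₃
    · have := hr₃.between x ⟨hs₃, ht₃⟩
      refine Or.inl ⟨Or.inr ⟨hs₃, ht₃⟩, ?_⟩
      rw [hr₁.after x ht₁, hr₂.after x ht₂]
      exact abs_lt.2 ⟨by linarith [this.1], by linarith [this.2]⟩
    · refine Or.inr ⟨?_, Or.inr ⟨?_, h4 x ⟨ht₃, hx.2⟩⟩⟩
      · rintro ((h | h) | h) <;> linarith [h.2]
      · rw [hr₁.after x ht₁, hr₂.after x ht₂, hr₃.after x ht₃]; ring
  · rintro ((h | h) | h) <;> linarith [h.1, hx.2]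

end Assemble

end Profile

/-! ### The shape of `a` -/

lemma deriv_nonneg_of_pos_Ioo {a : ℝ → ℝ} (ha : ContDiff ℝ 1 a) {x y : ℝ} (hxy : x < y)
    (h : ∀ t ∈ Ioo x y, 0 < deriv a t) : ∀ t ∈ Icc x y, 0 ≤ deriv a t := by
  intro t ht
  rw [← closure_Ioo hxy.ne] at ht
  exact closure_minimal (fun s hs => (h s hs).le)
    (isClosed_le continuous_const (ha.continuous_deriv le_rfl)) ht

lemma deriv_nonpos_of_neg_Ioo {a : ℝ → ℝ} (ha : ContDiff ℝ 1 a) {x y : ℝ} (hxy : x < y)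
    (h : ∀ t ∈ Ioo x y, deriv a t < 0) : ∀ t ∈ Icc x y, deriv a t ≤ 0 := by
  intro t ht
  rw [← closure_Ioo hxy.ne] at ht
  exact closure_minimal (fun s hs => (h s hs).le)
    (isClosed_le (ha.continuous_deriv le_rfl) continuous_const) ht

namespace IsDoubleBump

variable {a : ℝ → ℝ} {φ₁ φ₂ φ₃ : ℝ}

lemma continuous (ha : IsDoubleBump a φ₁ φ₂ φ₃) : Continuous a := ha.contDiff.continuous

lemma strictMonoOn_left (ha : IsDoubleBump a φ₁ φ₂ φ₃) : StrictMonoOn a (Icc 0 φ₁) :=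
  strictMonoOn_of_deriv_pos (convex_Icc _ _) ha.continuous.continuousOn
    (by rw [interior_Icc]; exact ha.incr₁)

lemma strictAntiOn_left (ha : IsDoubleBump a φ₁ φ₂ φ₃) : StrictAntiOn a (Icc φ₁ φ₂) :=
  strictAntiOn_of_deriv_neg (convex_Icc _ _) ha.continuous.continuousOn
    (by rw [interior_Icc]; exact ha.decr₁)

lemma strictMonoOn_right (ha : IsDoubleBump a φ₁ φ₂ φ₃) : StrictMonoOn a (Icc φ₂ φ₃) :=
  strictMonoOn_of_deriv_pos (convex_Icc _ _) ha.continuous.continuousOn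
    (by rw [interior_Icc]; exact ha.incr₂)

lemma strictAntiOn_right (ha : IsDoubleBump a φ₁ φ₂ φ₃) : StrictAntiOn a (Icc φ₃ π) :=
  strictAntiOn_of_deriv_neg (convex_Icc _ _) ha.continuous.continuousOn
    (by rw [interior_Icc]; exact ha.decr₂)

lemma nonneg (ha : IsDoubleBump a φ₁ φ₂ φ₃) {x : ℝ} (hx : x ∈ Icc 0 π) : 0 ≤ a x := by
  rcases eq_or_lt_of_le hx.1 with h | h
  · rw [← h, ha.zero]
  rcases eq_or_lt_of_le hx.2 with h' | h'
  · rw [h', ha.pi]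
  exact (ha.pos x ⟨h, h'⟩).le

lemma level_pos (ha : IsDoubleBump a φ₁ φ₂ φ₃) : 0 < a φ₂ :=
  ha.pos _ ⟨by linarith [ha.order.1, ha.order.2.1], by linarith [ha.order.2.2.1, ha.order.2.2.2]⟩

lemma level_lt_left (ha : IsDoubleBump a φ₁ φ₂ φ₃) : a φ₂ < a φ₁ :=
  ha.strictAntiOn_left (left_mem_Icc.2 ha.order.2.1.le) (right_mem_Icc.2 ha.order.2.1.le)
    ha.order.2.1

/-- The two peaks and the valley: comparison with the values at the ends of an interval. -/
lemma lt_of_mem_left (ha : IsDoubleBump a φ₁ φ₂ φ₃) {α s t : ℝ} (hs : s ∈ Icc 0 φ₁)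
    (ht : t ∈ Icc φ₁ φ₂) (hsα : α ≤ a s) (htα : α ≤ a t) : ∀ x ∈ Ioo s t, α < a x := by
  intro x hx
  rcases le_total x φ₁ with h | h
  · exact hsα.trans_lt (ha.strictMonoOn_left hs ⟨hs.1.trans hx.1.le, h⟩ hx.1)
  · exact htα.trans_lt (ha.strictAntiOn_left ⟨h, hx.2.le.trans ht.2⟩ ht hx.2)

lemma gt_of_mem_valley (ha : IsDoubleBump a φ₁ φ₂ φ₃) {α s t : ℝ} (hs : s ∈ Icc φ₁ φ₂)
    (ht : t ∈ Icc φ₂ φ₃) (hsα : a s ≤ α) (htα : a t ≤ α) : ∀ x ∈ Ioo s t, a x < α := by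
  intro x hx
  rcases le_total x φ₂ with h | h
  · exact (ha.strictAntiOn_left hs ⟨hs.1.trans hx.1.le, h⟩ hx.1).trans_le hsα
  · exact (ha.strictMonoOn_right ⟨h, hx.2.le.trans ht.2⟩ ht hx.2).trans_le htα

lemma lt_of_mem_right (ha : IsDoubleBump a φ₁ φ₂ φ₃) {α s t : ℝ} (hs : s ∈ Icc φ₂ φ₃)
    (ht : t ∈ Icc φ₃ π) (hsα : α ≤ a s) (htα : α ≤ a t) : ∀ x ∈ Ioo s t, α < a x := by
  intro x hx
  rcases le_total x φ₃ with h | h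
  · exact hsα.trans_lt (ha.strictMonoOn_right hs ⟨hs.1.trans hx.1.le, h⟩ hx.1)
  · exact htα.trans_lt (ha.strictAntiOn_right ⟨h, hx.2.le.trans ht.2⟩ ht hx.2)

end IsDoubleBump

/-- Inverse functions of `a` on its intervals of monotonicity. -/
structure IsRoots (a : ℝ → ℝ) (φ₁ φ₂ φ₃ : ℝ) (φm ψp ψm φp : ℝ → ℝ) : Prop where
  mem_φm : ∀ α ∈ Icc 0 (a φ₁), φm α ∈ Icc 0 φ₁
  apply_φm : ∀ α ∈ Icc 0 (a φ₁), a (φm α) = α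
  mem_ψp : ∀ α ∈ Icc (a φ₂) (a φ₁), ψp α ∈ Icc φ₁ φ₂
  apply_ψp : ∀ α ∈ Icc (a φ₂) (a φ₁), a (ψp α) = α
  mem_ψm : ∀ α ∈ Icc (a φ₂) (a φ₃), ψm α ∈ Icc φ₂ φ₃
  apply_ψm : ∀ α ∈ Icc (a φ₂) (a φ₃), a (ψm α) = α
  mem_φp : ∀ α ∈ Icc 0 (a φ₃), φp α ∈ Icc φ₃ π
  apply_φp : ∀ α ∈ Icc 0 (a φ₃), a (φp α) = α

/-- The roots may be chosen arbitrarily outside the stated ranges of levels, and their continuity in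
α is not needed: the areas of the peaks and of the valley are continuous as integrals of truncations
over fixed intervals. -/
lemma IsDoubleBump.exists_isRoots {a : ℝ → ℝ} {φ₁ φ₂ φ₃ : ℝ} (ha : IsDoubleBump a φ₁ φ₂ φ₃) :
    ∃ φm ψp ψm φp : ℝ → ℝ, IsRoots a φ₁ φ₂ φ₃ φm ψp ψm φp := by
  obtain ⟨o1, o2, o3, o4⟩ := ha.order
  have h1 := intermediate_value_Icc o1.le (ha.continuous.continuousOn (s := Icc 0 φ₁))
  have h2 := intermediate_value_Icc' o2.le (ha.continuous.continuousOn (s := Icc φ₁ φ₂))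
  have h3 := intermediate_value_Icc o3.le (ha.continuous.continuousOn (s := Icc φ₂ φ₃))
  have h4 := intermediate_value_Icc' o4.le (ha.continuous.continuousOn (s := Icc φ₃ π))
  rw [ha.zero] at h1
  rw [ha.pi] at h4
  choose! φm m1 e1 using h1
  choose! ψp m2 e2 using h2
  choose! ψm m3 e3 using h3
  choose! φp m4 e4 using h4
  exact ⟨φm, ψp, ψm, φp, m1, e1, m2, e2, m3, e3, m4, e4⟩

namespace Profile

variable {S : Profile}

/-- The weight blows up at the poles, but a' = Hργ vanishes there because H is finite, so a vanishes
to higher order than ρ. -/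
lemma continuousOn_mul_weight {a : ℝ → ℝ} {φ₁ φ₂ φ₃ : ℝ} {H : E3 → ℝ}
    (ha : IsDoubleBump a φ₁ φ₂ φ₃) (hH : S.IsInducedField a H) :
    ContinuousOn (fun x => a x * (S.γ x / S.ρ x)) (Icc 0 π) := by
  have hd : ∀ x, HasDerivAt a (deriv a x) x := fun x =>
    (ha.contDiff.differentiable (by simp) x).hasDerivAt
  intro x hx
  refine ContinuousAt.continuousWithinAt ?_
  rcases eq_or_lt_of_le hx.1 with h | h
  · have h0 : deriv a 0 = 0 := by
      rw [hH.2 0 ⟨le_rfl, Real.pi_pos.le⟩ 0, S.ρ_zero, zero_mul, mul_zero]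
    have hd0 := hd 0
    rw [h0] at hd0
    rw [← h]
    exact S.continuousAt_mul_weight hd0 ha.zero S.ρ_zero S.deriv_ρ_zero_pos.ne'
  rcases eq_or_lt_of_le hx.2 with h' | h'
  · have h0 : deriv a π = 0 := by
      rw [hH.2 π ⟨Real.pi_pos.le, le_rfl⟩ 0, S.ρ_pi, zero_mul, mul_zero]
    have hdπ := hd π
    rw [h0] at hdπ
    rw [h']
    exact S.continuousAt_mul_weight hdπ ha.pi S.ρ_pi S.deriv_ρ_pi_neg.ne
  · exact (ha.continuous.continuousOn.mul S.continuousOn_weight).continuousAt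
      (Ioo_mem_nhds h h')

lemma measurable_weight (S : Profile) : Measurable fun x => S.γ x / S.ρ x :=
  S.continuous_γ.measurable.div S.continuous_ρ.measurable

/-! ### Integrals of truncations -/

/-- The integral of `(a - α)⁺ γ / ρ`, for nonnegative levels `α`. -/
noncomputable def excess (S : Profile) (a : ℝ → ℝ) (x y α : ℝ) : ℝ :=
  ∫ t in x..y, max (a t - max α 0) 0 * (S.γ t / S.ρ t)

/-- The integral of `(α - a)⁺ γ / ρ`, for levels `α ≤ M`. -/
noncomputable def deficit (S : Profile) (a : ℝ → ℝ) (M x y α : ℝ) : ℝ :=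
  ∫ t in x..y, max (min α M - a t) 0 * (S.γ t / S.ρ t)

/-- The integral of a truncation is a level integral. -/
lemma integral_truncation_eq_levelInt (S : Profile) {a : ℝ → ℝ} {α x s t y : ℝ} (hxs : x ≤ s)
    (hst : s ≤ t) (hty : t ≤ y) (h1 : ∀ z ∈ Ioc x s, a z ≤ α) (h2 : ∀ z ∈ Ioc s t, α ≤ a z)
    (h3 : ∀ z ∈ Ioc t y, a z ≤ α) :
    ∫ z in x..y, max (a z - α) 0 * (S.γ z / S.ρ z) = S.levelInt a α s t := by
  rw [levelInt, intervalIntegral.integral_of_le (hxs.trans (hst.trans hty)),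
    intervalIntegral.integral_of_le hst]
  have h := setIntegral_indicator (s := Ioc x y) (t := Ioc s t) (μ := volume)
    (f := fun z => (a z - α) * (S.γ z / S.ρ z)) measurableSet_Ioc
  rw [inter_eq_right.2 (Ioc_subset_Ioc hxs hty)] at h
  rw [← h]
  refine setIntegral_congr_fun measurableSet_Ioc fun z hz => ?_
  by_cases hzs : z ∈ Ioc s t
  · rw [indicator_of_mem hzs, max_eq_left (sub_nonneg.2 (h2 z hzs))]
  · have hle : a z ≤ α := by
      rcases le_or_gt z s with h | h
      · exact h1 z ⟨hz.1, h⟩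
      · exact h3 z ⟨lt_of_not_ge fun h' => hzs ⟨h, h'⟩, hz.2⟩
    rw [indicator_of_notMem hzs, max_eq_right (sub_nonpos.2 hle), zero_mul]

lemma excess_eq_levelInt (S : Profile) {a : ℝ → ℝ} {α x s t y : ℝ} (hα : 0 ≤ α) (hxs : x ≤ s)
    (hst : s ≤ t) (hty : t ≤ y) (h1 : ∀ z ∈ Ioc x s, a z ≤ α) (h2 : ∀ z ∈ Ioc s t, α ≤ a z)
    (h3 : ∀ z ∈ Ioc t y, a z ≤ α) : S.excess a x y α = S.levelInt a α s t := by
  rw [excess, max_eq_left hα]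
  exact S.integral_truncation_eq_levelInt hxs hst hty h1 h2 h3

lemma deficit_eq_levelInt (S : Profile) {a : ℝ → ℝ} {α M x s t y : ℝ} (hα : α ≤ M) (hxs : x ≤ s)
    (hst : s ≤ t) (hty : t ≤ y) (h1 : ∀ z ∈ Ioc x s, α ≤ a z) (h2 : ∀ z ∈ Ioc s t, a z ≤ α)
    (h3 : ∀ z ∈ Ioc t y, α ≤ a z) : S.deficit a M x y α = -S.levelInt a α s t := by
  rw [deficit, min_eq_left hα, ← levelInt_neg_eq,
    ← S.integral_truncation_eq_levelInt (a := fun t => -a t) (α := -α) hxs hst hty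
      (fun z hz => neg_le_neg (h1 z hz)) (fun z hz => neg_le_neg (h2 z hz))
      (fun z hz => neg_le_neg (h3 z hz))]
  simp only [sub_neg_eq_add, neg_add_eq_sub]

section

variable {a : ℝ → ℝ} {x y : ℝ}

lemma abs_excessIntegrand_le (hpos : ∀ t ∈ Icc 0 π, 0 ≤ a t) (α : ℝ) {t : ℝ} (ht : t ∈ Icc 0 π) :
    ‖max (a t - max α 0) 0 * (S.γ t / S.ρ t)‖ ≤ a t * (S.γ t / S.ρ t) := by
  have hw := S.weight_nonneg ht
  rw [Real.norm_of_nonneg (mul_nonneg (le_max_right _ _) hw)]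
  refine mul_le_mul_of_nonneg_right (max_le ?_ (hpos t ht)) hw
  linarith [le_max_right α 0]

lemma intervalIntegrable_mul_weight
    (haw : ContinuousOn (fun x => a x * (S.γ x / S.ρ x)) (Icc 0 π)) (hx : x ∈ Icc 0 π)
    (hy : y ∈ Icc 0 π) : IntervalIntegrable (fun t => a t * (S.γ t / S.ρ t)) volume x y :=
  (haw.mono (OrdConnected.uIcc_subset ordConnected_Icc hx hy)).intervalIntegrable

lemma measurable_excessIntegrand (S : Profile) (ha : Continuous a) (α : ℝ) :
    Measurable fun t => max (a t - max α 0) 0 * (S.γ t / S.ρ t) :=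
  ((ha.sub continuous_const).max continuous_const).measurable.mul S.measurable_weight

lemma intervalIntegrable_excess (ha : Continuous a) (hpos : ∀ t ∈ Icc 0 π, 0 ≤ a t)
    (haw : ContinuousOn (fun x => a x * (S.γ x / S.ρ x)) (Icc 0 π)) (hx : x ∈ Icc 0 π)
    (hy : y ∈ Icc 0 π) (α : ℝ) :
    IntervalIntegrable (fun t => max (a t - max α 0) 0 * (S.γ t / S.ρ t)) volume x y := by
  refine (intervalIntegrable_mul_weight haw hx hy).mono_fun'
    (S.measurable_excessIntegrand ha α).aestronglyMeasurable ?_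
  filter_upwards [ae_restrict_mem measurableSet_uIoc] with t ht
  exact abs_excessIntegrand_le hpos α
    (OrdConnected.uIcc_subset ordConnected_Icc hx hy (uIoc_subset_uIcc ht))

/-- Dominated convergence with the bound aγ/ρ, integrable up to the poles. Clamping the level at 0
is what makes this bound valid for every real α. -/
lemma continuous_excess (ha : Continuous a) (hpos : ∀ t ∈ Icc 0 π, 0 ≤ a t)
    (haw : ContinuousOn (fun x => a x * (S.γ x / S.ρ x)) (Icc 0 π)) (hx : x ∈ Icc 0 π)
    (hy : y ∈ Icc 0 π) : Continuous (S.excess a x y) := by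
  refine intervalIntegral.continuous_of_dominated_interval
    (bound := fun t => a t * (S.γ t / S.ρ t))
    (fun α => (S.measurable_excessIntegrand ha α).aestronglyMeasurable)
    (fun α => .of_forall fun t ht => abs_excessIntegrand_le hpos α
      (OrdConnected.uIcc_subset ordConnected_Icc hx hy (uIoc_subset_uIcc ht)))
    (intervalIntegrable_mul_weight haw hx hy) (.of_forall fun t _ => ?_)
  fun_prop

lemma excess_antitone (ha : Continuous a) (hpos : ∀ t ∈ Icc 0 π, 0 ≤ a t)
    (haw : ContinuousOn (fun x => a x * (S.γ x / S.ρ x)) (Icc 0 π)) (hx : x ∈ Icc 0 π)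
    (hy : y ∈ Icc 0 π) (hxy : x ≤ y) : Antitone (S.excess a x y) := by
  intro α α' h
  refine intervalIntegral.integral_mono_on hxy (intervalIntegrable_excess ha hpos haw hx hy α')
    (intervalIntegrable_excess ha hpos haw hx hy α) fun t ht => ?_
  refine mul_le_mul_of_nonneg_right ?_ (S.weight_nonneg ⟨hx.1.trans ht.1, ht.2.trans hy.2⟩)
  gcongr

lemma excess_zero_level (hpos : ∀ t ∈ Icc 0 π, 0 ≤ a t) (hx : x ∈ Icc 0 π) (hy : y ∈ Icc 0 π) :
    S.excess a x y 0 = ∫ t in x..y, a t * (S.γ t / S.ρ t) := by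
  refine intervalIntegral.integral_congr fun t ht => ?_
  simp [max_eq_left (hpos t (OrdConnected.uIcc_subset ordConnected_Icc hx hy ht))]

lemma continuousOn_deficitIntegrand (S : Profile) (ha : Continuous a) (M α : ℝ) :
    ContinuousOn (fun t => max (min α M - a t) 0 * (S.γ t / S.ρ t)) (Ioo 0 π) :=
  ContinuousOn.mul (by fun_prop) S.continuousOn_weight

/-- The interval stays away from the poles, so γ/ρ is integrable on it; clamping the level at M
bounds the truncation by M. -/
lemma continuous_deficit (ha : Continuous a) {M : ℝ} (hM : 0 ≤ M) (hpos : ∀ t ∈ Icc 0 π, 0 ≤ a t)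
    (hx : x ∈ Ioo 0 π) (hy : y ∈ Ioo 0 π) : Continuous (S.deficit a M x y) := by
  have hsub := uIcc_subset_Ioo hx hy
  refine intervalIntegral.continuous_of_dominated_interval
    (bound := fun t => M * (S.γ t / S.ρ t))
    (fun α => (((continuous_const.sub ha).max continuous_const).measurable.mul
      S.measurable_weight).aestronglyMeasurable)
    (fun α => .of_forall fun t ht => ?_)
    ((continuousOn_const.mul (S.continuousOn_weight.mono hsub)).intervalIntegrable)
    (.of_forall fun t _ => by fun_prop)
  have ht' := Ioo_subset_Icc_self (hsub (uIoc_subset_uIcc ht))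
  have hw := S.weight_nonneg ht'
  rw [Real.norm_of_nonneg (mul_nonneg (le_max_right _ _) hw)]
  refine mul_le_mul_of_nonneg_right (max_le ?_ hM) hw
  linarith [min_le_right α M, hpos t ht']

/-- The integrands are continuous and ordered, so strictness at a single point suffices. At c the
truncation is already positive for the level α'. -/
lemma deficit_lt_deficit (ha : Continuous a) {M α α' c : ℝ} (hx : x ∈ Ioo 0 π) (hy : y ∈ Ioo 0 π)
    (hxy : x < y) (hc : c ∈ Icc x y) (hαα' : α < α') (hM : α' ≤ M) (hac : a c < α') :
    S.deficit a M x y α < S.deficit a M x y α' := by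
  have hsub : Icc x y ⊆ Ioo 0 π := fun t ht => ⟨hx.1.trans_le ht.1, ht.2.trans_lt hy.2⟩
  refine intervalIntegral.integral_lt_integral_of_continuousOn_of_le_of_exists_lt hxy
    ((S.continuousOn_deficitIntegrand ha M α).mono hsub)
    ((S.continuousOn_deficitIntegrand ha M α').mono hsub) (fun t ht => ?_) ⟨c, hc, ?_⟩
  · refine mul_le_mul_of_nonneg_right ?_
      (S.weight_nonneg (Ioo_subset_Icc_self (hsub (Ioc_subset_Icc_self ht))))
    gcongr
  · refine mul_lt_mul_of_pos_right ?_ (S.weight_pos (hsub hc))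
    rw [min_eq_left hM, min_eq_left (hαα'.le.trans hM)]
    exact lt_max_of_lt_left (max_lt (by linarith) (by linarith))

end

/-! ### The range of the primitives of `a - α` -/

section

variable {a : ℝ → ℝ} {α s t : ℝ}

lemma levelInt_nonpos (ha : Continuous a) (hs : s ∈ Ioo 0 π)
    (ht : t ∈ Ioo 0 π) (hst : s ≤ t) (h : ∀ x ∈ Ioo s t, a x < α) : S.levelInt a α s t ≤ 0 := by
  rcases hst.eq_or_lt with rfl | hlt
  · simp [levelInt]
  · exact (levelInt_neg ha hs ht hlt h).le

lemma levelInt_mem_of_peak (ha : Continuous a) (hs : s ∈ Ioo 0 π) (ht : t ∈ Ioo 0 π)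
    (h : ∀ x ∈ Ioo s t, α < a x) :
    ∀ x ∈ Ioo s t, S.levelInt a α s x ∈ Ioo 0 (S.levelInt a α s t) := by
  intro x hx
  have hx' : x ∈ Ioo 0 π := ⟨hs.1.trans hx.1, hx.2.trans ht.2⟩
  have h1 := levelInt_pos (S := S) ha hs hx' hx.1 fun z hz => h z ⟨hz.1, hz.2.trans hx.2⟩
  have h2 := levelInt_pos (S := S) ha hx' ht hx.2 fun z hz => h z ⟨hx.1.trans hz.1, hz.2⟩
  have h3 := levelInt_add (S := S) ha α hs hx' ht
  exact ⟨h1, by linarith⟩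

lemma levelInt_mem_of_valley (ha : Continuous a) (hs : s ∈ Ioo 0 π) (ht : t ∈ Ioo 0 π)
    (h : ∀ x ∈ Ioo s t, a x < α) :
    ∀ x ∈ Ioo s t, S.levelInt a α s x ∈ Ioo (S.levelInt a α s t) 0 := by
  intro x hx
  have := levelInt_mem_of_peak (S := S) (a := fun t => -a t) (α := -α) ha.neg hs ht
    (fun z hz => neg_lt_neg (h z hz)) x hx
  rw [levelInt_neg_eq, levelInt_neg_eq] at this
  exact ⟨by linarith [this.2], by linarith [this.1]⟩

/-- The primitive climbs to its value at p, which is below β, and then decreases strictly to 0 at t;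
hence it is positive before t. -/
lemma levelInt_mem_of_peak_valley (ha : Continuous a) (hs : s ∈ Ioo 0 π) (ht : t ∈ Ioo 0 π)
    {p β : ℝ} (hsp : s < p) (hpt : p < t) (h1 : ∀ x ∈ Ioo s p, α < a x)
    (h2 : ∀ x ∈ Ioo p t, a x < α) (h0 : S.levelInt a α s t = 0) (hβ : S.levelInt a α s p < β) :
    ∀ x ∈ Ioo s t, S.levelInt a α s x ∈ Ioo 0 β := by
  intro x hx
  have hp : p ∈ Ioo 0 π := ⟨hs.1.trans hsp, hpt.trans ht.2⟩
  have hx' : x ∈ Ioo 0 π := ⟨hs.1.trans hx.1, hx.2.trans ht.2⟩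
  rcases lt_or_ge x p with h | h
  · have := levelInt_mem_of_peak (S := S) ha hs hp h1 x ⟨hx.1, h⟩
    exact ⟨this.1, this.2.trans hβ⟩
  · have e1 := levelInt_add (S := S) ha α hs hp hx'
    have e2 := levelInt_add (S := S) ha α hs hx' ht
    have i1 := levelInt_nonpos (S := S) ha hp hx' h fun z hz => h2 z ⟨hz.1, hz.2.trans hx.2⟩
    have i2 := levelInt_neg (S := S) ha hx' ht hx.2 fun z hz => h2 z ⟨h.trans_lt hz.1, hz.2⟩
    exact ⟨by linarith, by linarith⟩

lemma levelInt_mem_of_valley_peak (ha : Continuous a) (hs : s ∈ Ioo 0 π) (ht : t ∈ Ioo 0 π)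
    {p β : ℝ} (hsp : s < p) (hpt : p < t) (h1 : ∀ x ∈ Ioo s p, a x < α)
    (h2 : ∀ x ∈ Ioo p t, α < a x) (h0 : S.levelInt a α s t = 0) (hβ : -β < S.levelInt a α s p) :
    ∀ x ∈ Ioo s t, S.levelInt a α s x ∈ Ioo (-β) 0 := by
  intro x hx
  have := levelInt_mem_of_peak_valley (S := S) (a := fun t => -a t) (α := -α) (β := β) ha.neg hs ht
    hsp hpt (fun z hz => neg_lt_neg (h1 z hz)) (fun z hz => neg_lt_neg (h2 z hz))
    (by rw [levelInt_neg_eq, h0, neg_zero]) (by rw [levelInt_neg_eq]; linarith) x hx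
  rw [levelInt_neg_eq] at this
  exact ⟨by linarith [this.2], by linarith [this.1]⟩

/-- The lowest point inside is q and the highest one is p. The valley takes away less than the first
peak gave, so the value at q is positive, and less than the second peak gives back, so the value at
p is below the final one. The case p = q means that there is no valley. -/
lemma levelInt_mem_of_two_peaks (ha : Continuous a) (hs : s ∈ Ioo 0 π) (ht : t ∈ Ioo 0 π)
    {p q : ℝ} (hsp : s < p) (hpq : p ≤ q) (hqt : q < t) (h1 : ∀ x ∈ Ioo s p, α < a x)
    (h2 : ∀ x ∈ Ioo p q, a x < α) (h3 : ∀ x ∈ Ioo q t, α < a x)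
    (h12 : -S.levelInt a α p q < S.levelInt a α s p)
    (h23 : -S.levelInt a α p q < S.levelInt a α q t) :
    ∀ x ∈ Ioo s t, S.levelInt a α s x ∈ Ioo 0 (S.levelInt a α s t) := by
  intro x hx
  have hp : p ∈ Ioo 0 π := ⟨hs.1.trans hsp, hpq.trans_lt (hqt.trans ht.2)⟩
  have hq : q ∈ Ioo 0 π := ⟨hp.1.trans_le hpq, hqt.trans ht.2⟩
  have hx' : x ∈ Ioo 0 π := ⟨hs.1.trans hx.1, hx.2.trans ht.2⟩
  have e1 := levelInt_add (S := S) ha α hs hp hq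
  have e2 := levelInt_add (S := S) ha α hs hq ht
  have i2 := levelInt_nonpos (S := S) ha hp hq hpq h2
  rcases lt_or_ge x p with h | h
  · have := levelInt_mem_of_peak (S := S) ha hs hp h1 x ⟨hx.1, h⟩
    exact ⟨this.1, by linarith [this.2]⟩
  rcases le_or_gt x q with h' | h'
  · have e3 := levelInt_add (S := S) ha α hs hp hx'
    have e4 := levelInt_add (S := S) ha α hp hx' hq
    have i3 := levelInt_nonpos (S := S) ha hp hx' h fun z hz => h2 z ⟨hz.1, hz.2.trans_le h'⟩
    have i4 := levelInt_nonpos (S := S) ha hx' hq h' fun z hz => h2 z ⟨h.trans_lt hz.1, hz.2⟩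
    exact ⟨by linarith, by linarith⟩
  · have e3 := levelInt_add (S := S) ha α hs hq hx'
    have := levelInt_mem_of_peak (S := S) ha hq ht h3 x ⟨h', hx.2⟩
    exact ⟨by linarith [this.1], by linarith [this.2]⟩

end

end Profile

/-! ### Position and monotonicity of the roots of a = α -/

namespace IsRoots

variable {a : ℝ → ℝ} {φ₁ φ₂ φ₃ : ℝ} {φm ψp ψm φp : ℝ → ℝ}

lemma φm_pos (R : IsRoots a φ₁ φ₂ φ₃ φm ψp ψm φp) (ha : IsDoubleBump a φ₁ φ₂ φ₃) {α : ℝ}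
    (hα : 0 < α) (hα' : α ≤ a φ₁) : 0 < φm α := by
  refine lt_of_le_of_ne (R.mem_φm α ⟨hα.le, hα'⟩).1 fun h => ?_
  have := R.apply_φm α ⟨hα.le, hα'⟩
  rw [← h, ha.zero] at this
  exact hα.ne this

lemma φm_lt (R : IsRoots a φ₁ φ₂ φ₃ φm ψp ψm φp) {α : ℝ}
    (hα : 0 ≤ α) (hα' : α < a φ₁) : φm α < φ₁ := by
  refine lt_of_le_of_ne (R.mem_φm α ⟨hα, hα'.le⟩).2 fun h => ?_
  have := R.apply_φm α ⟨hα, hα'.le⟩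
  rw [h] at this
  exact hα'.ne' this

lemma lt_ψp (R : IsRoots a φ₁ φ₂ φ₃ φm ψp ψm φp) {α : ℝ}
    (hα : a φ₂ ≤ α) (hα' : α < a φ₁) : φ₁ < ψp α := by
  refine lt_of_le_of_ne (R.mem_ψp α ⟨hα, hα'.le⟩).1 fun h => ?_
  have := R.apply_ψp α ⟨hα, hα'.le⟩
  rw [← h] at this
  exact hα'.ne' this

lemma ψp_lt (R : IsRoots a φ₁ φ₂ φ₃ φm ψp ψm φp) {α : ℝ}
    (hα : a φ₂ < α) (hα' : α ≤ a φ₁) : ψp α < φ₂ := by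
  refine lt_of_le_of_ne (R.mem_ψp α ⟨hα.le, hα'⟩).2 fun h => ?_
  have := R.apply_ψp α ⟨hα.le, hα'⟩
  rw [h] at this
  exact hα.ne this

lemma lt_ψm (R : IsRoots a φ₁ φ₂ φ₃ φm ψp ψm φp) {α : ℝ}
    (hα : a φ₂ < α) (hα' : α ≤ a φ₃) : φ₂ < ψm α := by
  refine lt_of_le_of_ne (R.mem_ψm α ⟨hα.le, hα'⟩).1 fun h => ?_
  have := R.apply_ψm α ⟨hα.le, hα'⟩
  rw [← h] at this
  exact hα.ne this

lemma ψm_lt (R : IsRoots a φ₁ φ₂ φ₃ φm ψp ψm φp) {α : ℝ}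
    (hα : a φ₂ ≤ α) (hα' : α < a φ₃) : ψm α < φ₃ := by
  refine lt_of_le_of_ne (R.mem_ψm α ⟨hα, hα'.le⟩).2 fun h => ?_
  have := R.apply_ψm α ⟨hα, hα'.le⟩
  rw [h] at this
  exact hα'.ne' this

lemma lt_φp (R : IsRoots a φ₁ φ₂ φ₃ φm ψp ψm φp) {α : ℝ}
    (hα : 0 ≤ α) (hα' : α < a φ₃) : φ₃ < φp α := by
  refine lt_of_le_of_ne (R.mem_φp α ⟨hα, hα'.le⟩).1 fun h => ?_
  have := R.apply_φp α ⟨hα, hα'.le⟩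
  rw [← h] at this
  exact hα'.ne' this

lemma φp_lt (R : IsRoots a φ₁ φ₂ φ₃ φm ψp ψm φp) (ha : IsDoubleBump a φ₁ φ₂ φ₃) {α : ℝ}
    (hα : 0 < α) (hα' : α ≤ a φ₃) : φp α < π := by
  refine lt_of_le_of_ne (R.mem_φp α ⟨hα.le, hα'⟩).2 fun h => ?_
  have := R.apply_φp α ⟨hα.le, hα'⟩
  rw [h, ha.pi] at this
  exact hα.ne this

lemma ψp_strictAnti (R : IsRoots a φ₁ φ₂ φ₃ φm ψp ψm φp) (ha : IsDoubleBump a φ₁ φ₂ φ₃)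
    {α α' : ℝ} (hα : a φ₂ ≤ α) (h : α < α') (hα' : α' ≤ a φ₁) : ψp α' < ψp α := by
  have h1 : α ∈ Icc (a φ₂) (a φ₁) := ⟨hα, h.le.trans hα'⟩
  have h2 : α' ∈ Icc (a φ₂) (a φ₁) := ⟨hα.trans h.le, hα'⟩
  rw [← ha.strictAntiOn_left.lt_iff_gt (R.mem_ψp _ h1) (R.mem_ψp _ h2), R.apply_ψp _ h1,
    R.apply_ψp _ h2]
  exact h

lemma ψm_strictMono (R : IsRoots a φ₁ φ₂ φ₃ φm ψp ψm φp) (ha : IsDoubleBump a φ₁ φ₂ φ₃)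
    {α α' : ℝ} (hα : a φ₂ ≤ α) (h : α < α') (hα' : α' ≤ a φ₃) : ψm α < ψm α' := by
  have h1 : α ∈ Icc (a φ₂) (a φ₃) := ⟨hα, h.le.trans hα'⟩
  have h2 : α' ∈ Icc (a φ₂) (a φ₃) := ⟨hα.trans h.le, hα'⟩
  rw [← ha.strictMonoOn_right.lt_iff_lt (R.mem_ψm _ h1) (R.mem_ψm _ h2), R.apply_ψm _ h1,
    R.apply_ψm _ h2]
  exact h

/-- The level sets of intermediate levels consist of four points. -/
lemma levelSet_eq (R : IsRoots a φ₁ φ₂ φ₃ φm ψp ψm φp) (ha : IsDoubleBump a φ₁ φ₂ φ₃) {α : ℝ}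
    (hα : a φ₂ < α) (hα' : α < a φ₁) :
    {φ ∈ Icc 0 π | a φ = α} = {φm α, ψp α, ψm α, φp α} := by
  obtain ⟨o1, o2, o3, o4⟩ := ha.order
  have h0 := ha.level_pos
  have h3 := ha.lower
  have m1 : α ∈ Icc 0 (a φ₁) := ⟨by linarith, by linarith⟩
  have m2 : α ∈ Icc (a φ₂) (a φ₁) := ⟨by linarith, by linarith⟩
  have m3 : α ∈ Icc (a φ₂) (a φ₃) := ⟨by linarith, by linarith⟩
  have m4 : α ∈ Icc 0 (a φ₃) := ⟨by linarith, by linarith⟩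
  have b1 := R.mem_φm α m1
  have b2 := R.mem_ψp α m2
  have b3 := R.mem_ψm α m3
  have b4 := R.mem_φp α m4
  ext x
  simp only [mem_ofPred_eq, mem_insert_iff, mem_singleton_iff]
  constructor
  · rintro ⟨hx, hxα⟩
    rcases le_total x φ₁ with h | h
    · exact Or.inl (ha.strictMonoOn_left.injOn ⟨hx.1, h⟩ b1 (by rw [hxα, R.apply_φm α m1]))
    rcases le_total x φ₂ with h' | h'
    · exact Or.inr (Or.inl (ha.strictAntiOn_left.injOn ⟨h, h'⟩ b2 (by rw [hxα, R.apply_ψp α m2])))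
    rcases le_total x φ₃ with h'' | h''
    · exact Or.inr (Or.inr (Or.inl
        (ha.strictMonoOn_right.injOn ⟨h', h''⟩ b3 (by rw [hxα, R.apply_ψm α m3]))))
    · exact Or.inr (Or.inr (Or.inr
        (ha.strictAntiOn_right.injOn ⟨h'', hx.2⟩ b4 (by rw [hxα, R.apply_φp α m4]))))
  · rintro (rfl | rfl | rfl | rfl)
    · exact ⟨⟨b1.1, by linarith [b1.2]⟩, R.apply_φm α m1⟩
    · exact ⟨⟨by linarith [b2.1], by linarith [b2.2]⟩, R.apply_ψp α m2⟩
    · exact ⟨⟨by linarith [b3.1], by linarith [b3.2]⟩, R.apply_ψm α m3⟩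
    · exact ⟨⟨by linarith [b4.1], b4.2⟩, R.apply_φp α m4⟩

end IsRoots

namespace Profile

variable {S : Profile} {a : ℝ → ℝ} {φ₁ φ₂ φ₃ : ℝ}

/-! ### The areas of the peaks and of the valley -/

/-- The two options for p serve levels above the valley, where p is a root of a = α, and levels
below it, where the truncation on (0, φ₂) is active up to φ₂. -/
lemma excess_left_eq (S : Profile) (ha : IsDoubleBump a φ₁ φ₂ φ₃) {α s p : ℝ} (hα : 0 ≤ α)
    (hs : s ∈ Icc 0 φ₁) (hsα : a s = α) (hp : p ∈ Icc φ₁ φ₂) (hpα : α ≤ a p)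
    (hp' : a p = α ∨ p = φ₂) : S.excess a 0 φ₂ α = S.levelInt a α s p := by
  refine S.excess_eq_levelInt hα hs.1 (hs.2.trans hp.1) hp.2 ?_ ?_ ?_
  · intro z hz
    rw [← hsα]
    exact ha.strictMonoOn_left.monotoneOn ⟨hz.1.le, hz.2.trans hs.2⟩ hs hz.2
  · intro z hz
    rcases hz.2.eq_or_lt with h | h
    · rwa [h]
    · exact (ha.lt_of_mem_left hs hp hsα.ge hpα z ⟨hz.1, h⟩).le
  · intro z hz
    rcases hp' with h | h
    · rw [← h]
      exact ha.strictAntiOn_left.antitoneOn hp ⟨hp.1.trans hz.1.le, hz.2⟩ hz.1.le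
    · exact absurd hz.1 (by rw [h]; exact hz.2.not_gt)

lemma excess_right_eq (S : Profile) (ha : IsDoubleBump a φ₁ φ₂ φ₃) {α q t : ℝ} (hα : 0 ≤ α)
    (ht : t ∈ Icc φ₃ π) (htα : a t = α) (hq : q ∈ Icc φ₂ φ₃) (hqα : α ≤ a q)
    (hq' : a q = α ∨ q = φ₂) : S.excess a φ₂ π α = S.levelInt a α q t := by
  refine S.excess_eq_levelInt hα hq.1 (hq.2.trans ht.1) ht.2 ?_ ?_ ?_
  · intro z hz
    rcases hq' with h | h
    · rw [← h]
      exact ha.strictMonoOn_right.monotoneOn ⟨hz.1.le, hz.2.trans hq.2⟩ hq hz.2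
    · exact absurd hz.1 (by rw [← h]; exact hz.2.not_gt)
  · intro z hz
    rcases hz.2.eq_or_lt with h | h
    · rw [h, htα]
    · exact (ha.lt_of_mem_right hq ht hqα htα.ge z ⟨hz.1, h⟩).le
  · intro z hz
    rw [← htα]
    exact ha.strictAntiOn_right.antitoneOn ht ⟨ht.1.trans hz.1.le, hz.2⟩ hz.1.le

/-- For levels not above a φ₂ the valley is empty, which is encoded by s = t = φ₂. -/
lemma deficit_valley_eq (S : Profile) (ha : IsDoubleBump a φ₁ φ₂ φ₃) {α s t : ℝ} (hα : α ≤ a φ₁)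
    (hs : s ∈ Icc φ₁ φ₂) (ht : t ∈ Icc φ₂ φ₃) (h : (a s = α ∧ a t = α) ∨
      (s = φ₂ ∧ t = φ₂ ∧ α ≤ a φ₂)) :
    S.deficit a (a φ₁) φ₁ φ₃ α = -S.levelInt a α s t := by
  have hsα : α ≤ a s := by
    rcases h with h | h
    · exact h.1.ge
    · rw [h.1]; exact h.2.2
  have htα : α ≤ a t := by
    rcases h with h | h
    · exact h.2.ge
    · rw [h.2.1]; exact h.2.2
  refine S.deficit_eq_levelInt hα hs.1 (hs.2.trans ht.1) ht.2 ?_ ?_ ?_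
  · intro z hz
    exact hsα.trans (ha.strictAntiOn_left.antitoneOn ⟨hz.1.le, hz.2.trans hs.2⟩ hs hz.2)
  · intro z hz
    rcases h with h | h
    · rcases hz.2.eq_or_lt with h' | h'
      · rw [h', h.2]
      · exact (ha.gt_of_mem_valley hs ht h.1.le h.2.le z ⟨hz.1, h'⟩).le
    · exact absurd hz.1 (by rw [h.1, ← h.2.1]; exact hz.2.not_gt)
  · intro z hz
    exact htα.trans (ha.strictMonoOn_right.monotoneOn ht ⟨ht.1.trans hz.1.le, hz.2⟩ hz.1.le)

/-- Since a ≥ 0, the function *F is nondecreasing, so its oscillation is ∫ aγ/ρ over [0, π]; at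
level 0 nothing is truncated, and the integral is split at φ₂. -/
lemma betaC_eq {H : E3 → ℝ} (ha : IsDoubleBump a φ₁ φ₂ φ₃) (hH : S.IsInducedField a H) :
    S.betaC a = S.excess a 0 φ₂ 0 + S.excess a φ₂ π 0 := by
  have hpos : ∀ t ∈ Icc 0 π, 0 ≤ a t := fun t ht => ha.nonneg ht
  have haw := continuousOn_mul_weight ha hH
  obtain ⟨o1, o2, o3, o4⟩ := ha.order
  have m0 : (0 : ℝ) ∈ Icc 0 π := ⟨le_rfl, Real.pi_pos.le⟩
  have mπ : π ∈ Icc 0 π := ⟨Real.pi_pos.le, le_rfl⟩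
  have m2 : φ₂ ∈ Icc 0 π := ⟨by linarith, by linarith⟩
  have hmono : MonotoneOn (S.starF a) (Icc 0 π) := by
    intro x hx y hy hxy
    have h1 := intervalIntegral.integral_add_adjacent_intervals
      (intervalIntegrable_mul_weight haw m0 hx) (intervalIntegrable_mul_weight haw hx hy)
    have h2 : 0 ≤ ∫ t in x..y, a t * (S.γ t / S.ρ t) :=
      intervalIntegral.integral_nonneg hxy fun t ht =>
        mul_nonneg (hpos t ⟨hx.1.trans ht.1, ht.2.trans hy.2⟩)
          (S.weight_nonneg ⟨hx.1.trans ht.1, ht.2.trans hy.2⟩)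
    simp only [starF]
    linarith
  have hmax : IsGreatest (S.starF a '' Icc 0 π) (S.starF a π) :=
    ⟨mem_image_of_mem _ mπ, by rintro _ ⟨x, hx, rfl⟩; exact hmono hx mπ hx.2⟩
  have hmin : IsLeast (S.starF a '' Icc 0 π) (S.starF a 0) :=
    ⟨mem_image_of_mem _ m0, by rintro _ ⟨x, hx, rfl⟩; exact hmono m0 hx hx.1⟩
  rw [betaC, hmax.csSup_eq, hmin.csInf_eq, excess_zero_level hpos m0 m2,
    excess_zero_level hpos m2 mπ,
    intervalIntegral.integral_add_adjacent_intervals (intervalIntegrable_mul_weight haw m0 m2)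
      (intervalIntegrable_mul_weight haw m2 mπ)]
  simp [starF]

end Profile

namespace Profile

variable {S : Profile} {a : ℝ → ℝ} {φ₁ φ₂ φ₃ : ℝ} {φm ψp ψm φp : ℝ → ℝ} {H : E3 → ℝ}

lemma excess_left_eq_roots (S : Profile) (ha : IsDoubleBump a φ₁ φ₂ φ₃)
    (R : IsRoots a φ₁ φ₂ φ₃ φm ψp ψm φp) {α : ℝ} (h : α ∈ Icc (a φ₂) (a φ₁)) :
    S.excess a 0 φ₂ α = S.levelInt a α (φm α) (ψp α) := by
  have h0 := ha.level_pos.le.trans h.1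
  exact S.excess_left_eq ha h0 (R.mem_φm α ⟨h0, h.2⟩) (R.apply_φm α ⟨h0, h.2⟩) (R.mem_ψp α h)
    (R.apply_ψp α h).ge (Or.inl (R.apply_ψp α h))

lemma excess_right_eq_roots (S : Profile) (ha : IsDoubleBump a φ₁ φ₂ φ₃)
    (R : IsRoots a φ₁ φ₂ φ₃ φm ψp ψm φp) {α : ℝ} (h : α ∈ Icc (a φ₂) (a φ₃)) :
    S.excess a φ₂ π α = S.levelInt a α (ψm α) (φp α) := by
  have h0 := ha.level_pos.le.trans h.1
  exact S.excess_right_eq ha h0 (R.mem_φp α ⟨h0, h.2⟩) (R.apply_φp α ⟨h0, h.2⟩) (R.mem_ψm α h)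
    (R.apply_ψm α h).ge (Or.inl (R.apply_ψm α h))

lemma deficit_eq_roots (S : Profile) (ha : IsDoubleBump a φ₁ φ₂ φ₃)
    (R : IsRoots a φ₁ φ₂ φ₃ φm ψp ψm φp) {α : ℝ} (h : α ∈ Icc (a φ₂) (a φ₁)) :
    S.deficit a (a φ₁) φ₁ φ₃ α = -S.levelInt a α (ψp α) (ψm α) := by
  have h' : α ∈ Icc (a φ₂) (a φ₃) := ⟨h.1, h.2.trans ha.lower.le⟩
  exact S.deficit_valley_eq ha h.2 (R.mem_ψp α h) (R.mem_ψm α h')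
    (Or.inl ⟨R.apply_ψp α h, R.apply_ψm α h'⟩)

/-! ### The solutions in the three regimes -/

/-- A single level for the whole ascent: the primitive from φ₋ to φ₊ gains M + P - D = β, and D < M,
D < P keep it strictly between the obstacles. The level may also lie below the bottom of the valley.
-/
lemma exists_solution_one (ha : IsDoubleBump a φ₁ φ₂ φ₃) (R : IsRoots a φ₁ φ₂ φ₃ φm ψp ψm φp)
    (hH : S.IsInducedField a H) {α β : ℝ} (hα0 : 0 < α) (hα : α < a φ₁) (hβ : 0 < β)
    (h1 : S.deficit a (a φ₁) φ₁ φ₃ α < S.excess a 0 φ₂ α)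
    (h2 : S.deficit a (a φ₁) φ₁ φ₃ α < S.excess a φ₂ π α)
    (hαβ : S.excess a 0 φ₂ α + S.excess a φ₂ π α - S.deficit a (a φ₁) φ₁ φ₃ α = β) :
    ∃ V, S.IsTheSolution H β V ∧ S.SC β V = S.band (φm α) (φp α) := by
  obtain ⟨o1, o2, o3, o4⟩ := ha.order
  have hc := ha.continuous
  have h3 : α < a φ₃ := hα.trans ha.lower
  have m1 := R.mem_φm α ⟨hα0.le, hα.le⟩
  have e1 := R.apply_φm α ⟨hα0.le, hα.le⟩
  have m4 := R.mem_φp α ⟨hα0.le, h3.le⟩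
  have e4 := R.apply_φp α ⟨hα0.le, h3.le⟩
  have hs0 := R.φm_pos ha hα0 hα.le
  have hs1 := R.φm_lt hα0.le hα
  have ht0 := R.lt_φp hα0.le h3
  have ht1 := R.φp_lt ha hα0 h3.le
  have hs : φm α ∈ Ioo 0 π := ⟨hs0, by linarith⟩
  have ht : φp α ∈ Ioo 0 π := ⟨by linarith, ht1⟩
  -- the two points between the peaks and the valley
  obtain ⟨p, q, hp, hq, hpα, hqα, hpq⟩ : ∃ p q, p ∈ Icc φ₁ φ₂ ∧ q ∈ Icc φ₂ φ₃ ∧ α ≤ a p ∧ α ≤ a q ∧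
      ((a p = α ∧ a q = α) ∨ (p = φ₂ ∧ q = φ₂ ∧ α ≤ a φ₂)) := by
    rcases le_total α (a φ₂) with h | h
    · exact ⟨φ₂, φ₂, right_mem_Icc.2 o2.le, left_mem_Icc.2 o3.le, h, h, Or.inr ⟨rfl, rfl, h⟩⟩
    · have e2 := R.apply_ψp α ⟨h, hα.le⟩
      have e3 := R.apply_ψm α ⟨h, h3.le⟩
      exact ⟨ψp α, ψm α, R.mem_ψp α ⟨h, hα.le⟩, R.mem_ψm α ⟨h, h3.le⟩, e2.ge, e3.ge,
        Or.inl ⟨e2, e3⟩⟩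
  have i1 : S.excess a 0 φ₂ α = S.levelInt a α (φm α) p :=
    S.excess_left_eq ha hα0.le m1 e1 hp hpα (hpq.imp (fun h => h.1) fun h => h.1)
  have i2 : S.excess a φ₂ π α = S.levelInt a α q (φp α) :=
    S.excess_right_eq ha hα0.le m4 e4 hq hqα (hpq.imp (fun h => h.2) fun h => h.2.1)
  have i3 := S.deficit_valley_eq ha hα.le hp hq hpq
  have hpI : p ∈ Ioo 0 π := ⟨by linarith [hp.1], by linarith [hp.2]⟩
  have hqI : q ∈ Ioo 0 π := ⟨by linarith [hq.1], by linarith [hq.2]⟩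
  have htot : S.levelInt a α (φm α) (φp α) = β := by
    rw [← levelInt_add hc α hs hqI ht, ← levelInt_add hc α hs hpI hqI]
    linarith
  have hval : ∀ x ∈ Ioo p q, a x < α := by
    rcases hpq with h | h
    · exact ha.gt_of_mem_valley hp hq h.1.le h.2.le
    · rw [h.1, h.2.1]
      intro x hx
      exact absurd hx.1 hx.2.not_gt
  have hr := isRamp_bump (S := S) (l := 0) (h := β) hc hs ht (by linarith) e1 e4 (by
    rw [← htot]
    exact levelInt_mem_of_two_peaks hc hs ht (by linarith [hp.1]) (hp.2.trans hq.1)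
      (by linarith [hq.2]) (ha.lt_of_mem_left m1 hp e1.ge hpα) hval
      (ha.lt_of_mem_right hq m4 hqα e4.ge) (by rw [← i3, ← i1]; exact h1)
      (by rw [← i3, ← i2]; exact h2))
  rw [htot] at hr
  exact solves_one (δ := φm α / 2) hβ ha.contDiff hH (by linarith) (by linarith) (by linarith) ht1
    (isFree_bump ha.contDiff hs ht (by linarith) e1 e4) hr
    (fun x hx => ha.incr₁ x ⟨hx.1, by linarith [hx.2]⟩)
    (fun x hx => deriv_nonneg_of_pos_Ioo ha.contDiff o1 ha.incr₁ x ⟨hx.1, hx.2.trans m1.2⟩)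
    (fun x hx => deriv_nonpos_of_neg_Ioo ha.contDiff o4 ha.decr₂ x ⟨m4.1.trans hx.1, hx.2⟩)

/-- At level α₀ the left peak and the valley cancel: the solution leaves the lower obstacle, rises
by M(α₀) < β and returns to it. The ascent takes place over the right peak, at the level where its
area is β. -/
lemma exists_solution_two (ha : IsDoubleBump a φ₁ φ₂ φ₃) (R : IsRoots a φ₁ φ₂ φ₃ φm ψp ψm φp)
    (hH : S.IsInducedField a H) {α₀ α β : ℝ} (h₀ : α₀ ∈ Ioo (a φ₂) (a φ₁)) (hα : α₀ ≤ α)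
    (hα' : α < a φ₃) (hβ : 0 < β)
    (h1 : S.deficit a (a φ₁) φ₁ φ₃ α₀ = S.excess a 0 φ₂ α₀)
    (h2 : S.excess a 0 φ₂ α₀ < β) (h3 : S.excess a φ₂ π α = β) :
    ∃ V, S.IsTheSolution H β V ∧
      S.SC β V = S.band (φm α₀) (ψm α₀) ∪ S.band (ψm α) (φp α) := by
  obtain ⟨o1, o2, o3, o4⟩ := ha.order
  have hc := ha.continuous
  have hp := ha.level_pos
  have hl := ha.lower
  obtain ⟨h₀1, h₀2⟩ := h₀
  have k1 : α₀ ∈ Icc 0 (a φ₁) := ⟨by linarith, by linarith⟩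
  have k2 : α₀ ∈ Icc (a φ₂) (a φ₁) := ⟨by linarith, by linarith⟩
  have k3 : α₀ ∈ Icc (a φ₂) (a φ₃) := ⟨by linarith, by linarith⟩
  have k4 : α ∈ Icc (a φ₂) (a φ₃) := ⟨by linarith, by linarith⟩
  have k5 : α ∈ Icc 0 (a φ₃) := ⟨by linarith, by linarith⟩
  have m1 := R.mem_φm _ k1
  have m2 := R.mem_ψp _ k2
  have m3 := R.mem_ψm _ k3
  have m4 := R.mem_ψm _ k4
  have m5 := R.mem_φp _ k5
  have e1 := R.apply_φm _ k1
  have e2 := R.apply_ψp _ k2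
  have e3 := R.apply_ψm _ k3
  have e4 := R.apply_ψm _ k4
  have e5 := R.apply_φp _ k5
  have b1 := R.φm_pos ha (by linarith : 0 < α₀) k1.2
  have b2 := R.φm_lt k1.1 h₀2
  have b3 := R.lt_ψp k2.1 h₀2
  have b4 := R.ψp_lt h₀1 h₀2.le
  have b5 := R.lt_ψm h₀1 k3.2
  have b6 := R.ψm_lt k4.1 hα'
  have b7 := R.lt_φp k5.1 hα'
  have b8 := R.φp_lt ha (by linarith : 0 < α) hα'.le
  have b9 : ψm α₀ ≤ ψm α := by
    rcases hα.eq_or_lt with rfl | h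
    · exact le_rfl
    · exact (R.ψm_strictMono ha k3.1 h k4.2).le
  have i1 := S.excess_left_eq_roots ha R k2
  have i2 := S.deficit_eq_roots ha R k2
  have i3 := S.excess_right_eq_roots ha R k4
  have hs : φm α₀ ∈ Ioo 0 π := ⟨b1, by linarith⟩
  have hm : ψp α₀ ∈ Ioo 0 π := ⟨by linarith, by linarith⟩
  have ht : ψm α₀ ∈ Ioo 0 π := ⟨by linarith, by linarith⟩
  have hs' : ψm α ∈ Ioo 0 π := ⟨by linarith, by linarith⟩
  have ht' : φp α ∈ Ioo 0 π := ⟨by linarith, b8⟩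
  have htot : S.levelInt a α₀ (φm α₀) (ψm α₀) = 0 := by
    rw [← levelInt_add hc α₀ hs hm ht]
    linarith
  have hr := isRamp_bump (S := S) (l := 0) (h := β) hc hs ht (by linarith) e1 e3
    (levelInt_mem_of_peak_valley hc hs ht (p := ψp α₀) (by linarith) (by linarith)
      (ha.lt_of_mem_left m1 m2 e1.ge e2.ge) (ha.gt_of_mem_valley m2 m3 e2.le e3.le) htot
      (by linarith))
  have hr' := isRamp_bump (S := S) hc hs' ht' (by linarith) e4 e5
    (levelInt_mem_of_peak hc hs' ht' (ha.lt_of_mem_right m4 m5 e4.ge e5.ge))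
  rw [htot] at hr
  rw [← i3, h3] at hr'
  exact solves_two (δ := φm α₀ / 2) hβ ha.contDiff hH (by linarith) (by linarith) (by linarith) b9
    (by linarith) b8 (isFree_bump ha.contDiff hs ht (by linarith) e1 e3)
    (isFree_bump ha.contDiff hs' ht' (by linarith) e4 e5) hr hr'
    (fun x hx => ha.incr₁ x ⟨hx.1, by linarith [hx.2]⟩)
    (fun x hx => deriv_nonneg_of_pos_Ioo ha.contDiff o1 ha.incr₁ x ⟨hx.1, hx.2.trans m1.2⟩)
    (fun x hx => deriv_nonneg_of_pos_Ioo ha.contDiff o3 ha.incr₂ x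
      ⟨m3.1.trans hx.1, hx.2.trans m4.2⟩)
    (fun x hx => deriv_nonpos_of_neg_Ioo ha.contDiff o4 ha.decr₂ x ⟨m5.1.trans hx.1, hx.2⟩)

/-- Here the valley cancels the right peak: after an ascent over the left peak, the solution leaves
the upper obstacle, drops by P(α₀) < β and returns to it. -/
lemma exists_solution_two' (ha : IsDoubleBump a φ₁ φ₂ φ₃) (R : IsRoots a φ₁ φ₂ φ₃ φm ψp ψm φp)
    (hH : S.IsInducedField a H) {α₀ α β : ℝ} (h₀ : α₀ ∈ Ioo (a φ₂) (a φ₁)) (hα : α₀ ≤ α)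
    (hα' : α < a φ₁) (hβ : 0 < β)
    (h1 : S.deficit a (a φ₁) φ₁ φ₃ α₀ = S.excess a φ₂ π α₀)
    (h2 : S.excess a φ₂ π α₀ < β) (h3 : S.excess a 0 φ₂ α = β) :
    ∃ V, S.IsTheSolution H β V ∧
      S.SC β V = S.band (φm α) (ψp α) ∪ S.band (ψp α₀) (φp α₀) := by
  obtain ⟨o1, o2, o3, o4⟩ := ha.order
  have hc := ha.continuous
  have hp := ha.level_pos
  have hl := ha.lower
  obtain ⟨h₀1, h₀2⟩ := h₀
  have k1 : α ∈ Icc 0 (a φ₁) := ⟨by linarith, by linarith⟩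
  have k2 : α ∈ Icc (a φ₂) (a φ₁) := ⟨by linarith, by linarith⟩
  have k3 : α₀ ∈ Icc (a φ₂) (a φ₁) := ⟨by linarith, by linarith⟩
  have k4 : α₀ ∈ Icc (a φ₂) (a φ₃) := ⟨by linarith, by linarith⟩
  have k5 : α₀ ∈ Icc 0 (a φ₃) := ⟨by linarith, by linarith⟩
  have m1 := R.mem_φm _ k1
  have m2 := R.mem_ψp _ k2
  have m3 := R.mem_ψp _ k3
  have m4 := R.mem_ψm _ k4
  have m5 := R.mem_φp _ k5
  have e1 := R.apply_φm _ k1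
  have e2 := R.apply_ψp _ k2
  have e3 := R.apply_ψp _ k3
  have e4 := R.apply_ψm _ k4
  have e5 := R.apply_φp _ k5
  have b1 := R.φm_pos ha (by linarith : 0 < α) k1.2
  have b2 := R.φm_lt k1.1 hα'
  have b3 := R.lt_ψp k2.1 hα'
  have b4 := R.ψp_lt h₀1 h₀2.le
  have b5 := R.lt_ψm h₀1 k4.2
  have b6 := R.ψm_lt k4.1 (h₀2.trans hl)
  have b7 := R.lt_φp k5.1 (h₀2.trans hl)
  have b8 := R.φp_lt ha (by linarith : 0 < α₀) k5.2
  have b9 : ψp α ≤ ψp α₀ := by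
    rcases hα.eq_or_lt with rfl | h
    · exact le_rfl
    · exact (R.ψp_strictAnti ha k3.1 h k2.2).le
  have i1 := S.excess_left_eq_roots ha R k2
  have i2 := S.deficit_eq_roots ha R k3
  have i3 := S.excess_right_eq_roots ha R k4
  have hs : φm α ∈ Ioo 0 π := ⟨b1, by linarith⟩
  have ht : ψp α ∈ Ioo 0 π := ⟨by linarith, by linarith⟩
  have hs' : ψp α₀ ∈ Ioo 0 π := ⟨by linarith, by linarith⟩
  have hm : ψm α₀ ∈ Ioo 0 π := ⟨by linarith, by linarith⟩
  have ht' : φp α₀ ∈ Ioo 0 π := ⟨by linarith, b8⟩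
  have htot : S.levelInt a α₀ (ψp α₀) (φp α₀) = 0 := by
    rw [← levelInt_add hc α₀ hs' hm ht']
    linarith
  have hr := isRamp_bump (S := S) hc hs ht (by linarith) e1 e2
    (levelInt_mem_of_peak hc hs ht (ha.lt_of_mem_left m1 m2 e1.ge e2.ge))
  have hr' := isRamp_bump (S := S) (l := -β) (h := 0) hc hs' ht' (by linarith) e3 e5
    (levelInt_mem_of_valley_peak hc hs' ht' (p := ψm α₀) (by linarith) (by linarith)
      (ha.gt_of_mem_valley m3 m4 e3.le e4.le) (ha.lt_of_mem_right m4 m5 e4.ge e5.ge) htot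
      (by linarith))
  rw [htot] at hr'
  rw [← i1, h3] at hr
  exact solves_two' (δ := φm α / 2) hβ ha.contDiff hH (by linarith) (by linarith) (by linarith) b9
    (by linarith) b8 (isFree_bump ha.contDiff hs ht (by linarith) e1 e2)
    (isFree_bump ha.contDiff hs' ht' (by linarith) e3 e5) hr hr'
    (fun x hx => ha.incr₁ x ⟨hx.1, by linarith [hx.2]⟩)
    (fun x hx => deriv_nonneg_of_pos_Ioo ha.contDiff o1 ha.incr₁ x ⟨hx.1, hx.2.trans m1.2⟩)
    (fun x hx => deriv_nonpos_of_neg_Ioo ha.contDiff o2 ha.decr₁ x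
      ⟨m2.1.trans hx.1, hx.2.trans m3.2⟩)
    (fun x hx => deriv_nonpos_of_neg_Ioo ha.contDiff o4 ha.decr₂ x ⟨m5.1.trans hx.1, hx.2⟩)

/-- Each crossing has its own level. The valley is crossed at the lowest of the three, and as ψ₊
decreases and ψ₋ increases with the level, the free intervals come out in order. -/
lemma exists_solution_three (ha : IsDoubleBump a φ₁ φ₂ φ₃) (R : IsRoots a φ₁ φ₂ φ₃ φm ψp ψm φp)
    (hH : S.IsInducedField a H) {α₁ α₂ α₃ β : ℝ} (hα₂ : a φ₂ < α₂) (h21 : α₂ ≤ α₁)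
    (hα₁ : α₁ < a φ₁) (h23 : α₂ ≤ α₃) (hα₃ : α₃ < a φ₃) (hβ : 0 < β)
    (h1 : S.excess a 0 φ₂ α₁ = β) (h2 : S.deficit a (a φ₁) φ₁ φ₃ α₂ = β)
    (h3 : S.excess a φ₂ π α₃ = β) :
    ∃ V, S.IsTheSolution H β V ∧ S.SC β V =
      S.band (φm α₁) (ψp α₁) ∪ S.band (ψp α₂) (ψm α₂) ∪ S.band (ψm α₃) (φp α₃) := by
  obtain ⟨o1, o2, o3, o4⟩ := ha.order
  have hc := ha.continuous
  have hp := ha.level_pos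
  have hl := ha.lower
  have k1 : α₁ ∈ Icc 0 (a φ₁) := ⟨by linarith, by linarith⟩
  have k2 : α₁ ∈ Icc (a φ₂) (a φ₁) := ⟨by linarith, by linarith⟩
  have k3 : α₂ ∈ Icc (a φ₂) (a φ₁) := ⟨by linarith, by linarith⟩
  have k4 : α₂ ∈ Icc (a φ₂) (a φ₃) := ⟨by linarith, by linarith⟩
  have k5 : α₃ ∈ Icc (a φ₂) (a φ₃) := ⟨by linarith, by linarith⟩
  have k6 : α₃ ∈ Icc 0 (a φ₃) := ⟨by linarith, by linarith⟩
  have m1 := R.mem_φm _ k1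
  have m2 := R.mem_ψp _ k2
  have m3 := R.mem_ψp _ k3
  have m4 := R.mem_ψm _ k4
  have m5 := R.mem_ψm _ k5
  have m6 := R.mem_φp _ k6
  have e1 := R.apply_φm _ k1
  have e2 := R.apply_ψp _ k2
  have e3 := R.apply_ψp _ k3
  have e4 := R.apply_ψm _ k4
  have e5 := R.apply_ψm _ k5
  have e6 := R.apply_φp _ k6
  have b1 := R.φm_pos ha (by linarith : 0 < α₁) k1.2
  have b2 := R.φm_lt k1.1 hα₁
  have b3 := R.lt_ψp k2.1 hα₁
  have b4 := R.ψp_lt hα₂ k3.2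
  have b5 := R.lt_ψm hα₂ k4.2
  have b6 := R.ψm_lt k5.1 hα₃
  have b7 := R.lt_φp k6.1 hα₃
  have b8 := R.φp_lt ha (by linarith : 0 < α₃) k6.2
  have b9 : ψp α₁ ≤ ψp α₂ := by
    rcases h21.eq_or_lt with rfl | h
    · exact le_rfl
    · exact (R.ψp_strictAnti ha k3.1 h k2.2).le
  have b10 : ψm α₂ ≤ ψm α₃ := by
    rcases h23.eq_or_lt with rfl | h
    · exact le_rfl
    · exact (R.ψm_strictMono ha k4.1 h k5.2).le
  have i1 := S.excess_left_eq_roots ha R k2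
  have i2 := S.deficit_eq_roots ha R k3
  have i3 := S.excess_right_eq_roots ha R k5
  have hs₁ : φm α₁ ∈ Ioo 0 π := ⟨b1, by linarith⟩
  have ht₁ : ψp α₁ ∈ Ioo 0 π := ⟨by linarith, by linarith⟩
  have hs₂ : ψp α₂ ∈ Ioo 0 π := ⟨by linarith, by linarith⟩
  have ht₂ : ψm α₂ ∈ Ioo 0 π := ⟨by linarith, by linarith⟩
  have hs₃ : ψm α₃ ∈ Ioo 0 π := ⟨by linarith, by linarith⟩
  have ht₃ : φp α₃ ∈ Ioo 0 π := ⟨by linarith, b8⟩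
  have i2' : S.levelInt a α₂ (ψp α₂) (ψm α₂) = -β := by linarith
  have hr₁ := isRamp_bump (S := S) hc hs₁ ht₁ (by linarith) e1 e2
    (levelInt_mem_of_peak hc hs₁ ht₁ (ha.lt_of_mem_left m1 m2 e1.ge e2.ge))
  have hr₂ := isRamp_bump (S := S) hc hs₂ ht₂ (by linarith) e3 e4
    (levelInt_mem_of_valley hc hs₂ ht₂ (ha.gt_of_mem_valley m3 m4 e3.le e4.le))
  have hr₃ := isRamp_bump (S := S) hc hs₃ ht₃ (by linarith) e5 e6
    (levelInt_mem_of_peak hc hs₃ ht₃ (ha.lt_of_mem_right m5 m6 e5.ge e6.ge))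
  rw [← i1, h1] at hr₁
  rw [i2'] at hr₂
  rw [← i3, h3] at hr₃
  exact solves_three (δ := φm α₁ / 2) hβ ha.contDiff hH (by linarith) (by linarith)
    (by linarith) b9 (by linarith) b10 (by linarith) b8
    (isFree_bump ha.contDiff hs₁ ht₁ (by linarith) e1 e2)
    (isFree_bump ha.contDiff hs₂ ht₂ (by linarith) e3 e4)
    (isFree_bump ha.contDiff hs₃ ht₃ (by linarith) e5 e6) hr₁ hr₂ hr₃
    (fun x hx => ha.incr₁ x ⟨hx.1, by linarith [hx.2]⟩)
    (fun x hx => deriv_nonneg_of_pos_Ioo ha.contDiff o1 ha.incr₁ x ⟨hx.1, hx.2.trans m1.2⟩)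
    (fun x hx => deriv_nonpos_of_neg_Ioo ha.contDiff o2 ha.decr₁ x
      ⟨m2.1.trans hx.1, hx.2.trans m3.2⟩)
    (fun x hx => deriv_nonneg_of_pos_Ioo ha.contDiff o3 ha.incr₂ x
      ⟨m4.1.trans hx.1, hx.2.trans m5.2⟩)
    (fun x hx => deriv_nonpos_of_neg_Ioo ha.contDiff o4 ha.decr₂ x ⟨m6.1.trans hx.1, hx.2⟩)

end Profile

namespace Profile

variable {S : Profile} {a : ℝ → ℝ} {φ₁ φ₂ φ₃ : ℝ} {φm ψp ψm φp : ℝ → ℝ} {H : E3 → ℝ}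

/-! ### The critical level and the thresholds -/

lemma excess_left_pos (S : Profile) (ha : IsDoubleBump a φ₁ φ₂ φ₃) {α : ℝ}
    (h : α ∈ Ico (a φ₂) (a φ₁)) : 0 < S.excess a 0 φ₂ α := by
  obtain ⟨φm, ψp, ψm, φp, R⟩ := ha.exists_isRoots
  obtain ⟨o1, o2, o3, o4⟩ := ha.order
  have h0 := ha.level_pos.trans_le h.1
  have h' : α ∈ Icc (a φ₂) (a φ₁) := ⟨h.1, h.2.le⟩
  have m1 := R.mem_φm α ⟨h0.le, h.2.le⟩
  have m2 := R.mem_ψp α h'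
  have b1 := R.φm_pos ha h0 h.2.le
  have b2 := R.φm_lt h0.le h.2
  rw [S.excess_left_eq_roots ha R h']
  exact levelInt_pos ha.continuous ⟨b1, by linarith⟩ ⟨by linarith [m2.1], by linarith [m2.2]⟩
    (by linarith [m2.1]) (ha.lt_of_mem_left m1 m2 (R.apply_φm α ⟨h0.le, h.2.le⟩).ge
      (R.apply_ψp α h').ge)

lemma excess_right_pos (S : Profile) (ha : IsDoubleBump a φ₁ φ₂ φ₃) {α : ℝ}
    (h : α ∈ Ico (a φ₂) (a φ₃)) : 0 < S.excess a φ₂ π α := by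
  obtain ⟨φm, ψp, ψm, φp, R⟩ := ha.exists_isRoots
  obtain ⟨o1, o2, o3, o4⟩ := ha.order
  have h0 := ha.level_pos.trans_le h.1
  have h' : α ∈ Icc (a φ₂) (a φ₃) := ⟨h.1, h.2.le⟩
  have m1 := R.mem_ψm α h'
  have m2 := R.mem_φp α ⟨h0.le, h.2.le⟩
  have b1 := R.lt_φp h0.le h.2
  have b2 := R.φp_lt ha h0 h.2.le
  rw [S.excess_right_eq_roots ha R h']
  exact levelInt_pos ha.continuous ⟨by linarith [m1.1], by linarith [m1.2]⟩
    ⟨by linarith, b2⟩ (by linarith [m1.2]) (ha.lt_of_mem_right m1 m2 (R.apply_ψm α h').ge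
      (R.apply_φp α ⟨h0.le, h.2.le⟩).ge)

lemma excess_left_top (S : Profile) (ha : IsDoubleBump a φ₁ φ₂ φ₃) :
    S.excess a 0 φ₂ (a φ₁) = 0 := by
  obtain ⟨o1, o2, o3, o4⟩ := ha.order
  rw [S.excess_left_eq ha (ha.level_pos.trans ha.level_lt_left).le (right_mem_Icc.2 o1.le) rfl
    (left_mem_Icc.2 o2.le) le_rfl (Or.inl rfl), levelInt, intervalIntegral.integral_same]

lemma excess_right_top (S : Profile) (ha : IsDoubleBump a φ₁ φ₂ φ₃) :
    S.excess a φ₂ π (a φ₃) = 0 := by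
  obtain ⟨o1, o2, o3, o4⟩ := ha.order
  rw [S.excess_right_eq ha ((ha.level_pos.trans ha.level_lt_left).trans ha.lower).le
    (left_mem_Icc.2 o4.le) rfl (right_mem_Icc.2 o3.le) le_rfl (Or.inl rfl), levelInt,
    intervalIntegral.integral_same]

lemma deficit_bottom (S : Profile) (ha : IsDoubleBump a φ₁ φ₂ φ₃) {α : ℝ} (hα : α ≤ a φ₂) :
    S.deficit a (a φ₁) φ₁ φ₃ α = 0 := by
  obtain ⟨o1, o2, o3, o4⟩ := ha.order
  rw [S.deficit_valley_eq ha (hα.trans ha.level_lt_left.le) (right_mem_Icc.2 o2.le)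
    (left_mem_Icc.2 o3.le) (Or.inr ⟨rfl, rfl, hα⟩), levelInt, intervalIntegral.integral_same,
    neg_zero]

lemma deficit_strictMono (S : Profile) (ha : IsDoubleBump a φ₁ φ₂ φ₃) {α α' : ℝ}
    (h2 : a φ₂ < α') (h : α < α') (h1 : α' ≤ a φ₁) :
    S.deficit a (a φ₁) φ₁ φ₃ α < S.deficit a (a φ₁) φ₁ φ₃ α' := by
  obtain ⟨o1, o2, o3, o4⟩ := ha.order
  exact deficit_lt_deficit ha.continuous ⟨o1, by linarith⟩ ⟨by linarith, o4⟩ (by linarith)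
    (c := φ₂) ⟨o2.le, o3.le⟩ h h1 h2

/-- The intermediate value theorem for D - min(M, P): at a φ₂ the valley is empty while both peaks
are not, and at a φ₁ the left peak has shrunk to nothing while the valley is positive. -/
lemma exists_critical_level (ha : IsDoubleBump a φ₁ φ₂ φ₃)
    (hM : Continuous (S.excess a 0 φ₂)) (hP : Continuous (S.excess a φ₂ π))
    (hD : Continuous (S.deficit a (a φ₁) φ₁ φ₃)) :
    ∃ αs ∈ Ioo (a φ₂) (a φ₁), S.deficit a (a φ₁) φ₁ φ₃ αs =
      min (S.excess a 0 φ₂ αs) (S.excess a φ₂ π αs) := by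
  have hl := ha.level_lt_left
  have hc : Continuous fun α => S.deficit a (a φ₁) φ₁ φ₃ α -
      min (S.excess a 0 φ₂ α) (S.excess a φ₂ π α) := hD.sub (hM.min hP)
  have hiv := intermediate_value_Ioo hl.le (hc.continuousOn (s := Icc (a φ₂) (a φ₁)))
  have h1 : S.deficit a (a φ₁) φ₁ φ₃ (a φ₂) -
      min (S.excess a 0 φ₂ (a φ₂)) (S.excess a φ₂ π (a φ₂)) < 0 := by
    rw [S.deficit_bottom ha le_rfl, zero_sub, neg_neg_iff_pos]
    exact lt_min (S.excess_left_pos ha ⟨le_rfl, hl⟩)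
      (S.excess_right_pos ha ⟨le_rfl, hl.trans ha.lower⟩)
  have h2 : 0 < S.deficit a (a φ₁) φ₁ φ₃ (a φ₁) -
      min (S.excess a 0 φ₂ (a φ₁)) (S.excess a φ₂ π (a φ₁)) := by
    have h3 := S.deficit_strictMono ha hl hl le_rfl
    rw [S.deficit_bottom ha le_rfl] at h3
    have h4 := min_le_left (S.excess a 0 φ₂ (a φ₁)) (S.excess a φ₂ π (a φ₁))
    rw [S.excess_left_top ha] at h4 ⊢
    linarith
  obtain ⟨αs, hαs, h⟩ := hiv ⟨h1, h2⟩
  exact ⟨αs, hαs, sub_eq_zero.1 h⟩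

end Profile

end Shell

/-! ### The three regimes -/

theorem proposition4p2 (S : Shell.Profile) (a : ℝ → ℝ) (φ₁ φ₂ φ₃ : ℝ)
    (ha : Shell.IsDoubleBump a φ₁ φ₂ φ₃) (H : Shell.E3 → ℝ) (hH : S.IsInducedField a H) :
    -- the four points of the level sets `{a = α}`, for `α` between `a φ₂` and `a φ₁`
    ∃ φm ψp ψm φp : ℝ → ℝ,
      (∀ α ∈ Set.Ioo (a φ₂) (a φ₁),
        φm α < ψp α ∧ ψp α < ψm α ∧ ψm α < φp α ∧
        {φ ∈ Set.Icc 0 Real.pi | a φ = α} = {φm α, ψp α, ψm α, φp α}) ∧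
    ∃ Im Ip J : ℝ → ℝ,
      (∀ α, Im α = S.levelInt a α (φm α) (ψp α)) ∧
      (∀ α, Ip α = S.levelInt a α (ψm α) (φp α)) ∧
      (∀ α, J α = -S.levelInt a α (ψp α) (ψm α)) ∧
    -- the critical level
    ∃ αs ∈ Set.Ioo (a φ₂) (a φ₁),
      (∀ α ∈ Set.Ioo (a φ₂) αs, J α < min (Im α) (Ip α)) ∧
      (∀ α ∈ Set.Ioo αs (a φ₁), min (Im α) (Ip α) < J α) ∧
    -- the thresholds
    ∃ β₁ β₂ : ℝ, β₁ = max (Im αs) (Ip αs) ∧ β₂ = min (Im αs) (Ip αs) ∧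
      0 < β₂ ∧ β₂ ≤ β₁ ∧ β₁ < S.betaC a ∧
    -- the solutions of the obstacle problems
    ∃ V : ℝ → Shell.E3 → ℝ,
      (∀ β ∈ Set.Ioo 0 (S.betaC a), S.IsTheSolution H β (V β)) ∧
    -- the three regimes
      (∀ β ∈ Set.Ioo β₁ (S.betaC a), ∃ s t : ℝ, 0 < s ∧ s < t ∧ t < Real.pi ∧
        S.SC β (V β) = S.band s t) ∧
      (∃ s₀ t₀ : ℝ, 0 < s₀ ∧ s₀ < t₀ ∧ t₀ < Real.pi ∧
        ∀ β ∈ Set.Ioo β₂ β₁, ∃ s t : ℝ, 0 < s ∧ s < t ∧ t < Real.pi ∧ (t₀ < s ∨ t < s₀) ∧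
          S.SC β (V β) = S.band s₀ t₀ ∪ S.band s t) ∧
      (∀ β ∈ Set.Ioo 0 β₂, ∃ s₁ t₁ s₂ t₂ s₃ t₃ : ℝ,
        0 < s₁ ∧ s₁ < t₁ ∧ t₁ < s₂ ∧ s₂ < t₂ ∧ t₂ < s₃ ∧ s₃ < t₃ ∧ t₃ < Real.pi ∧
        S.SC β (V β) = S.band s₁ t₁ ∪ S.band s₂ t₂ ∪ S.band s₃ t₃) := by
  obtain ⟨φm, ψp, ψm, φp, R⟩ := ha.exists_isRoots
  obtain ⟨o1, o2, o3, o4⟩ := ha.order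
  have hl := ha.level_lt_left
  have hl' := ha.lower
  have hp := ha.level_pos
  have hpos : ∀ t ∈ Icc 0 π, 0 ≤ a t := fun t ht => ha.nonneg ht
  have haw := Shell.Profile.continuousOn_mul_weight ha hH
  have mem0 : (0 : ℝ) ∈ Icc 0 π := ⟨le_rfl, Real.pi_pos.le⟩
  have memπ : π ∈ Icc 0 π := ⟨Real.pi_pos.le, le_rfl⟩
  have mem2 : φ₂ ∈ Icc 0 π := ⟨by linarith, by linarith⟩
  have cM : Continuous (S.excess a 0 φ₂) :=
    Shell.Profile.continuous_excess ha.continuous hpos haw mem0 mem2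
  have cP : Continuous (S.excess a φ₂ π) :=
    Shell.Profile.continuous_excess ha.continuous hpos haw mem2 memπ
  have aM : Antitone (S.excess a 0 φ₂) :=
    Shell.Profile.excess_antitone ha.continuous hpos haw mem0 mem2 mem2.1
  have aP : Antitone (S.excess a φ₂ π) :=
    Shell.Profile.excess_antitone ha.continuous hpos haw mem2 memπ mem2.2
  have cD : Continuous (S.deficit a (a φ₁) φ₁ φ₃) :=
    Shell.Profile.continuous_deficit ha.continuous (hp.trans hl).le hpos ⟨o1, by linarith⟩
      ⟨by linarith, o4⟩
  have eM : ∀ α ∈ Icc (a φ₂) (a φ₁), S.levelInt a α (φm α) (ψp α) = S.excess a 0 φ₂ α :=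
    fun α h => (S.excess_left_eq_roots ha R h).symm
  have eP : ∀ α ∈ Icc (a φ₂) (a φ₁), S.levelInt a α (ψm α) (φp α) = S.excess a φ₂ π α :=
    fun α h => (S.excess_right_eq_roots ha R ⟨h.1, h.2.trans hl'.le⟩).symm
  have eD : ∀ α ∈ Icc (a φ₂) (a φ₁),
      -S.levelInt a α (ψp α) (ψm α) = S.deficit a (a φ₁) φ₁ φ₃ α :=
    fun α h => (S.deficit_eq_roots ha R h).symm
  have hβc := Shell.Profile.betaC_eq ha hH
  obtain ⟨αs, hαs, hcrit⟩ := Shell.Profile.exists_critical_level ha cM cP cD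
  have pM := S.excess_left_pos ha (α := αs) ⟨hαs.1.le, hαs.2⟩
  have pP := S.excess_right_pos ha (α := αs) ⟨hαs.1.le, hαs.2.trans hl'⟩
  have topM := S.excess_left_top ha
  have topP := S.excess_right_top ha
  have dmono : ∀ {α α' : ℝ}, a φ₂ < α' → α < α' → α' ≤ a φ₁ →
      S.deficit a (a φ₁) φ₁ φ₃ α < S.deficit a (a φ₁) φ₁ φ₃ α' := S.deficit_strictMono ha
  have bot : ∀ {α : ℝ}, α ≤ a φ₂ → S.deficit a (a φ₁) φ₁ φ₃ α = 0 := S.deficit_bottom ha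
  -- D is smaller than at αs, while M and P are at least as large as there. This holds for every α <
  -- αs, also below the valley, as the one-interval regime requires.
  have below : ∀ α < αs, S.deficit a (a φ₁) φ₁ φ₃ α <
      min (S.excess a 0 φ₂ α) (S.excess a φ₂ π α) := fun α h =>
    (dmono hαs.1 h hαs.2.le).trans_le (hcrit.le.trans (min_le_min (aM h.le) (aP h.le)))
  set fM := S.excess a 0 φ₂
  set fP := S.excess a φ₂ π
  set fD := S.deficit a (a φ₁) φ₁ φ₃
  have hmm : αs ∈ Icc (a φ₂) (a φ₁) := ⟨hαs.1.le, hαs.2.le⟩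
  have hβ₁c : max (fM αs) (fP αs) < S.betaC a := by
    have h1 := aM (by linarith [hαs.1] : (0 : ℝ) ≤ αs)
    have h2 := aP (by linarith [hαs.1] : (0 : ℝ) ≤ αs)
    rw [hβc]
    exact max_lt (by linarith) (by linarith)
  -- one interval
  have one : ∀ β ∈ Ioo (max (fM αs) (fP αs)) (S.betaC a), ∃ V, S.IsTheSolution H β V ∧
      ∃ s t : ℝ, 0 < s ∧ s < t ∧ t < π ∧ S.SC β V = S.band s t := by
    intro β hβ
    -- The total gain M + P - D equals β_c at level 0, where the valley is empty, and max(M, P) at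
    -- αs, where D = min(M, P).
    have hc : Continuous fun α => fM α + fP α - fD α := (cM.add cP).sub cD
    have hiv := intermediate_value_Ioo' (by linarith [hαs.1] : (0 : ℝ) ≤ αs)
      (hc.continuousOn (s := Icc 0 αs))
    have h0 : fM 0 + fP 0 - fD 0 = S.betaC a := by rw [hβc, bot hp.le, sub_zero]
    have h1 : fM αs + fP αs - fD αs = max (fM αs) (fP αs) := by
      rw [hcrit, ← min_add_max (fM αs) (fP αs)]
      ring
    rw [h0, h1] at hiv
    obtain ⟨α, hα, hαβ⟩ := hiv hβ
    have hb := lt_min_iff.1 (below α hα.2)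
    have hα1 : α < a φ₁ := hα.2.trans hαs.2
    obtain ⟨V, hV, hSC⟩ := Shell.Profile.exists_solution_one ha R hH hα.1 hα1
      (pM.trans_le ((le_max_left _ _).trans hβ.1.le)) hb.1 hb.2 hαβ
    have b1 := R.φm_lt hα.1.le hα1
    have b2 := R.lt_φp hα.1.le (hα1.trans hl')
    exact ⟨V, hV, φm α, φp α, R.φm_pos ha hα.1 hα1.le, by linarith,
      R.φp_lt ha hα.1 (hα1.trans hl').le, hSC⟩
  -- levels of the peaks and of the valley
  have levelM : ∀ β, 0 < β → β ≤ fM αs → ∃ α, αs ≤ α ∧ α < a φ₁ ∧ fM α = β := by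
    intro β h1 h2
    have hiv := intermediate_value_Ico' hαs.2.le (cM.continuousOn (s := Icc αs (a φ₁)))
    rw [topM] at hiv
    obtain ⟨α, hα, h⟩ := hiv ⟨h1, h2⟩
    exact ⟨α, hα.1, hα.2, h⟩
  have levelP : ∀ β, 0 < β → β ≤ fP αs → ∃ α, αs ≤ α ∧ α < a φ₃ ∧ fP α = β := by
    intro β h1 h2
    have hiv := intermediate_value_Ico' (hαs.2.trans hl').le
      (cP.continuousOn (s := Icc αs (a φ₃)))
    rw [topP] at hiv
    obtain ⟨α, hα, h⟩ := hiv ⟨h1, h2⟩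
    exact ⟨α, hα.1, hα.2, h⟩
  have levelD : ∀ β, 0 < β → β ≤ fD αs → ∃ α, a φ₂ < α ∧ α ≤ αs ∧ fD α = β := by
    intro β h1 h2
    have hiv := intermediate_value_Ioc hαs.1.le (cD.continuousOn (s := Icc (a φ₂) αs))
    rw [bot le_rfl] at hiv
    obtain ⟨α, hα, h⟩ := hiv ⟨h1, h2⟩
    exact ⟨α, hα.1, hα.2, h⟩
  have c0 : 0 < αs := hp.trans hαs.1
  have hαs3 : αs < a φ₃ := hαs.2.trans hl'
  have r1 := R.φm_pos ha c0 hαs.2.le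
  have r2 := R.φm_lt c0.le hαs.2
  have r3 := R.lt_ψp hαs.1.le hαs.2
  have r4 := R.ψp_lt hαs.1 hαs.2.le
  have r5 := R.lt_ψm hαs.1 hαs3.le
  have r6 := R.ψm_lt hαs.1.le hαs3
  have r7 := R.lt_φp c0.le hαs3
  have r8 := R.φp_lt ha c0 hαs3.le
  -- two intervals
  have two : ∃ s₀ t₀ : ℝ, 0 < s₀ ∧ s₀ < t₀ ∧ t₀ < π ∧
      ∀ β ∈ Ioc (min (fM αs) (fP αs)) (max (fM αs) (fP αs)), ∃ V, S.IsTheSolution H β V ∧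
        (β < max (fM αs) (fP αs) → ∃ s t : ℝ, 0 < s ∧ s < t ∧ t < π ∧ (t₀ < s ∨ t < s₀) ∧
          S.SC β V = S.band s₀ t₀ ∪ S.band s t) := by
    -- The smaller of the two peaks at level αs is the one that cancels the valley, and this decides
    -- whether the fixed interval lies on the left or on the right.
    rcases le_total (fM αs) (fP αs) with h | h
    · rw [min_eq_left h, max_eq_right h]
      rw [min_eq_left h] at hcrit
      refine ⟨φm αs, ψm αs, r1, by linarith, by linarith, fun β hβ => ?_⟩
      have hβ0 : 0 < β := pM.trans hβ.1
      obtain ⟨α, hα1, hα2, hαβ⟩ := levelP β hβ0 hβ.2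
      obtain ⟨V, hV, hSC⟩ := Shell.Profile.exists_solution_two ha R hH hαs hα1 hα2 hβ0 hcrit hβ.1
        hαβ
      refine ⟨V, hV, fun hlt => ⟨ψm α, φp α, ?_, ?_, R.φp_lt ha (c0.trans_le hα1) hα2.le,
        Or.inl ?_, hSC⟩⟩
      · linarith [R.lt_ψm (hαs.1.trans_le hα1) hα2.le]
      · linarith [R.ψm_lt (hαs.1.trans_le hα1).le hα2, R.lt_φp (c0.trans_le hα1).le hα2]
      -- The closures are disjoint as soon as α ≠ αs; equality would give β = P(αs), which is the
      -- upper threshold in this case.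
      · refine R.ψm_strictMono ha hαs.1.le (lt_of_le_of_ne hα1 ?_) hα2.le
        rintro rfl
        exact hlt.ne hαβ.symm
    · rw [min_eq_right h, max_eq_left h]
      rw [min_eq_right h] at hcrit
      refine ⟨ψp αs, φp αs, by linarith, by linarith, r8, fun β hβ => ?_⟩
      have hβ0 : 0 < β := pP.trans hβ.1
      obtain ⟨α, hα1, hα2, hαβ⟩ := levelM β hβ0 hβ.2
      obtain ⟨V, hV, hSC⟩ := Shell.Profile.exists_solution_two' ha R hH hαs hα1 hα2 hβ0 hcrit
        hβ.1 hαβ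
      have b1 := R.φm_lt (c0.trans_le hα1).le hα2
      have b2 := R.lt_ψp (hαs.1.trans_le hα1).le hα2
      have b3 := R.ψp_lt (hαs.1.trans_le hα1) hα2.le
      refine ⟨V, hV, fun hlt => ⟨φm α, ψp α, R.φm_pos ha (c0.trans_le hα1) hα2.le, by linarith,
        by linarith, Or.inr ?_, by rw [hSC, union_comm]⟩⟩
      refine R.ψp_strictAnti ha hαs.1.le (lt_of_le_of_ne hα1 ?_) hα2.le
      rintro rfl
      exact hlt.ne hαβ.symm
  -- three intervals
  have three : ∀ β ∈ Ioc 0 (min (fM αs) (fP αs)), ∃ V, S.IsTheSolution H β V ∧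
      (β < min (fM αs) (fP αs) → ∃ s₁ t₁ s₂ t₂ s₃ t₃ : ℝ,
        0 < s₁ ∧ s₁ < t₁ ∧ t₁ < s₂ ∧ s₂ < t₂ ∧ t₂ < s₃ ∧ s₃ < t₃ ∧ t₃ < π ∧
        S.SC β V = S.band s₁ t₁ ∪ S.band s₂ t₂ ∪ S.band s₃ t₃) := by
    intro β hβ
    obtain ⟨α₁, h1, h1', e1⟩ := levelM β hβ.1 (hβ.2.trans (min_le_left _ _))
    obtain ⟨α₂, h2, h2', e2⟩ := levelD β hβ.1 (hβ.2.trans hcrit.ge)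
    obtain ⟨α₃, h3, h3', e3⟩ := levelP β hβ.1 (hβ.2.trans (min_le_right _ _))
    obtain ⟨V, hV, hSC⟩ := Shell.Profile.exists_solution_three ha R hH h2 (h2'.trans h1) h1'
      (h2'.trans h3) h3' hβ.1 e1 e2 e3
    refine ⟨V, hV, fun hlt => ⟨φm α₁, ψp α₁, ψp α₂, ψm α₂, ψm α₃, φp α₃,
      R.φm_pos ha (c0.trans_le h1) h1'.le, ?_, ?_, ?_, ?_, ?_, R.φp_lt ha (c0.trans_le h3) h3'.le,
      hSC⟩⟩
    · linarith [R.φm_lt (c0.trans_le h1).le h1', R.lt_ψp (hαs.1.trans_le h1).le h1']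
    -- The levels of the left peak and of the valley are separated by αs, and α₂ = αs would force β
    -- = D(αs), the lower threshold.
    · refine R.ψp_strictAnti ha h2.le (lt_of_lt_of_le (lt_of_le_of_ne h2' ?_) h1) h1'.le
      rintro rfl
      exact hlt.ne (e2.symm.trans hcrit)
    · linarith [R.ψp_lt h2 (h2'.trans hαs.2.le), R.lt_ψm h2 (h2'.trans hαs3.le)]
    · refine R.ψm_strictMono ha h2.le (lt_of_lt_of_le (lt_of_le_of_ne h2' ?_) h3) h3'.le
      rintro rfl
      exact hlt.ne (e2.symm.trans hcrit)
    · linarith [R.ψm_lt (hαs.1.trans_le h3).le h3', R.lt_φp (c0.trans_le h3).le h3']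
  obtain ⟨s₀, t₀, hs₀, hst₀, ht₀, htwo⟩ := two
  -- The threshold values of β are included, since a solution is required for every β below β_c; the
  -- shape of the free region is recorded only away from them.
  have all : ∀ β ∈ Ioo 0 (S.betaC a), ∃ V, S.IsTheSolution H β V ∧
      (max (fM αs) (fP αs) < β → ∃ s t : ℝ, 0 < s ∧ s < t ∧ t < π ∧ S.SC β V = S.band s t) ∧
      (min (fM αs) (fP αs) < β → β < max (fM αs) (fP αs) → ∃ s t : ℝ, 0 < s ∧ s < t ∧ t < π ∧
        (t₀ < s ∨ t < s₀) ∧ S.SC β V = S.band s₀ t₀ ∪ S.band s t) ∧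
      (β < min (fM αs) (fP αs) → ∃ s₁ t₁ s₂ t₂ s₃ t₃ : ℝ,
        0 < s₁ ∧ s₁ < t₁ ∧ t₁ < s₂ ∧ s₂ < t₂ ∧ t₂ < s₃ ∧ s₃ < t₃ ∧ t₃ < π ∧
        S.SC β V = S.band s₁ t₁ ∪ S.band s₂ t₂ ∪ S.band s₃ t₃) := by
    intro β hβ
    have hle : min (fM αs) (fP αs) ≤ max (fM αs) (fP αs) := min_le_max
    rcases le_or_gt β (min (fM αs) (fP αs)) with h | h
    · obtain ⟨V, hV, h3⟩ := three β ⟨hβ.1, h⟩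
      exact ⟨V, hV, fun h' => absurd (h.trans hle) h'.not_ge, fun h' => absurd h h'.not_ge, h3⟩
    rcases le_or_gt β (max (fM αs) (fP αs)) with h' | h'
    · obtain ⟨V, hV, h2⟩ := htwo β ⟨h, h'⟩
      exact ⟨V, hV, fun h'' => absurd h' h''.not_ge, fun _ => h2, fun h'' => absurd h h''.not_gt⟩
    · obtain ⟨V, hV, h1⟩ := one β ⟨h', hβ.2⟩
      exact ⟨V, hV, fun _ => h1, fun _ h'' => absurd h' h''.not_gt, fun h'' => absurd h h''.not_gt⟩
  choose! V hV hV1 hV2 hV3 using all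
  refine ⟨φm, ψp, ψm, φp, ?_, fun α => S.levelInt a α (φm α) (ψp α),
    fun α => S.levelInt a α (ψm α) (φp α), fun α => -S.levelInt a α (ψp α) (ψm α),
    fun _ => rfl, fun _ => rfl, fun _ => rfl, αs, hαs, ?_, ?_, _, _, rfl, rfl, ?_, min_le_max, ?_,
    V, hV, ?_, ⟨s₀, t₀, hs₀, hst₀, ht₀, ?_⟩, ?_⟩
  · intro α hα
    have h0 : 0 < α := hp.trans hα.1
    have h3 : α < a φ₃ := hα.2.trans hl'
    have b2 := R.φm_lt h0.le hα.2
    have b3 := R.lt_ψp hα.1.le hα.2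
    have b4 := R.ψp_lt hα.1 hα.2.le
    have b5 := R.lt_ψm hα.1 h3.le
    have b6 := R.ψm_lt hα.1.le h3
    have b7 := R.lt_φp h0.le h3
    exact ⟨by linarith, by linarith, by linarith, R.levelSet_eq ha hα.1 hα.2⟩
  · intro α hα
    have hm : α ∈ Icc (a φ₂) (a φ₁) := ⟨hα.1.le, hα.2.le.trans hαs.2.le⟩
    simp only [eM α hm, eP α hm, eD α hm]
    exact below α hα.2
  · intro α hα
    have hm : α ∈ Icc (a φ₂) (a φ₁) := ⟨hαs.1.le.trans hα.1.le, hα.2.le⟩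
    simp only [eM α hm, eP α hm, eD α hm]
    exact (min_le_min (aM hα.1.le) (aP hα.1.le)).trans_lt
      (hcrit.ge.trans_lt (dmono (hαs.1.trans hα.1) hα.1 hα.2.le))
  · simp only [eM αs hmm, eP αs hmm]
    exact lt_min pM pP
  · simp only [eM αs hmm, eP αs hmm]
    exact hβ₁c
  · simp only [eM αs hmm, eP αs hmm]
    intro β hβ
    exact hV1 β ⟨(pM.trans_le (le_max_left _ _)).trans hβ.1, hβ.2⟩ hβ.1
  · simp only [eM αs hmm, eP αs hmm]
    intro β hβ
    exact hV2 β ⟨(lt_min pM pP).trans hβ.1, hβ.2.trans hβ₁c⟩ hβ.1 hβ.2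
  · simp only [eM αs hmm, eP αs hmm]
    intro β hβ
    exact hV3 β ⟨hβ.1, hβ.2.trans (min_le_max.trans_lt hβ₁c)⟩ hβ.2
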